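/- Let $q$ be a prime power, $\mathbb R_\infty=\mathbb F_q((1/\theta))$ and $\mathbb C_\infty$ the completion of an algebraic closure of $\mathbb R_\infty$; fix $n$ and $\omega\in\mathbb F_{q^2}\setminus\mathbb F_q\subset\mathbb C_\infty$. Let $\mathbb C_\infty[T,\tau]$ be the ring of non-commutative polynomials with $Ta=aT$, $T\tau=\tau T$, $\tau a=a^q\tau$ for $a\in\mathbb C_\infty$. For $A\in M_n(\mathbb C_\infty)$ let $M(A)$ be the T-motive, i.e. the left $\mathbb C_\infty[T,\tau]$-module, generated by $e_*=(e_1,\dots,e_n)^t$ with the relations $Te_*=\theta e_*+A\tau e_*+\tau^2e_*$. Write $X^{(i)}$ for the vector or matrix $X$ with all entries raised to the power $q^i$. The exponential map of $M(A)$ is $\mathrm{Exp}_A(z)=\sum_{i\ge 0}C_iz^{(i)}$ on $\mathbb C_\infty^n$, where $C_0=E_n$ (the identity matrix) and $\mathrm{Exp}_A(\theta z)=\theta\,\mathrm{Exp}_A(z)+A\,\mathrm{Exp}_A(z)^{(1)}+\mathrm{Exp}_A(z)^{(2)}$. $M(A)$ is uniformizable if $\mathrm{Exp}_A$ is surjective,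 and $L(M(A))=\ker\mathrm{Exp}_A$. A lattice of rank $r$ in $\mathbb C_\infty^n$ is a free $\mathbb F_q[\theta]$-submodule of rank $r$ which spans $\mathbb C_\infty^n$ over $\mathbb C_\infty$ and whose $\mathbb R_\infty$-span has dimension $r$ over $\mathbb R_\infty$. The Siegel matrix of an $\mathbb F_q[\theta]$-basis $l_1,\dots,l_{2n}$ of a lattice of rank $2n$ such that $l_1,\dots,l_n$ is a $\mathbb C_\infty$-basis of $\mathbb C_\infty^n$ is the matrix $Z=(z_{ij})\in M_n(\mathbb C_\infty)$ with $l_{n+i}=\sum_j z_{ij}l_j$. Let $y_0$ be a nonzero root of smallest absolute value of $\mathrm{Exp}_0$ for $n=1$. Put $l_{0,i}=y_0\epsilon_i$ and $l_{0,n+i}=\omega y_0\epsilon_i$ for $1\le i\le n$, where $\epsilon_1,\dots,\epsilon_n$ is the standard basis of $\mathbb C_\infty^n$. (These vectors form a basis of $L(M(0))$, with Siegel matrix $\omega E_n$.) Let $\mathfrak U_1$ be the set of all $A\in M_n(\mathbb C_\infty)$ such that $M(A)$ is uniformizable, $L(M(A))$ is a lattice of rank $2n$, for every $j$ there is exactly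 one $l_j\in L(M(A))$ close to $l_{0,j}$, namely with $\|l_j-l_{0,j}\|<|y_0|$ in the maximum norm, and $l_1,\dots,l_{2n}$ is an $\mathbb F_q[\theta]$-basis of $L(M(A))$ whose first $n$ vectors form a $\mathbb C_\infty$-basis of $\mathbb C_\infty^n$. For $A\in\mathfrak U_1$ let $\mu_{13}(A)$ be the Siegel matrix of $l_1,\dots,l_{2n}$. For $\gamma=\begin{pmatrix}a&b\\c&d\end{pmatrix}\in GL_{2n}(\mathbb F_q[\theta])$ with $n\times n$ blocks put $\gamma(Z)=(aZ+b)(cZ+d)^{-1}$, and let the degree of $\gamma$ be the highest degree in $\theta$ of its entries. Let $\mathfrak S_0$ be the group of all $\gamma\in GL_{2n}(\mathbb F_q[\theta])$ with $\gamma(\omega E_n)=\omega E_n$. **Theorem.** For every $k\ge 0$ there is an open neighbourhood $U_k$ of $0$ in $M_n(\mathbb C_\infty)$ with $U_k\subset\mathfrak U_1$ (in particular, $\mu_{13}$ is defined on $U_k$) such that the following holds: if $A,B\in U_k$ and $\mu_{13}(A)=\gamma(\mu_{13}(B))$ for some $\gamma\in\mathfrak S_0$ of degree $\le k$, then $M(A)$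 and $M(B)$ are isomorphic as left $\mathbb C_\infty[T,\tau]$-modules. -/

import Mathlib

open scoped Polynomial NNReal Topology

noncomputable section

namespace TMotive

/-! ## The fields `R_∞ = F_q((1/θ))` and `C_∞`

`F` is the finite field with `q` elements; `F[X]` is `F_q[θ]`, with `X` in the role of `θ`. -/

/-- `R_∞ = F_q((1/θ))`, the completion of `F_q(θ)` at the place `∞`. -/
abbrev RInfty (F : Type*) [Field F] : Type _ :=
  @RatFunc.CompletionAtInfty F _ (Classical.decEq _)

instance instValuedRInfty (F : Type*) [Field F] :
    Valued (RInfty F) (WithZero (Multiplicative ℤ)) :=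
  @RatFunc.CompletionAtInfty.instValuedWithZeroMultiplicativeInt F _ (Classical.decEq _)

theorem one_lt_card (F : Type*) [Field F] [Finite F] : (1 : ℝ≥0) < (Nat.card F : ℝ≥0) := by
  exact_mod_cast Finite.one_lt_card (α := F)

theorem valued_theta (F : Type*) [Field F] :
    Valued.v (algebraMap (RatFunc F) (RInfty F) RatFunc.X) = WithZero.exp (1 : ℤ) := by
  let _ : DecidableEq (RatFunc F) := Classical.decEq _
  let _ : Valued (RatFunc F) (WithZero (Multiplicative ℤ)) := RatFunc.inftyValued F
  exact (Valued.valuedCompletion_apply (RatFunc.X : RatFunc F)).trans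
    (RatFunc.inftyValuation.X F)

/-- The absolute value on `R_∞` is normalised by `|θ| = q`. -/
instance instRankOneRInfty (F : Type*) [Field F] [Finite F] :
    Valuation.RankOne (Valued.v : Valuation (RInfty F) (WithZero (Multiplicative ℤ))) where
  hom' := (WithZeroMulInt.toNNReal (one_lt_card F).ne_zero).comp
    MonoidWithZeroHom.ValueGroup₀.embedding
  strictMono' := (WithZeroMulInt.toNNReal_strictMono (one_lt_card F)).comp
    MonoidWithZeroHom.ValueGroup₀.embedding_strictMono
  exists_val_nontrivial := ⟨algebraMap (RatFunc F) (RInfty F) RatFunc.X, by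
    rw [valued_theta]; simp⟩

instance instNormRInfty (F : Type*) [Field F] [Finite F] : NontriviallyNormedField (RInfty F) :=
  Valued.toNontriviallyNormedField (RInfty F) _

instance instUltraRInfty (F : Type*) [Field F] [Finite F] : IsUltrametricDist (RInfty F) :=
  inferInstance

instance instCompleteRInfty (F : Type*) [Field F] [Finite F] : CompleteSpace (RInfty F) :=
  @UniformSpace.Completion.completeSpace (RatFunc F)
    (@RatFunc.inftyValued F _ (Classical.decEq _)).toUniformSpace

/-- The algebraic closure of `R_∞`. -/
abbrev AlgClRInfty (F : Type*) [Field F] : Type _ := AlgebraicClosure (RInfty F)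

/-- The algebraic closure of `R_∞` with the unique extension of the absolute value of `R_∞`. -/
instance instNormAlgCl (F : Type*) [Field F] [Finite F] : NormedField (AlgClRInfty F) :=
  spectralNorm.normedField (RInfty F) (AlgClRInfty F)

instance instNormedAlgebraAlgCl (F : Type*) [Field F] [Finite F] :
    NormedAlgebra (RInfty F) (AlgClRInfty F) :=
  spectralNorm.normedAlgebra (RInfty F) (AlgClRInfty F)

/-- `C_∞`, the completion of the algebraic closure of `R_∞`. -/
def CInfty (F : Type*) [Field F] [Finite F] : Type _ :=
  UniformSpace.Completion (AlgClRInfty F)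

instance instNormCInfty (F : Type*) [Field F] [Finite F] : NormedField (CInfty F) :=
  inferInstanceAs (NormedField (UniformSpace.Completion (AlgClRInfty F)))

instance instCompleteCInfty (F : Type*) [Field F] [Finite F] : CompleteSpace (CInfty F) :=
  inferInstanceAs (CompleteSpace (UniformSpace.Completion (AlgClRInfty F)))

instance instNormedAlgebraCInfty (F : Type*) [Field F] [Finite F] :
    NormedAlgebra (RInfty F) (CInfty F) :=
  inferInstanceAs (NormedAlgebra (RInfty F) (UniformSpace.Completion (AlgClRInfty F)))

/-- The inclusion `F_q[θ] ⊂ F_q(θ) ⊂ R_∞ ⊂ C_∞`. -/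
def polyHom (F : Type*) [Field F] [Finite F] : F[X] →+* CInfty F :=
  (algebraMap (RInfty F) (CInfty F)).comp
    ((algebraMap (RatFunc F) (RInfty F)).comp (algebraMap F[X] (RatFunc F)))

theorem polyHom_injective (F : Type*) [Field F] [Finite F] :
    Function.Injective (polyHom F) :=
  (algebraMap (RInfty F) (CInfty F)).injective.comp
    ((algebraMap (RatFunc F) (RInfty F)).injective.comp (RatFunc.algebraMap_injective F))

instance instAlgebraPoly (F : Type*) [Field F] [Finite F] : Algebra F[X] (CInfty F) :=
  (polyHom F).toAlgebra

instance instAlgebraConst (F : Type*) [Field F] [Finite F] : Algebra F (CInfty F) :=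
  ((polyHom F).comp Polynomial.C).toAlgebra

/-- The element `θ` of `C_∞`. -/
def theta (F : Type*) [Field F] [Finite F] : CInfty F := algebraMap F[X] (CInfty F) Polynomial.X

/-- The `i`-th power `a ↦ a ^ (q ^ i)` of the Frobenius of `C_∞`. -/
def frob (F : Type*) [Field F] [Finite F] (i : ℕ) : CInfty F →+* CInfty F :=
  letI := Fintype.ofFinite F
  { toFun := fun a => a ^ (Nat.card F ^ i)
    map_one' := one_pow _
    map_mul' := fun a b => mul_pow a b _
    map_zero' := zero_pow (pow_pos Nat.card_pos i).ne'
    map_add' := fun a b => by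
      have h : ∀ c : CInfty F, c ^ (Nat.card F ^ i) =
          ((FiniteField.frobeniusAlgHom F (CInfty F)) ^ i) c := by
        intro c
        rw [AlgHom.coe_pow, FiniteField.coe_frobeniusAlgHom, pow_iterate, Nat.card_eq_fintype_card]
      rw [h, h, h, map_add] }

theorem frob_apply (F : Type*) [Field F] [Finite F] (i : ℕ) (a : CInfty F) :
    frob F i a = a ^ (Nat.card F ^ i) := rfl

theorem continuous_frob (F : Type*) [Field F] [Finite F] (i : ℕ) : Continuous (frob F i) :=
  continuous_pow (Nat.card F ^ i)

theorem frob_add_apply (F : Type*) [Field F] [Finite F] (i j : ℕ) (a : CInfty F) :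
    frob F (i + j) a = frob F i (frob F j a) := by
  rw [frob_apply, frob_apply, frob_apply, ← pow_mul, ← pow_add, add_comm]

theorem frob_zero_apply (F : Type*) [Field F] [Finite F] (a : CInfty F) : frob F 0 a = a := by
  rw [frob_apply, pow_zero, pow_one]

/-! ## The Anderson ring and the T-motive `M(A)` -/

/-- `τ` acts on `C_∞` by `a ↦ a ^ q`. -/
instance instFrobAction (F : Type*) [Field F] [Finite F] :
    MulSemiringAction (Multiplicative ℕ) (CInfty F) where
  smul m a := frob F m.toAdd a
  one_smul a := frob_zero_apply F a
  mul_smul m k a := frob_add_apply F m.toAdd k.toAdd a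
  smul_zero m := map_zero (frob F m.toAdd)
  smul_add m a b := map_add (frob F m.toAdd) a b
  smul_one m := map_one (frob F m.toAdd)
  smul_mul m a b := map_mul (frob F m.toAdd) a b

/-- The Anderson ring `C_∞[T, τ]`: polynomials in a central variable `T` over the skew polynomial
ring `C_∞[τ]`, in which `τ a = a ^ q τ`. -/
abbrev AndersonRing (F : Type*) [Field F] [Finite F] : Type _ :=
  Polynomial (SkewPolynomial (CInfty F))

/-- The variable `T` of the Anderson ring. -/
def andT (F : Type*) [Field F] [Finite F] : AndersonRing F := Polynomial.X

/-- The variable `τ` of the Anderson ring. -/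
def andTau (F : Type*) [Field F] [Finite F] : AndersonRing F := Polynomial.C SkewPolynomial.X

/-- The inclusion of `C_∞` into the Anderson ring. -/
def andConst (F : Type*) [Field F] [Finite F] : CInfty F →+* AndersonRing F :=
  Polynomial.C.comp SkewPolynomial.CRingHom

/-- The relation `T e_i - (θ e_i + ∑ j, A_ij τ e_j + τ ^ 2 e_i)` in the free left module with basis
`e_1, ..., e_n`. -/
def motiveRel {F : Type*} [Field F] [Finite F] {n : ℕ}
    (A : Matrix (Fin n) (Fin n) (CInfty F)) (i : Fin n) : Fin n → AndersonRing F :=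
  andT F • Pi.single i 1 -
    (andConst F (theta F) • Pi.single i 1
      + ∑ j, (andConst F (A i j) * andTau F) • Pi.single j 1
      + andTau F ^ 2 • Pi.single i 1)

/-- The T-motive `M(A)`: the left `C_∞[T, τ]`-module with generators `e_1, ..., e_n` and relations
`T e_* = θ e_* + A τ e_* + τ ^ 2 e_*`. -/
abbrev Motive {F : Type*} [Field F] [Finite F] {n : ℕ}
    (A : Matrix (Fin n) (Fin n) (CInfty F)) : Type _ :=
  (Fin n → AndersonRing F) ⧸ Submodule.span (AndersonRing F) (Set.range (motiveRel A))

/-! ## The exponential map and the lattice of `M(A)` -/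

/-- `z ↦ z^{(i)}` on column vectors: every coordinate is raised to the power `q ^ i`. -/
def vecFrob {F : Type*} [Field F] [Finite F] {n : ℕ} (i : ℕ) (z : Fin n → CInfty F) :
    Fin n → CInfty F :=
  fun j => frob F i (z j)

/-- The coefficients `C_i` of the exponential map of `M(A)`. In the coordinates of `Lie(M(A))` given
by the basis `e_*`, the variable `T` acts on the t-module of `M(A)` by
`x ↦ θ x + A x^{(1)} + x^{(2)}` and on `Lie(M(A))` by `θ`. Hence `C_0 = 1`, and comparing the
coefficients of `z^{(i)}` in `Exp(θ z) = θ Exp(z) + A Exp(z)^{(1)} + Exp(z)^{(2)}` gives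
`(θ^{q^i} - θ) C_i = A C_{i-1}^{(1)} + C_{i-2}^{(2)}`. -/
def expCoeff {F : Type*} [Field F] [Finite F] {n : ℕ} (A : Matrix (Fin n) (Fin n) (CInfty F)) :
    ℕ → Matrix (Fin n) (Fin n) (CInfty F)
  | 0 => 1
  | 1 => (frob F 1 (theta F) - theta F)⁻¹ • A
  | i + 2 => (frob F (i + 2) (theta F) - theta F)⁻¹ •
      (A * (expCoeff A (i + 1)).map (frob F 1) + (expCoeff A i).map (frob F 2))

/-- The term `C_i z^{(i)}` of the series `Exp(z)`. -/
def expTerm {F : Type*} [Field F] [Finite F] {n : ℕ} (A : Matrix (Fin n) (Fin n) (CInfty F))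
    (z : Fin n → CInfty F) (i : ℕ) : Fin n → CInfty F :=
  (expCoeff A i).mulVec (vecFrob i z)

/-- `Exp(z) = w` for the exponential map `Exp` of `M(A)`. -/
def ExpEq {F : Type*} [Field F] [Finite F] {n : ℕ} (A : Matrix (Fin n) (Fin n) (CInfty F))
    (z w : Fin n → CInfty F) : Prop :=
  HasSum (expTerm A z) w

theorem frob_theta_ne (F : Type*) [Field F] [Finite F] {i : ℕ} (hi : i ≠ 0) :
    frob F i (theta F) - theta F ≠ 0 := by
  intro h
  have h1 : polyHom F (Polynomial.X ^ (Nat.card F ^ i)) = polyHom F Polynomial.X := by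
    rw [map_pow]
    exact sub_eq_zero.mp h
  have h2 := congrArg Polynomial.natDegree (polyHom_injective F h1)
  rw [Polynomial.natDegree_X_pow, Polynomial.natDegree_X] at h2
  exact (Nat.one_lt_pow hi (Finite.one_lt_card (α := F))).ne' h2

theorem ExpEq.add {F : Type*} [Field F] [Finite F] {n : ℕ}
    {A : Matrix (Fin n) (Fin n) (CInfty F)} {z z' w w' : Fin n → CInfty F}
    (h : ExpEq A z w) (h' : ExpEq A z' w') : ExpEq A (z + z') (w + w') := by
  have : expTerm A (z + z') = fun i => expTerm A z i + expTerm A z' i := by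
    funext i
    rw [expTerm, expTerm, expTerm, ← Matrix.mulVec_add]
    congr 1
    funext j
    exact map_add (frob F i) (z j) (z' j)
  rw [ExpEq, this]
  exact HasSum.add h h'

theorem ExpEq.const_smul {F : Type*} [Field F] [Finite F] {n : ℕ}
    {A : Matrix (Fin n) (Fin n) (CInfty F)} {z w : Fin n → CInfty F} (a : F)
    (h : ExpEq A z w) : ExpEq A ((algebraMap F (CInfty F) a) • z) ((algebraMap F (CInfty F) a) • w) := by
  have hc : ∀ i, frob F i (algebraMap F (CInfty F) a) = algebraMap F (CInfty F) a := by
    intro i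
    let _ := Fintype.ofFinite F
    rw [frob_apply, ← map_pow, Nat.card_eq_fintype_card, FiniteField.pow_card_pow]
  have : expTerm A ((algebraMap F (CInfty F) a) • z) =
      fun i => (algebraMap F (CInfty F) a) • expTerm A z i := by
    funext i
    rw [expTerm, expTerm, ← Matrix.mulVec_smul]
    congr 1
    funext j
    simp only [vecFrob, Pi.smul_apply, smul_eq_mul, map_mul, hc]
  rw [ExpEq, this]
  exact HasSum.const_smul _ h

theorem vecFrob_mulVec {F : Type*} [Field F] [Finite F] {n : ℕ} (k i : ℕ)
    (C : Matrix (Fin n) (Fin n) (CInfty F)) (z : Fin n → CInfty F) :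
    vecFrob k (C.mulVec (vecFrob i z)) = (C.map (frob F k)).mulVec (vecFrob (k + i) z) := by
  funext j
  simp only [vecFrob, Matrix.mulVec, dotProduct, map_sum, map_mul, Matrix.map_apply,
    frob_add_apply]

/-- The functional equation `Exp(θ z) = θ Exp(z) + A Exp(z)^{(1)} + Exp(z)^{(2)}`. -/
theorem ExpEq.theta_smul {F : Type*} [Field F] [Finite F] {n : ℕ}
    {A : Matrix (Fin n) (Fin n) (CInfty F)} {z w : Fin n → CInfty F}
    (h : ExpEq A z w) :
    ExpEq A (theta F • z) (theta F • w + A.mulVec (vecFrob 1 w) + vecFrob 2 w) := by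
  have hv : ∀ k, HasSum (fun i => vecFrob k (expTerm A z i)) (vecFrob k w) := fun k =>
    HasSum.map h
      ({ toFun := vecFrob k
         map_zero' := funext fun _ => map_zero (frob F k)
         map_add' := fun a b => funext fun j => map_add (frob F k) (a j) (b j) } :
        (Fin n → CInfty F) →+ (Fin n → CInfty F))
      (continuous_pi fun j => (continuous_frob F k).comp (continuous_apply j))
  have hA : HasSum (fun i => A.mulVec (vecFrob 1 (expTerm A z i))) (A.mulVec (vecFrob 1 w)) :=
    HasSum.map (hv 1) (A.mulVecLin.toAddMonoidHom) (continuous_const.matrix_mulVec continuous_id)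
  have hu : HasSum (fun i => theta F • expTerm A z i) (theta F • w) := HasSum.const_smul _ h
  have hA' : HasSum (fun i => Nat.casesOn (motive := fun _ => Fin n → CInfty F) i 0
      fun i => A.mulVec (vecFrob 1 (expTerm A z i))) (A.mulVec (vecFrob 1 w)) := by
    have := (hasSum_nat_add_iff (f := fun i => Nat.casesOn (motive := fun _ => Fin n → CInfty F) i 0
      fun i => A.mulVec (vecFrob 1 (expTerm A z i))) 1).mp hA
    simpa using this
  have h2' : HasSum (fun i => Nat.casesOn (motive := fun _ => Fin n → CInfty F) i 0
      fun i => Nat.casesOn (motive := fun _ => Fin n → CInfty F) i 0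
        fun i => vecFrob 2 (expTerm A z i)) (vecFrob 2 w) := by
    have := (hasSum_nat_add_iff (f := fun i => Nat.casesOn (motive := fun _ => Fin n → CInfty F) i 0
      fun i => Nat.casesOn (motive := fun _ => Fin n → CInfty F) i 0
        fun i => vecFrob 2 (expTerm A z i)) 2).mp (hv 2)
    simpa [Finset.sum_range_succ] using this
  have hs : ∀ i, vecFrob i (theta F • z) = frob F i (theta F) • vecFrob i z := fun i =>
    funext fun j => map_mul (frob F i) (theta F) (z j)
  have hterm : ∀ i, expTerm A (theta F • z) i = theta F • expTerm A z i +
      (frob F i (theta F) - theta F) • expTerm A z i := by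
    intro i
    rw [expTerm, hs, Matrix.mulVec_smul, ← add_smul, add_sub_cancel, expTerm]
  have key := (hu.add hA').add h2'
  rw [ExpEq]
  convert! key using 1
  funext i
  rw [hterm, add_assoc]
  congr 1
  match i with
  | 0 => simp [frob_zero_apply]
  | 1 =>
    have h0 : expTerm A z 0 = vecFrob 0 z := by simp [expTerm, expCoeff]
    have h1 : vecFrob 1 (vecFrob 0 z) = vecFrob 1 z :=
      funext fun j => (frob_add_apply F 1 0 (z j)).symm
    change _ = A.mulVec (vecFrob 1 (expTerm A z 0)) + 0
    rw [h0, h1, add_zero, expTerm, expCoeff, Matrix.smul_mulVec, smul_smul,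
      mul_inv_cancel₀ (frob_theta_ne F one_ne_zero), one_smul]
  | i + 2 =>
    simp only
    rw [expTerm, expCoeff, Matrix.smul_mulVec, smul_smul,
      mul_inv_cancel₀ (frob_theta_ne F (Nat.succ_ne_zero _)), one_smul, Matrix.add_mulVec,
      expTerm, expTerm, vecFrob_mulVec, vecFrob_mulVec, Matrix.mulVec_mulVec,
      show 1 + (i + 1) = i + 2 by omega, show 2 + i = i + 2 by omega]

theorem ExpEq.zero {F : Type*} [Field F] [Finite F] {n : ℕ}
    (A : Matrix (Fin n) (Fin n) (CInfty F)) : ExpEq A 0 0 := by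
  have : expTerm A 0 = fun _ => 0 := by
    funext i
    have : vecFrob i (0 : Fin n → CInfty F) = 0 := by
      funext j
      exact map_zero (frob F i)
    rw [expTerm, this, Matrix.mulVec_zero]
  rw [ExpEq, this]
  exact hasSum_zero

theorem ExpEq.poly_smul {F : Type*} [Field F] [Finite F] {n : ℕ}
    {A : Matrix (Fin n) (Fin n) (CInfty F)} (p : F[X]) {z : Fin n → CInfty F}
    (h : ExpEq A z 0) : ExpEq A (p • z) 0 := by
  induction p using Polynomial.induction_on with
  | C a =>
    have := h.const_smul a
    rw [smul_zero] at this
    rw [← algebraMap_smul (CInfty F) (Polynomial.C a) z]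
    exact this
  | add p p' hp hp' => simpa [add_smul] using hp.add hp'
  | monomial m a hm =>
    have hv : vecFrob 1 (0 : Fin n → CInfty F) = 0 ∧ vecFrob 2 (0 : Fin n → CInfty F) = 0 :=
      ⟨funext fun j => map_zero (frob F 1), funext fun j => map_zero (frob F 2)⟩
    have := hm.theta_smul
    rw [hv.1, hv.2, smul_zero, Matrix.mulVec_zero, add_zero, add_zero] at this
    rw [pow_succ', ← mul_assoc, mul_comm _ Polynomial.X, mul_assoc, mul_smul]
    rwa [theta, algebraMap_smul] at this

/-- The lattice `L(M(A))`: the kernel of the exponential map of `M(A)`, as an `F_q[θ]`-module. -/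
def motiveLattice {F : Type*} [Field F] [Finite F] {n : ℕ}
    (A : Matrix (Fin n) (Fin n) (CInfty F)) : Submodule F[X] (Fin n → CInfty F) where
  carrier := {z | ExpEq A z 0}
  zero_mem' := ExpEq.zero A
  add_mem' h h' := by simpa using ExpEq.add h h'
  smul_mem' p _ h := ExpEq.poly_smul p h

/-- `M(A)` is uniformizable: its exponential map is surjective. -/
def Uniformizable {F : Type*} [Field F] [Finite F] {n : ℕ}
    (A : Matrix (Fin n) (Fin n) (CInfty F)) : Prop :=
  ∀ w, ∃ z, ExpEq A z w

/-- A lattice of rank `r` in `C_∞ ^ n`. -/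
structure IsLattice {F : Type*} [Field F] [Finite F] {n : ℕ} (r : ℕ)
    (L : Submodule F[X] (Fin n → CInfty F)) : Prop where
  free : Nonempty (Module.Basis (Fin r) F[X] L)
  span_eq_top : Submodule.span (CInfty F) (L : Set (Fin n → CInfty F)) = ⊤
  finrank_eq : Module.finrank (RInfty F)
    (Submodule.span (RInfty F) (L : Set (Fin n → CInfty F))) = r

/-- `l` is an `F_q[θ]`-basis of `L`, and its first `n` vectors form a basis of `C_∞ ^ n`. -/
structure IsSiegelBasis {F : Type*} [Field F] [Finite F] {n : ℕ}
    (L : Submodule F[X] (Fin n → CInfty F)) (l : Fin n ⊕ Fin n → Fin n → CInfty F) : Prop where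
  linearIndependent : LinearIndependent F[X] l
  span_eq : Submodule.span F[X] (Set.range l) = L
  linearIndependent_inl : LinearIndependent (CInfty F) (fun i => l (Sum.inl i))

/-- The Siegel matrix `Z` of a basis `l`: the solution of `l_{n+i} = ∑ j, z_ij l_j`. -/
def siegelMatrix {F : Type*} [Field F] [Finite F] {n : ℕ}
    (l : Fin n ⊕ Fin n → Fin n → CInfty F) : Matrix (Fin n) (Fin n) (CInfty F) :=
  Matrix.of (fun i => l (Sum.inr i)) * (Matrix.of fun i => l (Sum.inl i))⁻¹

/-! ## The map from matrices `A` near `0` to Siegel matrices -/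

/-- `y₀` is a nonzero root of smallest absolute value of the exponential map
`Exp_0(z) = z + z^{q^2} / (θ^{q^2} - θ) + ...` of the module `M(0)` of dimension `1`. -/
def IsNearestRoot {F : Type*} [Field F] [Finite F] (y₀ : CInfty F) : Prop :=
  y₀ ≠ 0 ∧ ExpEq (0 : Matrix (Fin 1) (Fin 1) (CInfty F)) (fun _ => y₀) 0 ∧
    ∀ y : CInfty F, y ≠ 0 → ExpEq (0 : Matrix (Fin 1) (Fin 1) (CInfty F)) (fun _ => y) 0 →
      ‖y₀‖ ≤ ‖y‖

/-- The basis `l_{0,i} = y₀ (0, ..., 1, ..., 0)`, `l_{0,n+i} = ω l_{0,i}` of the lattice of `M(0)`;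
its Siegel matrix is `ω E_n`. -/
def baseVec {F : Type*} [Field F] [Finite F] (n : ℕ) (ω y₀ : CInfty F) :
    Fin n ⊕ Fin n → Fin n → CInfty F :=
  Sum.elim (fun i => Pi.single i y₀) (fun i => Pi.single i (ω * y₀))

/-- `x` is an element of `L(M(A))` close to `l_{0,j}`: its distance to `l_{0,j}` is less than the
minimal length `|y₀|` of a nonzero element of the lattice of `M(0)`. -/
def IsCloseVec {F : Type*} [Field F] [Finite F] {n : ℕ} (ω y₀ : CInfty F)
    (A : Matrix (Fin n) (Fin n) (CInfty F)) (j : Fin n ⊕ Fin n) (x : Fin n → CInfty F) : Prop :=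
  x ∈ motiveLattice A ∧ ‖x - baseVec n ω y₀ j‖ < ‖y₀‖

/-- The element `l_j` of `L(M(A))` close to `l_{0,j}` (a junk value if there is none). -/
def closeVec {F : Type*} [Field F] [Finite F] {n : ℕ} (ω y₀ : CInfty F)
    (A : Matrix (Fin n) (Fin n) (CInfty F)) (j : Fin n ⊕ Fin n) : Fin n → CInfty F :=
  Classical.epsilon (IsCloseVec ω y₀ A j)

/-- The domain of the map `mu13`: all `A` such that `M(A)` is uniformizable, its lattice has rank
`2n`, every `l_{0,j}` has exactly one close element `l_j` in it, and the `l_j` form a basis to which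
a Siegel matrix is attached. -/
def domain13 {F : Type*} [Field F] [Finite F] (n : ℕ) (ω y₀ : CInfty F) :
    Set (Matrix (Fin n) (Fin n) (CInfty F)) :=
  {A | Uniformizable A ∧ IsLattice (2 * n) (motiveLattice A) ∧
    (∀ j, ∃! x, IsCloseVec ω y₀ A j x) ∧ IsSiegelBasis (motiveLattice A) (closeVec ω y₀ A)}

/-- The map `μ₁₃`: it sends `A` to the Siegel matrix of the basis of `L(M(A))` that is close to the
basis `l_{0,1}, ..., l_{0,2n}` of the lattice of `M(0)`. -/
def mu13 {F : Type*} [Field F] [Finite F] {n : ℕ} (ω y₀ : CInfty F)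
    (A : Matrix (Fin n) (Fin n) (CInfty F)) : Matrix (Fin n) (Fin n) (CInfty F) :=
  siegelMatrix (closeVec ω y₀ A)

/-! ## The action of `GL_{2n}(F_q[θ])` on Siegel matrices -/

/-- `γ(Z) = (a Z + b) (c Z + d)⁻¹` for `γ` with blocks `a, b, c, d`. -/
def siegelAct {F : Type*} [Field F] [Finite F] {n : ℕ}
    (γ : Matrix.GeneralLinearGroup (Fin n ⊕ Fin n) F[X])
    (Z : Matrix (Fin n) (Fin n) (CInfty F)) : Matrix (Fin n) (Fin n) (CInfty F) :=
  let g : Matrix (Fin n ⊕ Fin n) (Fin n ⊕ Fin n) (CInfty F) :=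
    γ.val.map (algebraMap F[X] (CInfty F))
  (g.toBlocks₁₁ * Z + g.toBlocks₁₂) * (g.toBlocks₂₁ * Z + g.toBlocks₂₂)⁻¹

/-- The group `𝔖₀` of all `γ` that fix the Siegel matrix `ω E_n`. -/
def stabilizer0 {F : Type*} [Field F] [Finite F] (n : ℕ) (ω : CInfty F) :
    Set (Matrix.GeneralLinearGroup (Fin n ⊕ Fin n) F[X]) :=
  {γ | siegelAct γ (ω • 1) = ω • 1}

/-- The degree of `γ`: the highest degree in `θ` of its entries. -/
def glDegree {F : Type*} [Field F] {n : ℕ}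
    (γ : Matrix.GeneralLinearGroup (Fin n ⊕ Fin n) F[X]) : ℕ :=
  Finset.univ.sup fun i => Finset.univ.sup fun j => (γ.val i j).natDegree

end TMotive

end

/-!
The exponential of `M(A)` with `A` small is an isometry on a ball containing all shortest nonzero
lattice vectors of `M(0)`, so `L(M(A))` is generated by vectors close to the basis `l_{0,j}`. If
`Z_A = γ(Z_B)`, a `C_∞`-linear change of coordinates `Φ` maps `L(M(A))` onto `L(M(B))`, and there
is a unique additive power series `f = ∑ f_i z^{(i)}` with `f_0 = Φ` that formally intertwines the
actions of `T`. It converges on small vectors and satisfies `f ∘ Exp_A = Exp_B ∘ Φ` there, hence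
maps the `T`-torsion of `A` to the `T`-torsion of `B`. Comparing the terms of `T(f(t)) = 0` for
`n` independent torsion vectors `t` squares every bound `‖f_i‖ ≤ κ^{q^i}` to `‖f_i‖ ≤ (κ²)^{q^i}`,
for all large `i`. Iterating, `f_i = 0` for large `i`, so `f` is a matrix over `C_∞[τ]` commuting
with `T`. The series of `Φ⁻¹` gives an inverse, because an intertwiner over `C_∞[τ]` is determined
by its constant coefficient.
-/

noncomputable section

namespace TMotive

attribute [local instance] Matrix.normedAddCommGroup Matrix.normedSpace

instance isUltrametricDist_cInfty (F : Type*) [Field F] [Finite F] :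
    IsUltrametricDist (CInfty F) :=
  IsUltrametricDist.of_normedAlgebra (RInfty F)

/-! ### Ultrametric linear algebra -/

section Ultrametric

variable {l m o R : Type*} [Fintype l] [Fintype m] [Fintype o]

instance isUltrametricDist_matrix [NormedAddCommGroup R] [IsUltrametricDist R] :
    IsUltrametricDist (Matrix l m R) :=
  inferInstanceAs (IsUltrametricDist (l → m → R))

theorem norm_sub_le_max {E : Type*} [SeminormedAddGroup E] [IsUltrametricDist E] (x y : E) :
    ‖x - y‖ ≤ max ‖x‖ ‖y‖ := by
  rw [sub_eq_add_neg, ← norm_neg y]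
  exact IsUltrametricDist.norm_add_le_max x (-y)

theorem norm_mulVec_le [NonUnitalNormedRing R] [IsUltrametricDist R] (M : Matrix l m R)
    (v : m → R) : ‖M.mulVec v‖ ≤ ‖M‖ * ‖v‖ := by
  refine (pi_norm_le_iff_of_nonneg (by positivity)).mpr fun i => ?_
  refine IsUltrametricDist.norm_sum_le_of_forall_le_of_nonneg (by positivity) fun j _ => ?_
  exact norm_mul_le_of_le (Matrix.norm_entry_le_entrywise_sup_norm M) (norm_le_pi_norm v j)

theorem norm_matrix_mul_le [NonUnitalNormedRing R] [IsUltrametricDist R] (M : Matrix l m R)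
    (N : Matrix m o R) : ‖M * N‖ ≤ ‖M‖ * ‖N‖ := by
  refine (Matrix.norm_le_iff (by positivity)).mpr fun i k => ?_
  refine IsUltrametricDist.norm_sum_le_of_forall_le_of_nonneg (by positivity) fun j _ => ?_
  exact norm_mul_le_of_le (Matrix.norm_entry_le_entrywise_sup_norm M)
    (Matrix.norm_entry_le_entrywise_sup_norm N)

theorem norm_one_matrix_le [DecidableEq m] [NormedRing R] [NormOneClass R] :
    ‖(1 : Matrix m m R)‖ ≤ 1 := by
  refine (Matrix.norm_le_iff zero_le_one).mpr fun i j => ?_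
  rw [Matrix.one_apply]
  split_ifs <;> simp

theorem norm_sum_smul_lt {ι 𝕜 E : Type*} [Fintype ι] [NormedField 𝕜] [SeminormedAddCommGroup E]
    [NormedSpace 𝕜 E] [IsUltrametricDist E] {c : ι → 𝕜} {v : ι → E} {r s : ℝ} (hr : 0 < r)
    (hs : 0 < s) (hc : ∀ i, ‖c i‖ ≤ r) (hv : ∀ i, ‖v i‖ < s) : ‖∑ i, c i • v i‖ < r * s := by
  rcases isEmpty_or_nonempty ι with h | h
  · simpa using mul_pos hr hs
  obtain ⟨i, -, hi⟩ := IsUltrametricDist.exists_norm_finsetSum_le_of_nonempty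
    (Finset.univ_nonempty (α := ι)) fun i => c i • v i
  refine hi.trans_lt ?_
  rw [norm_smul]
  exact mul_lt_mul' (hc i) (hv i) (norm_nonneg _) hr

theorem linearIndependent_of_norm_sub_lt {ι 𝕜 E : Type*} [Fintype ι] [NormedField 𝕜]
    [SeminormedAddCommGroup E] [NormedSpace 𝕜 E] [IsUltrametricDist E] {b v : ι → E} {s : ℝ}
    (hb : ∀ (c : ι → 𝕜) (i : ι), ‖c i‖ * s ≤ ‖∑ j, c j • b j‖) (hv : ∀ i, ‖v i - b i‖ < s) :
    LinearIndependent 𝕜 v := by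
  rw [Fintype.linearIndependent_iff]
  intro c h
  by_contra! ⟨i₁, hi₁⟩
  have : Nonempty ι := ⟨i₁⟩
  obtain ⟨i₀, hmax⟩ := Finite.exists_max fun i => ‖c i‖
  have hlt := norm_sum_smul_lt ((norm_pos_iff.mpr hi₁).trans_le (hmax i₁))
    ((norm_nonneg _).trans_lt (hv i₀)) hmax hv
  simp only [smul_sub, Finset.sum_sub_distrib, h, zero_sub, norm_neg] at hlt
  exact (hb c i₀).not_gt hlt

theorem exists_map_eq_of_contracting {E : Type*} [NormedAddCommGroup E] [IsUltrametricDist E]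
    [CompleteSpace E] (G : E →+ E) {r δ : ℝ} (hδ0 : 0 ≤ δ) (hδ : δ < 1)
    (hG : ∀ z, ‖z‖ ≤ r → ‖z - G z‖ ≤ δ * ‖z‖) {w : E} (hw : ‖w‖ ≤ r) :
    ∃ z, ‖z‖ ≤ ‖w‖ ∧ G z = w := by
  lift δ to ℝ≥0 using hδ0
  let φ : E → E := fun z => w + (z - G z)
  have hmaps : Set.MapsTo φ (Metric.closedBall 0 ‖w‖) (Metric.closedBall 0 ‖w‖) := by
    intro z hz
    rw [mem_closedBall_zero_iff] at hz ⊢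
    refine (IsUltrametricDist.norm_add_le_max _ _).trans (max_le le_rfl ?_)
    exact ((hG z (hz.trans hw)).trans
      (mul_le_of_le_one_left (norm_nonneg z) (mod_cast hδ.le))).trans hz
  have hlip : LipschitzOnWith δ φ (Metric.closedBall 0 ‖w‖) :=
    LipschitzOnWith.of_dist_le_mul fun x hx y hy => by
      rw [mem_closedBall_zero_iff] at hx hy
      have hxy : ‖x - y‖ ≤ r :=
        (norm_sub_le_max x y).trans ((max_le hx hy).trans hw)
      have hφ : φ x - φ y = (x - y) - G (x - y) := by
        simp only [φ, map_sub]
        abel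
      rw [dist_eq_norm, dist_eq_norm, hφ]
      exact hG _ hxy
  obtain ⟨z, hz, hfix, -⟩ := ContractingWith.exists_fixedPoint'
    Metric.isClosed_closedBall.isComplete hmaps ⟨mod_cast hδ, hlip.mapsToRestrict hmaps⟩
    (Metric.mem_closedBall_self (norm_nonneg w)) (edist_ne_top _ _)
  refine ⟨z, mem_closedBall_zero_iff.mp hz, ?_⟩
  have hw : w + z - G z = z := by rw [add_sub_assoc]; exact hfix
  rw [sub_eq_iff_eq_add, add_comm w, add_right_inj] at hw
  exact hw.symm

theorem norm_eq_one_of_pow_eq_self {K : Type*} [NormedDivisionRing K] {ζ : K} {k : ℕ}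
    (hk : 1 < k) (hζ : ζ ≠ 0) (h : ζ ^ k = ζ) : ‖ζ‖ = 1 := by
  have h1 : ‖ζ‖ ^ (k - 1) * ‖ζ‖ = 1 * ‖ζ‖ := by
    rw [pow_sub_one_mul (by omega), ← norm_pow, h, one_mul]
  exact (pow_eq_one_iff_of_nonneg (norm_nonneg ζ) (by omega)).mp
    (mul_right_cancel₀ (norm_ne_zero_iff.mpr hζ) h1)

end Ultrametric

/-! ### Absolute values in `C_∞` -/

section Scalars

variable (F : Type*) [Field F] [Finite F]

theorem one_lt_card_real : (1 : ℝ) < Nat.card F := by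
  exact_mod_cast Finite.one_lt_card (α := F)

theorem card_pos_real : (0 : ℝ) < Nat.card F := zero_lt_one.trans (one_lt_card_real F)

theorem norm_theta_rInfty :
    ‖algebraMap (RatFunc F) (RInfty F) RatFunc.X‖ = Nat.card F := by
  rw [Valued.toNormedField.norm_def]
  change ((WithZeroMulInt.toNNReal (one_lt_card F).ne_zero
    (MonoidWithZeroHom.ValueGroup₀.embedding (Valued.v.restrict _)) : ℝ≥0) : ℝ) = _
  rw [Valuation.embedding_restrict, valued_theta F,
    WithZeroMulInt.toNNReal_neg_apply _ WithZero.exp_ne_zero]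
  simp [WithZero.exp]

theorem norm_theta : ‖theta F‖ = Nat.card F := by
  have h : theta F = algebraMap (RInfty F) (CInfty F)
      (algebraMap (RatFunc F) (RInfty F) RatFunc.X) := by
    change polyHom F Polynomial.X = _
    rw [polyHom, RingHom.comp_apply, RingHom.comp_apply, RatFunc.algebraMap_X]
  rw [h, norm_algebraMap', norm_theta_rInfty]

theorem theta_ne_zero : theta F ≠ 0 := by
  rw [← norm_pos_iff, norm_theta]
  exact card_pos_real F

variable {F}

theorem algebraMap_pow_card_pow (a : F) (i : ℕ) :
    algebraMap F (CInfty F) a ^ (Nat.card F ^ i) = algebraMap F (CInfty F) a := by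
  have := Fintype.ofFinite F
  rw [← map_pow, Nat.card_eq_fintype_card, FiniteField.pow_card_pow]

theorem norm_algebraMap_of_ne_zero {a : F} (ha : a ≠ 0) : ‖algebraMap F (CInfty F) a‖ = 1 :=
  norm_eq_one_of_pow_eq_self (Nat.one_lt_pow one_ne_zero Finite.one_lt_card)
    ((map_ne_zero _).mpr ha) (algebraMap_pow_card_pow a 1)

theorem norm_algebraMap_le_one (a : F) : ‖algebraMap F (CInfty F) a‖ ≤ 1 := by
  rcases eq_or_ne a 0 with rfl | ha
  · simp
  · exact (norm_algebraMap_of_ne_zero ha).le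

theorem norm_frob (i : ℕ) (a : CInfty F) : ‖frob F i a‖ = ‖a‖ ^ (Nat.card F ^ i) := by
  rw [frob_apply, norm_pow]

theorem norm_frob_theta_sub {i : ℕ} (hi : i ≠ 0) :
    ‖frob F i (theta F) - theta F‖ = (Nat.card F : ℝ) ^ (Nat.card F ^ i) := by
  have h1 : ‖frob F i (theta F)‖ = (Nat.card F : ℝ) ^ (Nat.card F ^ i) := by
    rw [norm_frob, norm_theta]
  have h2 : ‖-theta F‖ < ‖frob F i (theta F)‖ := by
    rw [h1, norm_neg, norm_theta]
    exact lt_self_pow₀ (one_lt_card_real F) (Nat.one_lt_pow hi Finite.one_lt_card)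
  rw [sub_eq_add_neg, IsUltrametricDist.norm_add_eq_max_of_norm_ne_norm h2.ne',
    max_eq_left h2.le, h1]

theorem norm_inv_frob_theta_sub_smul {E : Type*} [NormedAddCommGroup E] [NormedSpace (CInfty F) E]
    {i : ℕ} (hi : i ≠ 0) (x : E) :
    ‖(frob F i (theta F) - theta F)⁻¹ • x‖ = (Nat.card F : ℝ)⁻¹ ^ (Nat.card F ^ i) * ‖x‖ := by
  rw [norm_smul, norm_inv, norm_frob_theta_sub hi, inv_pow]

end Scalars

/-! ### Additive power series -/

section Vectors

variable {F : Type*} [Field F] [Finite F] {n : ℕ}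

theorem norm_vecFrob (i : ℕ) (z : Fin n → CInfty F) :
    ‖vecFrob i z‖ = ‖z‖ ^ (Nat.card F ^ i) := by
  have hq : Nat.card F ^ i ≠ 0 := (pow_pos Nat.card_pos i).ne'
  rcases isEmpty_or_nonempty (Fin n) with h | h
  · rw [Subsingleton.elim z 0, Subsingleton.elim (vecFrob i 0) 0, norm_zero, zero_pow hq]
  apply le_antisymm
  · refine (pi_norm_le_iff_of_nonneg (by positivity)).mpr fun j => ?_
    rw [vecFrob, norm_frob]
    exact pow_le_pow_left₀ (norm_nonneg _) (norm_le_pi_norm z j) _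
  · obtain ⟨j, hj⟩ := Finite.exists_max fun j => ‖z j‖
    have hz : ‖z‖ = ‖z j‖ :=
      le_antisymm ((pi_norm_le_iff_of_nonneg (norm_nonneg _)).mpr hj) (norm_le_pi_norm z j)
    rw [hz, ← norm_frob]
    exact norm_le_pi_norm (vecFrob i z) j

theorem norm_map_frob_le {l m : Type*} [Fintype l] [Fintype m] (i : ℕ)
    (M : Matrix l m (CInfty F)) : ‖M.map (frob F i)‖ ≤ ‖M‖ ^ (Nat.card F ^ i) := by
  refine (Matrix.norm_le_iff (by positivity)).mpr fun j k => ?_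
  rw [Matrix.map_apply, norm_frob]
  exact pow_le_pow_left₀ (norm_nonneg _) (Matrix.norm_entry_le_entrywise_sup_norm M) _

/-- The Frobenius power `z ↦ z^{(i)}` as a homomorphism of additive groups. -/
def vecFrobHom (F : Type*) [Field F] [Finite F] (n i : ℕ) :
    (Fin n → CInfty F) →+ (Fin n → CInfty F) where
  toFun := vecFrob i
  map_zero' := funext fun _ => map_zero (frob F i)
  map_add' a b := funext fun j => map_add (frob F i) (a j) (b j)

theorem vecFrob_add (i : ℕ) (z w : Fin n → CInfty F) :
    vecFrob i (z + w) = vecFrob i z + vecFrob i w := map_add (vecFrobHom F n i) z w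

theorem vecFrob_sub (i : ℕ) (z w : Fin n → CInfty F) :
    vecFrob i (z - w) = vecFrob i z - vecFrob i w := map_sub (vecFrobHom F n i) z w

theorem vecFrob_zero_right (i : ℕ) : vecFrob i (0 : Fin n → CInfty F) = 0 :=
  map_zero (vecFrobHom F n i)

theorem vecFrob_zero_left (z : Fin n → CInfty F) : vecFrob 0 z = z :=
  funext fun j => frob_zero_apply F (z j)

theorem vecFrob_smul (i : ℕ) (c : CInfty F) (z : Fin n → CInfty F) :
    vecFrob i (c • z) = frob F i c • vecFrob i z :=
  funext fun j => map_mul (frob F i) c (z j)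

theorem vecFrob_vecFrob (i j : ℕ) (z : Fin n → CInfty F) :
    vecFrob i (vecFrob j z) = vecFrob (i + j) z :=
  funext fun k => (frob_add_apply F i j (z k)).symm

theorem continuous_vecFrob (i : ℕ) :
    Continuous (vecFrob i : (Fin n → CInfty F) → Fin n → CInfty F) :=
  continuous_pi fun j => (continuous_frob F i).comp (continuous_apply j)

/-- The action `x ↦ θ x + A x^{(1)} + x^{(2)}` of `T` on the t-module of `M(A)`. -/
def tAct (A : Matrix (Fin n) (Fin n) (CInfty F)) : (Fin n → CInfty F) →+ (Fin n → CInfty F) where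
  toFun x := theta F • x + A.mulVec (vecFrob 1 x) + vecFrob 2 x
  map_zero' := by simp [vecFrob_zero_right]
  map_add' a b := by
    simp only [vecFrob_add, smul_add, Matrix.mulVec_add]
    abel

theorem tAct_apply (A : Matrix (Fin n) (Fin n) (CInfty F)) (x : Fin n → CInfty F) :
    tAct A x = theta F • x + A.mulVec (vecFrob 1 x) + vecFrob 2 x := rfl

theorem continuous_tAct (A : Matrix (Fin n) (Fin n) (CInfty F)) : Continuous (tAct A) :=
  ((continuous_const_smul _).add (continuous_const.matrix_mulVec (continuous_vecFrob 1))).add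
    (continuous_vecFrob 2)

/-- The term `f_i z^{(i)}` of the additive power series `∑ f_i z^{(i)}`. -/
def addTerm (f : ℕ → Matrix (Fin n) (Fin n) (CInfty F)) (z : Fin n → CInfty F) (i : ℕ) :
    Fin n → CInfty F :=
  (f i).mulVec (vecFrob i z)

/-- The value of the additive power series `∑ f_i z^{(i)}`, zero if the series diverges. -/
def addSum (f : ℕ → Matrix (Fin n) (Fin n) (CInfty F)) (z : Fin n → CInfty F) : Fin n → CInfty F :=
  ∑' i, addTerm f z i

theorem norm_addTerm_le (f : ℕ → Matrix (Fin n) (Fin n) (CInfty F)) (z : Fin n → CInfty F)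
    (i : ℕ) : ‖addTerm f z i‖ ≤ ‖f i‖ * ‖z‖ ^ (Nat.card F ^ i) := by
  rw [addTerm, ← norm_vecFrob]
  exact norm_mulVec_le _ _

theorem norm_addTerm_le_pow {f : ℕ → Matrix (Fin n) (Fin n) (CInfty F)} {z : Fin n → CInfty F}
    {i : ℕ} {κ : ℝ} (hf : ‖f i‖ ≤ κ ^ (Nat.card F ^ i)) :
    ‖addTerm f z i‖ ≤ (κ * ‖z‖) ^ (Nat.card F ^ i) := by
  rw [mul_pow]
  exact (norm_addTerm_le f z i).trans (mul_le_mul_of_nonneg_right hf (by positivity))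

theorem summable_addTerm {f : ℕ → Matrix (Fin n) (Fin n) (CInfty F)} {z : Fin n → CInfty F}
    {κ : ℝ} {N : ℕ} (hκ : 0 ≤ κ) (hf : ∀ i ≥ N, ‖f i‖ ≤ κ ^ (Nat.card F ^ i))
    (hz : κ * ‖z‖ < 1) : Summable (addTerm f z) := by
  apply NonarchimedeanAddGroup.summable_of_tendsto_cofinite_zero
  rw [Nat.cofinite_eq_atTop]
  refine squeeze_zero_norm' (a := fun i => (κ * ‖z‖) ^ (Nat.card F ^ i)) ?_ ?_
  · filter_upwards [Filter.eventually_ge_atTop N] with i hi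
    exact norm_addTerm_le_pow (hf i hi)
  · exact (tendsto_pow_atTop_nhds_zero_of_lt_one (by positivity) hz).comp
      (tendsto_pow_atTop_atTop_of_one_lt Finite.one_lt_card)

theorem addTerm_add (f : ℕ → Matrix (Fin n) (Fin n) (CInfty F)) (z w : Fin n → CInfty F) (i : ℕ) :
    addTerm f (z + w) i = addTerm f z i + addTerm f w i := by
  simp only [addTerm, vecFrob_add, Matrix.mulVec_add]

theorem addSum_add {f : ℕ → Matrix (Fin n) (Fin n) (CInfty F)} {z w : Fin n → CInfty F}
    (hz : Summable (addTerm f z)) (hw : Summable (addTerm f w)) :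
    addSum f (z + w) = addSum f z + addSum f w := by
  rw [addSum, addSum, addSum, ← hz.tsum_add hw]
  exact tsum_congr fun i => addTerm_add f z w i

end Vectors

section TorsionRadius

/-- The positive real number `Λ` with `Λ ^ (q ^ 2) = q Λ`. It is the absolute value of the nonzero
`T`-torsion points of `M(0)`, and `q Λ` is that of the shortest nonzero periods. -/
def torsionRadius (F : Type*) : ℝ := (Nat.card F : ℝ) ^ ((1 : ℝ) / ((Nat.card F : ℝ) ^ 2 - 1))

variable (F : Type*) [Field F] [Finite F]

theorem torsionRadius_exponent_pos : (0 : ℝ) < 1 / ((Nat.card F : ℝ) ^ 2 - 1) :=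
  one_div_pos.mpr (sub_pos.mpr (one_lt_pow₀ (one_lt_card_real F) two_ne_zero))

theorem one_lt_torsionRadius : 1 < torsionRadius F :=
  Real.one_lt_rpow (one_lt_card_real F) (torsionRadius_exponent_pos F)

theorem torsionRadius_pos : 0 < torsionRadius F := zero_lt_one.trans (one_lt_torsionRadius F)

theorem torsionRadius_pow : torsionRadius F ^ (Nat.card F ^ 2) = Nat.card F * torsionRadius F := by
  have hne : (Nat.card F : ℝ) ^ 2 - 1 ≠ 0 := (one_div_pos.mp (torsionRadius_exponent_pos F)).ne'
  have hexp : (1 : ℝ) / ((Nat.card F : ℝ) ^ 2 - 1) * ((Nat.card F ^ 2 : ℕ) : ℝ) =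
      1 + 1 / ((Nat.card F : ℝ) ^ 2 - 1) := by
    push_cast
    field_simp
    ring
  rw [torsionRadius, ← Real.rpow_mul_natCast (card_pos_real F).le, hexp,
    Real.rpow_add (card_pos_real F), Real.rpow_one]

theorem torsionRadius_lt_card : torsionRadius F < Nat.card F := by
  have hq : (1 : ℝ) < (Nat.card F : ℝ) ^ 2 - 1 := by
    have : (2 : ℝ) ≤ Nat.card F := by exact_mod_cast Finite.one_lt_card (α := F)
    nlinarith
  calc torsionRadius F < (Nat.card F : ℝ) ^ (1 : ℝ) :=
        Real.rpow_lt_rpow_of_exponent_lt (one_lt_card_real F)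
          ((div_lt_one (zero_lt_one.trans hq)).mpr hq)
    _ = Nat.card F := Real.rpow_one _

variable {F}

theorem card_mul_lt_pow_of_torsionRadius_lt {t : ℝ} (ht : torsionRadius F < t) :
    Nat.card F * t < t ^ (Nat.card F ^ 2) := by
  have hΛ := torsionRadius_pos F
  have h : t / torsionRadius F < (t / torsionRadius F) ^ (Nat.card F ^ 2) :=
    lt_self_pow₀ ((one_lt_div hΛ).mpr ht) (Nat.one_lt_pow two_ne_zero Finite.one_lt_card)
  rw [div_pow, torsionRadius_pow, div_lt_div_iff₀ hΛ (mul_pos (card_pos_real F) hΛ),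
    ← mul_assoc] at h
  rw [mul_comm]
  exact lt_of_mul_lt_mul_right h hΛ.le

end TorsionRadius

section ExpBound

/-- The bound `q^{-⌊(i+1)/2⌋ q^i}` for the norm of the coefficient `C_i` of the exponential map of
`M(A)`, valid for `‖A‖ ≤ 1`. -/
def expBound (F : Type*) (i : ℕ) : ℝ := ((Nat.card F : ℝ) ^ ((i + 1) / 2))⁻¹ ^ (Nat.card F ^ i)

theorem expBound_nonneg (F : Type*) (i : ℕ) : 0 ≤ expBound F i := by
  unfold expBound
  positivity

theorem expBound_add_two (F : Type*) (i : ℕ) :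
    expBound F (i + 2) =
      (Nat.card F : ℝ)⁻¹ ^ (Nat.card F ^ (i + 2)) * expBound F i ^ (Nat.card F ^ 2) := by
  rw [expBound, expBound, ← pow_mul, ← pow_add, ← mul_pow, ← mul_inv, ← pow_succ',
    show (i + 2 + 1) / 2 = (i + 1) / 2 + 1 by omega]

variable {F : Type*} [Field F] [Finite F]

theorem expBound_le_one (i : ℕ) : expBound F i ≤ 1 :=
  pow_le_one₀ (by positivity) (inv_le_one_of_one_le₀ (one_le_pow₀ (one_lt_card_real F).le))

theorem expBound_succ_pow_le (i : ℕ) :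
    expBound F (i + 1) ^ (Nat.card F ^ 1) ≤ expBound F i ^ (Nat.card F ^ 2) := by
  have hq := card_pos_real F
  rw [expBound, expBound, ← pow_mul, ← pow_mul, ← pow_add, ← pow_add]
  exact pow_le_pow_left₀ (by positivity) (inv_anti₀ (by positivity)
    (pow_le_pow_right₀ (one_lt_card_real F).le (by omega))) _

theorem expBound_le_pow {i k : ℕ} (h : 2 * k ≤ i) :
    expBound F i ≤ ((Nat.card F : ℝ) ^ k)⁻¹ ^ (Nat.card F ^ i) := by
  have hq := card_pos_real F
  exact pow_le_pow_left₀ (by positivity) (inv_anti₀ (by positivity)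
    (pow_le_pow_right₀ (one_lt_card_real F).le (by omega))) _

theorem expBound_mul_pow_le {t : ℝ} (ht0 : 0 ≤ t) (ht : t ≤ Nat.card F * torsionRadius F) {i : ℕ}
    (hi : i ≠ 0) :
    expBound F i * t ^ (Nat.card F ^ i) ≤
      max (t / Nat.card F) ((t / Nat.card F) ^ (Nat.card F ^ 2)) := by
  have hq0 := card_pos_real F
  have hq1 := (one_lt_card_real F).le
  rw [expBound, ← mul_pow]
  have hle : ((Nat.card F : ℝ) ^ ((i + 1) / 2))⁻¹ * t ≤ t / Nat.card F := by
    rw [div_eq_inv_mul]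
    exact mul_le_mul_of_nonneg_right
      (inv_anti₀ hq0 (le_self_pow₀ hq1 (by omega))) ht0
  rcases le_or_gt t (Nat.card F) with htq | htq
  · have h1 : t / Nat.card F ≤ 1 := (div_le_one hq0).mpr htq
    exact le_max_of_le_left ((pow_le_of_le_one (by positivity) (hle.trans h1)
      (pow_pos Nat.card_pos i).ne').trans hle)
  have h1 : 1 ≤ t / Nat.card F := (one_le_div hq0).mpr htq.le
  rcases le_or_gt i 2 with hi2 | hi2
  · exact le_max_of_le_right ((pow_le_pow_left₀ (by positivity) hle _).trans
      (pow_le_pow_right₀ h1 (Nat.pow_le_pow_right Nat.card_pos hi2)))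
  · refine le_max_of_le_left ((pow_le_one₀ (by positivity) ?_).trans h1)
    rw [inv_mul_le_iff₀ (by positivity), mul_one]
    calc t ≤ Nat.card F * Nat.card F :=
          ht.trans (mul_le_mul_of_nonneg_left (torsionRadius_lt_card F).le hq0.le)
      _ = (Nat.card F : ℝ) ^ 2 := (sq _).symm
      _ ≤ (Nat.card F : ℝ) ^ ((i + 1) / 2) := pow_le_pow_right₀ hq1 (by omega)

end ExpBound

/-! ### The exponential map -/

section Exp

variable {F : Type*} [Field F] [Finite F] {n : ℕ} {A : Matrix (Fin n) (Fin n) (CInfty F)}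

theorem norm_map_frob_le_expBound_pow {M : Matrix (Fin n) (Fin n) (CInfty F)} {i k : ℕ}
    (hM : ‖M‖ ≤ expBound F i) : ‖M.map (frob F k)‖ ≤ expBound F i ^ (Nat.card F ^ k) :=
  (norm_map_frob_le k M).trans (pow_le_pow_left₀ (norm_nonneg M) hM _)

theorem norm_expCoeff_one_le : ‖expCoeff A 1‖ ≤ ‖A‖ * expBound F 1 := by
  rw [expCoeff, norm_inv_frob_theta_sub_smul one_ne_zero, mul_comm]
  simp [expBound]

theorem norm_mul_map_expCoeff_le {i : ℕ} (h : ‖expCoeff A (i + 1)‖ ≤ expBound F (i + 1)) :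
    ‖A * (expCoeff A (i + 1)).map (frob F 1)‖ ≤ ‖A‖ * expBound F i ^ (Nat.card F ^ 2) :=
  (norm_matrix_mul_le _ _).trans (mul_le_mul_of_nonneg_left
    ((norm_map_frob_le_expBound_pow h).trans (expBound_succ_pow_le i)) (norm_nonneg A))

theorem norm_expCoeff_le (hA : ‖A‖ ≤ 1) (i : ℕ) : ‖expCoeff A i‖ ≤ expBound F i := by
  induction i using Nat.twoStepInduction with
  | zero => simpa [expCoeff, expBound] using norm_one_matrix_le
  | one => exact norm_expCoeff_one_le.trans (mul_le_of_le_one_left (expBound_nonneg F 1) hA)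
  | more i ih₀ ih₁ =>
    rw [expCoeff, norm_inv_frob_theta_sub_smul (by omega), expBound_add_two]
    refine mul_le_mul_of_nonneg_left ?_ (by positivity)
    refine (IsUltrametricDist.norm_add_le_max _ _).trans
      (max_le ?_ (norm_map_frob_le_expBound_pow ih₀))
    exact (norm_mul_map_expCoeff_le ih₁).trans
      (mul_le_of_le_one_left (pow_nonneg (expBound_nonneg F i) _) hA)

theorem norm_expCoeff_sub_expCoeff_zero_le (hA : ‖A‖ ≤ 1) (i : ℕ) :
    ‖expCoeff A i - expCoeff 0 i‖ ≤ ‖A‖ * expBound F i := by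
  induction i using Nat.twoStepInduction with
  | zero =>
    simp only [expCoeff, sub_self, norm_zero]
    exact mul_nonneg (norm_nonneg A) (expBound_nonneg F 0)
  | one =>
    have h0 : expCoeff (0 : Matrix (Fin n) (Fin n) (CInfty F)) 1 = 0 := by simp [expCoeff]
    rw [h0, sub_zero]
    exact norm_expCoeff_one_le
  | more i ih _ =>
    have hdiff : expCoeff A (i + 2) - expCoeff 0 (i + 2) =
        (frob F (i + 2) (theta F) - theta F)⁻¹ • (A * (expCoeff A (i + 1)).map (frob F 1) +
          (expCoeff A i - expCoeff 0 i).map (frob F 2)) := by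
      rw [expCoeff, expCoeff, ← smul_sub, zero_mul, zero_add, add_sub_assoc,
        Matrix.map_sub _ (map_sub _)]
    rw [hdiff, norm_inv_frob_theta_sub_smul (by omega), expBound_add_two, mul_left_comm]
    refine mul_le_mul_of_nonneg_left ?_ (by positivity)
    refine (IsUltrametricDist.norm_add_le_max _ _).trans
      (max_le (norm_mul_map_expCoeff_le (norm_expCoeff_le hA _)) ?_)
    calc ‖(expCoeff A i - expCoeff 0 i).map (frob F 2)‖
        ≤ (‖A‖ * expBound F i) ^ (Nat.card F ^ 2) :=
          (norm_map_frob_le 2 _).trans (pow_le_pow_left₀ (norm_nonneg _) ih _)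
      _ = ‖A‖ ^ (Nat.card F ^ 2) * expBound F i ^ (Nat.card F ^ 2) := mul_pow _ _ _
      _ ≤ ‖A‖ * expBound F i ^ (Nat.card F ^ 2) :=
          mul_le_mul_of_nonneg_right
            (pow_le_of_le_one (norm_nonneg A) hA (pow_pos Nat.card_pos 2).ne')
            (pow_nonneg (expBound_nonneg F i) _)

/-- The exponential map of `M(A)`, zero where its series diverges. -/
def mExp (A : Matrix (Fin n) (Fin n) (CInfty F)) (z : Fin n → CInfty F) : Fin n → CInfty F :=
  addSum (expCoeff A) z

theorem summable_exp (hA : ‖A‖ ≤ 1) (z : Fin n → CInfty F) :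
    Summable (addTerm (expCoeff A) z) := by
  have hq0 := card_pos_real F
  obtain ⟨k, hk⟩ := pow_unbounded_of_one_lt ‖z‖ (one_lt_card_real F)
  refine summable_addTerm (κ := ((Nat.card F : ℝ) ^ k)⁻¹) (N := 2 * k) (by positivity)
    (fun i hi => (norm_expCoeff_le hA i).trans (expBound_le_pow hi)) ?_
  rwa [inv_mul_lt_iff₀ (by positivity), mul_one]

theorem expEq_mExp (hA : ‖A‖ ≤ 1) (z : Fin n → CInfty F) : ExpEq A z (mExp A z) :=
  (summable_exp hA z).hasSum

theorem expEq_iff (hA : ‖A‖ ≤ 1) {z w : Fin n → CInfty F} : ExpEq A z w ↔ mExp A z = w :=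
  ⟨fun h => h.tsum_eq, fun h => h ▸ expEq_mExp hA z⟩

theorem mExp_add (hA : ‖A‖ ≤ 1) (z w : Fin n → CInfty F) :
    mExp A (z + w) = mExp A z + mExp A w :=
  addSum_add (summable_exp hA z) (summable_exp hA w)

/-- The exponential map of `M(A)` as a homomorphism of additive groups. -/
def mExpHom (hA : ‖A‖ ≤ 1) : (Fin n → CInfty F) →+ (Fin n → CInfty F) :=
  AddMonoidHom.mk' (mExp A) (mExp_add hA)

theorem mExp_sub (hA : ‖A‖ ≤ 1) (z w : Fin n → CInfty F) :
    mExp A (z - w) = mExp A z - mExp A w :=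
  map_sub (mExpHom hA) z w

theorem mExp_zero (hA : ‖A‖ ≤ 1) : mExp A 0 = 0 := map_zero (mExpHom hA)

theorem mExp_sum (hA : ‖A‖ ≤ 1) {ι : Type*} (s : Finset ι) (z : ι → Fin n → CInfty F) :
    mExp A (∑ i ∈ s, z i) = ∑ i ∈ s, mExp A (z i) :=
  map_sum (mExpHom hA) z s

theorem mExp_const_smul (hA : ‖A‖ ≤ 1) (a : F) (z : Fin n → CInfty F) :
    mExp A (algebraMap F (CInfty F) a • z) = algebraMap F (CInfty F) a • mExp A z :=
  (expEq_iff hA).mp ((expEq_mExp hA z).const_smul a)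

theorem mExp_theta_smul (hA : ‖A‖ ≤ 1) (z : Fin n → CInfty F) :
    mExp A (theta F • z) = tAct A (mExp A z) :=
  (expEq_iff hA).mp (expEq_mExp hA z).theta_smul

theorem mem_motiveLattice (hA : ‖A‖ ≤ 1) {z : Fin n → CInfty F} :
    z ∈ motiveLattice A ↔ mExp A z = 0 :=
  expEq_iff hA

theorem norm_mExp_sub_le_of_forall (hA : ‖A‖ ≤ 1) {z : Fin n → CInfty F} {b : ℝ} (hb : 0 ≤ b)
    (h : ∀ i ≠ 0, ‖expCoeff A i‖ * ‖z‖ ^ (Nat.card F ^ i) ≤ b) : ‖mExp A z - z‖ ≤ b := by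
  have h0 : addTerm (expCoeff A) z 0 = z := by
    rw [addTerm, expCoeff, vecFrob_zero_left, Matrix.one_mulVec]
  rw [mExp, addSum, (summable_exp hA z).tsum_eq_zero_add, h0, add_sub_cancel_left]
  exact IsUltrametricDist.norm_tsum_le_of_forall_le_of_nonneg hb fun i =>
    (norm_addTerm_le _ _ _).trans (h _ (Nat.succ_ne_zero i))

theorem norm_mExp_sub_le (hA : ‖A‖ ≤ 1) {z : Fin n → CInfty F}
    (hz : ‖z‖ ≤ Nat.card F * torsionRadius F) :
    ‖mExp A z - z‖ ≤ max (‖z‖ / Nat.card F) ((‖z‖ / Nat.card F) ^ (Nat.card F ^ 2)) :=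
  norm_mExp_sub_le_of_forall hA (by positivity) fun i hi =>
    (mul_le_mul_of_nonneg_right (norm_expCoeff_le hA i) (by positivity)).trans
      (expBound_mul_pow_le (norm_nonneg z) hz hi)

theorem norm_mExp_sub_le_pow (hA : ‖A‖ ≤ 1) {z : Fin n → CInfty F} (hz : ‖z‖ ≤ 1) :
    ‖mExp A z - z‖ ≤ ‖z‖ ^ Nat.card F := by
  refine norm_mExp_sub_le_of_forall hA (by positivity) fun i hi => ?_
  calc ‖expCoeff A i‖ * ‖z‖ ^ (Nat.card F ^ i) ≤ 1 * ‖z‖ ^ (Nat.card F ^ i) :=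
        mul_le_mul_of_nonneg_right ((norm_expCoeff_le hA i).trans (expBound_le_one i))
          (by positivity)
    _ = ‖z‖ ^ (Nat.card F ^ i) := one_mul _
    _ ≤ ‖z‖ ^ Nat.card F := pow_le_pow_of_le_one (norm_nonneg z) hz (Nat.le_self_pow hi _)

theorem norm_mExp_sub_mExp_zero_le (hA : ‖A‖ ≤ 1) {z : Fin n → CInfty F}
    (hz : ‖z‖ ≤ Nat.card F * torsionRadius F) :
    ‖mExp A z - mExp 0 z‖ ≤ ‖A‖ * (Nat.card F * torsionRadius F) := by
  have hq0 := card_pos_real F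
  have hqΛ : 0 ≤ Nat.card F * torsionRadius F := (norm_nonneg z).trans hz
  have h0 : ‖(0 : Matrix (Fin n) (Fin n) (CInfty F))‖ ≤ 1 := by simp
  have hterm (i : ℕ) (hi : i ≠ 0) :
      expBound F i * ‖z‖ ^ (Nat.card F ^ i) ≤ Nat.card F * torsionRadius F := by
    refine (expBound_mul_pow_le (norm_nonneg z) hz hi).trans (max_le ?_ ?_)
    · exact (div_le_self (norm_nonneg z) (one_lt_card_real F).le).trans hz
    · rw [← torsionRadius_pow]
      exact pow_le_pow_left₀ (by positivity) (by rwa [div_le_iff₀' hq0]) _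
  rw [mExp, mExp, addSum, addSum, ← (summable_exp hA z).tsum_sub (summable_exp h0 z)]
  refine IsUltrametricDist.norm_tsum_le_of_forall_le_of_nonneg (by positivity) fun i => ?_
  rw [addTerm, addTerm, ← Matrix.sub_mulVec]
  refine (norm_mulVec_le _ _).trans ?_
  rcases eq_or_ne i 0 with rfl | hi
  · simp only [expCoeff, sub_self, norm_zero, zero_mul]
    positivity
  rw [norm_vecFrob]
  calc ‖expCoeff A i - expCoeff 0 i‖ * ‖z‖ ^ (Nat.card F ^ i)
      ≤ ‖A‖ * expBound F i * ‖z‖ ^ (Nat.card F ^ i) :=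
        mul_le_mul_of_nonneg_right (norm_expCoeff_sub_expCoeff_zero_le hA i) (by positivity)
    _ = ‖A‖ * (expBound F i * ‖z‖ ^ (Nat.card F ^ i)) := mul_assoc _ _ _
    _ ≤ ‖A‖ * (Nat.card F * torsionRadius F) :=
        mul_le_mul_of_nonneg_left (hterm i hi) (norm_nonneg A)

theorem exists_mExp_sub_contraction (hA : ‖A‖ ≤ 1) {r : ℝ} (hr0 : 0 ≤ r)
    (hr : r < Nat.card F * torsionRadius F) :
    ∃ δ, 0 ≤ δ ∧ δ < 1 ∧ ∀ z : Fin n → CInfty F, ‖z‖ ≤ r → ‖mExp A z - z‖ ≤ δ * ‖z‖ := by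
  have hq0 := card_pos_real F
  have hq2 : 1 < Nat.card F ^ 2 := Nat.one_lt_pow two_ne_zero Finite.one_lt_card
  have hpow : torsionRadius F ^ (Nat.card F ^ 2 - 1) = Nat.card F := by
    have h := torsionRadius_pow F
    rw [← pow_sub_one_mul (zero_lt_one.trans hq2).ne'] at h
    exact mul_right_cancel₀ (torsionRadius_pos F).ne' h
  refine ⟨max (Nat.card F : ℝ)⁻¹ ((Nat.card F : ℝ)⁻¹ * (r / Nat.card F) ^ (Nat.card F ^ 2 - 1)),
    by positivity, max_lt (inv_lt_one_of_one_lt₀ (one_lt_card_real F)) ?_, fun z hz => ?_⟩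
  · rw [inv_mul_lt_iff₀ hq0, mul_one]
    calc (r / Nat.card F) ^ (Nat.card F ^ 2 - 1) < torsionRadius F ^ (Nat.card F ^ 2 - 1) :=
          pow_lt_pow_left₀ (by rwa [div_lt_iff₀' hq0]) (by positivity) (by omega)
      _ = Nat.card F := hpow
  · refine (norm_mExp_sub_le hA (hz.trans hr.le)).trans ?_
    rw [max_mul_of_nonneg _ _ (norm_nonneg z)]
    refine max_le_max (by rw [div_eq_inv_mul]) ?_
    calc (‖z‖ / Nat.card F) ^ (Nat.card F ^ 2)
        = (‖z‖ / Nat.card F) ^ (Nat.card F ^ 2 - 1) * (‖z‖ / Nat.card F) :=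
          (pow_sub_one_mul (zero_lt_one.trans hq2).ne' _).symm
      _ ≤ (r / Nat.card F) ^ (Nat.card F ^ 2 - 1) * (‖z‖ / Nat.card F) := by gcongr
      _ = (Nat.card F : ℝ)⁻¹ * (r / Nat.card F) ^ (Nat.card F ^ 2 - 1) * ‖z‖ := by ring

theorem norm_mExp (hA : ‖A‖ ≤ 1) {z : Fin n → CInfty F}
    (hz : ‖z‖ < Nat.card F * torsionRadius F) : ‖mExp A z‖ = ‖z‖ := by
  rcases eq_or_ne z 0 with rfl | hz0
  · rw [mExp_zero hA]
  obtain ⟨δ, -, hδ, h⟩ := exists_mExp_sub_contraction hA (norm_nonneg z) hz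
  have hlt : ‖mExp A z + -z‖ < max ‖mExp A z‖ ‖-z‖ := by
    rw [← sub_eq_add_neg, norm_neg]
    exact ((h z le_rfl).trans_lt (mul_lt_of_lt_one_left (norm_pos_iff.mpr hz0) hδ)).trans_le
      (le_max_right _ _)
  rw [IsUltrametricDist.norm_eq_of_add_norm_lt_max hlt, norm_neg]

theorem eq_zero_of_mExp_eq_zero (hA : ‖A‖ ≤ 1) {z : Fin n → CInfty F}
    (hz : ‖z‖ < Nat.card F * torsionRadius F) (h : mExp A z = 0) : z = 0 := by
  rw [← norm_eq_zero, ← norm_mExp hA hz, h, norm_zero]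

theorem exists_mExp_eq (hA : ‖A‖ ≤ 1) {w : Fin n → CInfty F}
    (hw : ‖w‖ < Nat.card F * torsionRadius F) : ∃ z, ‖z‖ = ‖w‖ ∧ mExp A z = w := by
  obtain ⟨δ, hδ0, hδ, h⟩ := exists_mExp_sub_contraction hA (norm_nonneg w) hw
  obtain ⟨z, hz, rfl⟩ := exists_map_eq_of_contracting (mExpHom hA) hδ0 hδ
    (fun z hz => by rw [norm_sub_rev]; exact h z hz) le_rfl
  exact ⟨z, (norm_mExp hA (hz.trans_lt hw)).symm, rfl⟩

theorem norm_theta_inv_smul (z : Fin n → CInfty F) :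
    ‖(theta F)⁻¹ • z‖ = ‖z‖ / Nat.card F := by
  rw [norm_smul, norm_inv, norm_theta, div_eq_inv_mul]

theorem tAct_mExp_theta_inv_smul (hA : ‖A‖ ≤ 1) (z : Fin n → CInfty F) :
    tAct A (mExp A ((theta F)⁻¹ • z)) = mExp A z := by
  rw [← mExp_theta_smul hA, smul_inv_smul₀ (theta_ne_zero F)]

theorem torsionRadius_lt_card_mul : torsionRadius F < Nat.card F * torsionRadius F :=
  lt_mul_left (torsionRadius_pos F) (one_lt_card_real F)

theorem exists_tAct_eq (hA : ‖A‖ ≤ 1) {w : Fin n → CInfty F}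
    (hw : ‖w‖ < Nat.card F * torsionRadius F) : ∃ x, ‖x‖ < torsionRadius F ∧ tAct A x = w := by
  obtain ⟨z, hz, rfl⟩ := exists_mExp_eq hA hw
  refine ⟨mExp A ((theta F)⁻¹ • z), ?_, tAct_mExp_theta_inv_smul hA z⟩
  have hz' : ‖(theta F)⁻¹ • z‖ < torsionRadius F := by
    rwa [norm_theta_inv_smul, hz, div_lt_iff₀' (card_pos_real F)]
  rwa [norm_mExp hA (hz'.trans torsionRadius_lt_card_mul)]

theorem eq_zero_of_tAct_eq_zero (hA : ‖A‖ ≤ 1) {x : Fin n → CInfty F}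
    (hx : ‖x‖ < torsionRadius F) (h : tAct A x = 0) : x = 0 := by
  obtain ⟨z, hz, rfl⟩ := exists_mExp_eq hA (hx.trans torsionRadius_lt_card_mul)
  rw [← mExp_theta_smul hA] at h
  have hθz : theta F • z = 0 := by
    refine eq_zero_of_mExp_eq_zero hA ?_ h
    rw [norm_smul, norm_theta, hz]
    exact mul_lt_mul_of_pos_left hx (card_pos_real F)
  rw [(smul_eq_zero_iff_right (theta_ne_zero F)).mp hθz, mExp_zero hA]

theorem norm_le_of_tAct_eq_zero (hA : ‖A‖ ≤ 1) {x : Fin n → CInfty F} (h : tAct A x = 0) :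
    ‖x‖ ≤ torsionRadius F := by
  by_contra! hx
  have hx1 : 1 < ‖x‖ := (one_lt_torsionRadius F).trans hx
  have hx2 : vecFrob 2 x = -(theta F • x + A.mulVec (vecFrob 1 x)) :=
    (neg_eq_of_add_eq_zero_right h).symm
  have hle : ‖x‖ ^ (Nat.card F ^ 2) ≤ max (Nat.card F * ‖x‖) (‖x‖ ^ Nat.card F) := by
    rw [← norm_vecFrob, hx2, norm_neg]
    refine (IsUltrametricDist.norm_add_le_max _ _).trans (max_le_max ?_ ?_)
    · rw [norm_smul, norm_theta]
    · refine (norm_mulVec_le _ _).trans ?_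
      rw [norm_vecFrob, pow_one]
      exact mul_le_of_le_one_left (by positivity) hA
  refine hle.not_gt (max_lt (card_mul_lt_pow_of_torsionRadius_lt hx) ?_)
  exact pow_lt_pow_right₀ hx1 (lt_self_pow₀ Finite.one_lt_card one_lt_two)

end Exp

section Dense

variable (F : Type*) [Field F]

theorem denseRange_ratFunc : DenseRange (algebraMap (RatFunc F) (RInfty F)) :=
  @UniformSpace.Completion.denseRange_coe (RatFunc F)
    (@RatFunc.inftyValued F _ (Classical.decEq _)).toUniformSpace

variable [Finite F]

/-- The inclusion of the algebraic closure of `R_∞` in `C_∞`. -/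
def algClHom : AlgClRInfty F →+* CInfty F :=
  (UniformSpace.Completion.coeRingHom : AlgClRInfty F →+* UniformSpace.Completion (AlgClRInfty F))

theorem denseRange_algClHom : DenseRange (algClHom F) :=
  UniformSpace.Completion.denseRange_coe (α := AlgClRInfty F)

theorem exists_algClHom_eq_theta : ∃ t : AlgClRInfty F, algClHom F t = theta F :=
  ⟨algebraMap (RInfty F) (AlgClRInfty F)
    (algebraMap (RatFunc F) (RInfty F) (algebraMap F[X] (RatFunc F) Polynomial.X)), rfl⟩

variable {F} {m : ℕ}

theorem exists_norm_pow_add_theta_mul_sub_lt (hm : 1 < m) (w : CInfty F) {ε : ℝ} (hε : 0 < ε) :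
    ∃ x : CInfty F, ‖x ^ m + theta F * x - w‖ < ε := by
  obtain ⟨t, ht⟩ := exists_algClHom_eq_theta F
  obtain ⟨v, hv⟩ := Metric.denseRange_iff.mp (denseRange_algClHom F) w ε hε
  have hdeg : (Polynomial.X ^ m + (Polynomial.C t * Polynomial.X + Polynomial.C (-v))).degree
      ≠ 0 := by
    rw [Polynomial.degree_add_eq_left_of_degree_lt, Polynomial.degree_X_pow]
    · exact_mod_cast (zero_lt_one.trans hm).ne'
    · rw [Polynomial.degree_X_pow]
      exact Polynomial.degree_linear_lt.trans_le (by exact_mod_cast hm)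
  obtain ⟨x, hx⟩ := IsAlgClosed.exists_root _ hdeg
  have hxv : x ^ m + t * x = v := by
    simpa [Polynomial.IsRoot, ← sub_eq_add_neg, ← add_sub_assoc, sub_eq_zero] using hx
  refine ⟨algClHom F x, ?_⟩
  rwa [← ht, ← map_pow, ← map_mul, ← map_add, hxv, ← dist_eq_norm, dist_comm]

theorem exists_pow_eq_neg_theta_mul (hm : 1 < m) :
    ∃ x : CInfty F, x ≠ 0 ∧ x ^ m = -(theta F * x) := by
  obtain ⟨t, ht⟩ := exists_algClHom_eq_theta F
  obtain ⟨x, hx⟩ := IsAlgClosed.exists_pow_nat_eq (-t) (n := m - 1) (by omega)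
  have hxθ : algClHom F x ^ (m - 1) = -theta F := by rw [← map_pow, hx, map_neg, ht]
  refine ⟨algClHom F x, fun h0 => ?_, ?_⟩
  · rw [h0, zero_pow (by omega)] at hxθ
    exact theta_ne_zero F (neg_eq_zero.mp hxθ.symm)
  · rw [← pow_sub_one_mul (by omega : m ≠ 0), hxθ, neg_mul]

end Dense

/-! ### The base point `A = 0` -/

section BasePoint

variable {F : Type*} [Field F] [Finite F] {n : ℕ}

/-- The scalar coefficients of the exponential map of `M(0)`. -/
def expCoeffZero (F : Type*) [Field F] [Finite F] : ℕ → CInfty F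
  | 0 => 1
  | 1 => 0
  | i + 2 => (frob F (i + 2) (theta F) - theta F)⁻¹ * frob F 2 (expCoeffZero F i)

theorem expCoeff_zero (n i : ℕ) :
    expCoeff (0 : Matrix (Fin n) (Fin n) (CInfty F)) i = expCoeffZero F i • 1 := by
  induction i using Nat.twoStepInduction with
  | zero => simp [expCoeff, expCoeffZero]
  | one => simp [expCoeff, expCoeffZero]
  | more i ih _ =>
    rw [expCoeff, expCoeffZero, ih, zero_mul, zero_add, mul_smul]
    congr 1
    ext j k
    rcases eq_or_ne j k with rfl | h
    · simp
    · simp [h]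

theorem expCoeffZero_odd (i : ℕ) : expCoeffZero F (2 * i + 1) = 0 := by
  induction i with
  | zero => rfl
  | succ i ih => rw [mul_add_one, add_right_comm, expCoeffZero, ih, map_zero, mul_zero]

/-- The exponential map of the one-dimensional module `M(0)`. -/
def exp₀ (y : CInfty F) : CInfty F :=
  mExp (0 : Matrix (Fin 1) (Fin 1) (CInfty F)) (fun _ => y) 0

theorem norm_zero_matrix_le : ‖(0 : Matrix (Fin n) (Fin n) (CInfty F))‖ ≤ 1 :=
  norm_zero.trans_le zero_le_one

theorem mExp_zero_apply_eq_tsum (z : Fin n → CInfty F) (j : Fin n) :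
    mExp 0 z j = ∑' i, expCoeffZero F i * frob F i (z j) := by
  rw [mExp, addSum, tsum_apply (summable_exp norm_zero_matrix_le z)]
  refine tsum_congr fun i => ?_
  rw [addTerm, expCoeff_zero, Matrix.smul_mulVec, Matrix.one_mulVec]
  rfl

theorem mExp_zero_apply (z : Fin n → CInfty F) (j : Fin n) : mExp 0 z j = exp₀ (z j) := by
  rw [exp₀, mExp_zero_apply_eq_tsum, mExp_zero_apply_eq_tsum]

theorem mExp_zero_const (y : CInfty F) : mExp 0 (fun _ : Fin n => y) = fun _ => exp₀ y :=
  funext fun j => mExp_zero_apply _ j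

theorem exp₀_zero : exp₀ (0 : CInfty F) = 0 :=
  congrFun (mExp_zero (norm_zero_matrix_le (F := F) (n := 1))) 0

theorem exp₀_theta_mul (y : CInfty F) :
    exp₀ (theta F * y) = theta F * exp₀ y + exp₀ y ^ (Nat.card F ^ 2) := by
  have h := congrFun (mExp_theta_smul (norm_zero_matrix_le (F := F) (n := 1)) fun _ => y) 0
  rwa [tAct_apply, Matrix.zero_mulVec, add_zero] at h

theorem exp₀_mul {ω : CInfty F} (hω : ω ^ (Nat.card F ^ 2) = ω) (y : CInfty F) :
    exp₀ (ω * y) = ω * exp₀ y := by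
  have hf : ∀ i, frob F (2 * i) ω = ω := by
    intro i
    induction i with
    | zero => exact frob_zero_apply F ω
    | succ i ih => rw [mul_add_one, frob_add_apply, frob_apply F 2, hω, ih]
  rw [exp₀, exp₀, mExp_zero_apply_eq_tsum, mExp_zero_apply_eq_tsum, ← tsum_mul_left]
  refine tsum_congr fun i => ?_
  rcases Nat.even_or_odd' i with ⟨k, rfl | rfl⟩
  · rw [map_mul, hf, mul_left_comm]
  · rw [expCoeffZero_odd, zero_mul, zero_mul, mul_zero]

theorem mExp_zero_single (i : Fin n) (y : CInfty F) :
    mExp 0 (Pi.single i y) = Pi.single i (exp₀ y) := by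
  funext j
  rw [mExp_zero_apply]
  exact Pi.apply_single (fun _ => exp₀) (fun _ => exp₀_zero) i y j

theorem expEq_zero_iff {y : CInfty F} :
    ExpEq (0 : Matrix (Fin 1) (Fin 1) (CInfty F)) (fun _ => y) 0 ↔ exp₀ y = 0 := by
  rw [expEq_iff norm_zero_matrix_le, funext_iff, Fin.forall_fin_one]
  rfl

theorem norm_exp₀ {y : CInfty F} (hy : ‖y‖ < Nat.card F * torsionRadius F) : ‖exp₀ y‖ = ‖y‖ := by
  have h := norm_mExp (norm_zero_matrix_le (F := F) (n := 1)) (z := fun _ => y)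
    (by rwa [pi_norm_const])
  rwa [mExp_zero_const, pi_norm_const, pi_norm_const] at h

theorem exists_exp₀_eq {x : CInfty F} (hx : ‖x‖ < Nat.card F * torsionRadius F) :
    ∃ y, ‖y‖ = ‖x‖ ∧ exp₀ y = x := by
  obtain ⟨z, hz, hzx⟩ := exists_mExp_eq (norm_zero_matrix_le (F := F) (n := 1))
    (w := fun _ => x) (by rwa [pi_norm_const])
  have hz0 : z = fun _ => z 0 := funext fun j => congrArg z (Subsingleton.elim j 0)
  rw [hz0, pi_norm_const, pi_norm_const] at hz
  exact ⟨z 0, hz, by rw [← mExp_zero_apply, hzx]⟩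

theorem norm_eq_torsionRadius {x : CInfty F} (hx0 : x ≠ 0)
    (hx : x ^ (Nat.card F ^ 2) = -(theta F * x)) : ‖x‖ = torsionRadius F := by
  have hm : Nat.card F ^ 2 - 1 ≠ 0 :=
    (Nat.sub_pos_of_lt (Nat.one_lt_pow two_ne_zero Finite.one_lt_card)).ne'
  have hpow : ∀ {t : ℝ}, t ≠ 0 → t ^ (Nat.card F ^ 2) = Nat.card F * t →
      t ^ (Nat.card F ^ 2 - 1) = Nat.card F := fun ht h =>
    mul_right_cancel₀ ht ((pow_sub_one_mul (pow_pos Nat.card_pos 2).ne' _).trans h)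
  refine (pow_left_inj₀ (norm_nonneg x) (torsionRadius_pos F).le hm).mp ?_
  rw [hpow (torsionRadius_pos F).ne' (torsionRadius_pow F), hpow (norm_ne_zero_iff.mpr hx0)]
  rw [← norm_pow, hx, norm_neg, norm_mul, norm_theta]

variable {y₀ : CInfty F}

theorem IsNearestRoot.exp₀_eq_zero (hy : IsNearestRoot y₀) : exp₀ y₀ = 0 :=
  expEq_zero_iff.mp hy.2.1

theorem IsNearestRoot.norm_eq (hy : IsNearestRoot y₀) :
    ‖y₀‖ = Nat.card F * torsionRadius F := by
  apply le_antisymm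
  · obtain ⟨x, hx0, hx⟩ := exists_pow_eq_neg_theta_mul (F := F)
      (Nat.one_lt_pow two_ne_zero (Finite.one_lt_card (α := F)))
    have hxΛ := norm_eq_torsionRadius hx0 hx
    obtain ⟨y, hyx, rfl⟩ := exists_exp₀_eq (hxΛ.trans_lt torsionRadius_lt_card_mul)
    have hy0 : y ≠ 0 := norm_ne_zero_iff.mp (hyx ▸ norm_ne_zero_iff.mpr hx0)
    have hle := hy.2.2 (theta F * y) (mul_ne_zero (theta_ne_zero F) hy0)
      (expEq_zero_iff.mpr (by rw [exp₀_theta_mul, hx, add_neg_cancel]))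
    rwa [norm_mul, norm_theta, hyx, hxΛ] at hle
  · by_contra! hlt
    have h0 := norm_exp₀ hlt
    rw [hy.exp₀_eq_zero, norm_zero] at h0
    exact hy.1 (norm_eq_zero.mp h0.symm)

end BasePoint

/-! ### The quadratic extension `F_{q²}` and the base vectors -/

section QuadraticGenerator

theorem eq_zero_of_coeff_max_natDegree_eq_zero {R : Type*} [Semiring R] {a b : R[X]}
    (ha : a.coeff (max a.natDegree b.natDegree) = 0)
    (hb : b.coeff (max a.natDegree b.natDegree) = 0) : a = 0 ∧ b = 0 := by
  wlog h : a.natDegree ≤ b.natDegree generalizing a b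
  · exact (this (max_comm a.natDegree _ ▸ hb) (max_comm a.natDegree _ ▸ ha)
      (le_of_not_ge h)).symm
  rw [max_eq_right h] at ha hb
  obtain rfl : b = 0 := Polynomial.leadingCoeff_eq_zero.mp hb
  refine ⟨Polynomial.leadingCoeff_eq_zero.mp ?_, rfl⟩
  rwa [Polynomial.leadingCoeff, h.antisymm (by simp)]

variable {F : Type*} [Field F] [Finite F]

/-- `ω` is an element of `F_{q²}` outside `F_q`. -/
structure IsQuadraticGenerator (ω : CInfty F) : Prop where
  pow_card_sq : ω ^ (Nat.card F ^ 2) = ω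
  pow_card_ne : ω ^ Nat.card F ≠ ω

theorem exists_algebraMap_eq_of_frob_eq {x : CInfty F} (hx : frob F 1 x = x) :
    ∃ a : F, algebraMap F (CInfty F) a = x := by
  have := Fintype.ofFinite F
  have hq : 1 < Nat.card F := Finite.one_lt_card
  have hsplit : (Polynomial.X ^ Nat.card F - Polynomial.X : F[X]).Splits := by
    rw [Polynomial.splits_iff_card_roots, Nat.card_eq_fintype_card,
      FiniteField.roots_X_pow_card_sub_X, FiniteField.X_pow_card_sub_X_natDegree_eq F
      Fintype.one_lt_card]
    rfl
  refine hsplit.mem_range_of_isRoot (FiniteField.X_pow_card_sub_X_ne_zero F hq) ?_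
  rw [Polynomial.map_sub, Polynomial.map_pow, Polynomial.map_X, Polynomial.IsRoot,
    Polynomial.eval_sub, Polynomial.eval_pow, Polynomial.eval_X, sub_eq_zero]
  rwa [frob_apply, pow_one] at hx

variable {ω : CInfty F} (hω : IsQuadraticGenerator ω)

include hω

theorem IsQuadraticGenerator.frob_sub_ne_zero : frob F 1 ω - ω ≠ 0 := by
  rw [frob_apply, pow_one, sub_ne_zero]
  exact hω.pow_card_ne

theorem IsQuadraticGenerator.eq_zero_of_add_mul_eq_zero {a b : F}
    (h : algebraMap F (CInfty F) a + algebraMap F (CInfty F) b * ω = 0) : a = 0 ∧ b = 0 := by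
  have hfrob : ∀ c : F, frob F 1 (algebraMap F (CInfty F) c) = algebraMap F (CInfty F) c :=
    fun c => algebraMap_pow_card_pow c 1
  have hb : algebraMap F (CInfty F) b * (frob F 1 ω - ω) = 0 := by
    have h1 := congrArg (frob F 1) h
    rw [map_add, map_mul, hfrob, hfrob, map_zero] at h1
    linear_combination h1 - h
  obtain rfl : b = 0 :=
    (map_eq_zero _).mp ((mul_eq_zero.mp hb).resolve_right hω.frob_sub_ne_zero)
  rw [map_zero, zero_mul, add_zero] at h
  exact ⟨(map_eq_zero _).mp h, rfl⟩

theorem IsQuadraticGenerator.norm_add_mul {a b : F} (h : ¬(a = 0 ∧ b = 0)) :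
    ‖algebraMap F (CInfty F) a + algebraMap F (CInfty F) b * ω‖ = 1 := by
  refine norm_eq_one_of_pow_eq_self (Nat.one_lt_pow two_ne_zero (Finite.one_lt_card (α := F)))
    (fun h0 => h (hω.eq_zero_of_add_mul_eq_zero h0)) ?_
  rw [← frob_apply, map_add, map_mul, frob_apply, frob_apply, frob_apply,
    algebraMap_pow_card_pow, algebraMap_pow_card_pow, hω.pow_card_sq]

theorem IsQuadraticGenerator.norm_add_mul_le_one (a b : F) :
    ‖algebraMap F (CInfty F) a + algebraMap F (CInfty F) b * ω‖ ≤ 1 := by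
  by_cases h : a = 0 ∧ b = 0
  · simp [h.1, h.2]
  · exact (hω.norm_add_mul h).le

theorem IsQuadraticGenerator.norm_eq_one : ‖ω‖ = 1 := by
  simpa using hω.norm_add_mul (a := 0) (b := 1) (by simp)

theorem IsQuadraticGenerator.norm_frob_sub : ‖frob F 1 ω - ω‖ = 1 := by
  refine norm_eq_one_of_pow_eq_self (Nat.one_lt_pow two_ne_zero (Finite.one_lt_card (α := F)))
    hω.frob_sub_ne_zero ?_
  rw [← frob_apply, map_sub, ← frob_add_apply, add_comm, frob_add_apply, frob_apply F 2,
    hω.pow_card_sq]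

theorem IsQuadraticGenerator.exists_add_mul_eq {ζ : CInfty F} (hζ : ζ ^ (Nat.card F ^ 2) = ζ) :
    ∃ a b : F, ζ = algebraMap F (CInfty F) a + algebraMap F (CInfty F) b * ω := by
  have hζ' : frob F 1 (frob F 1 ζ) = ζ := (frob_add_apply F 1 1 ζ).symm.trans hζ
  have hω' : frob F 1 (frob F 1 ω) = ω := (frob_add_apply F 1 1 ω).symm.trans hω.pow_card_sq
  obtain ⟨b, hb⟩ := exists_algebraMap_eq_of_frob_eq
    (x := (frob F 1 ζ - ζ) / (frob F 1 ω - ω)) (by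
      rw [map_div₀, map_sub, map_sub, hζ', hω', ← neg_div_neg_eq, neg_sub, neg_sub])
  have hbω : algebraMap F (CInfty F) b * (frob F 1 ω - ω) = frob F 1 ζ - ζ := by
    rw [hb, div_mul_cancel₀ _ hω.frob_sub_ne_zero]
  have hbF : frob F 1 (algebraMap F (CInfty F) b) = algebraMap F (CInfty F) b :=
    algebraMap_pow_card_pow b 1
  obtain ⟨a, ha⟩ := exists_algebraMap_eq_of_frob_eq
    (x := ζ - algebraMap F (CInfty F) b * ω) (by
      rw [map_sub, map_mul, hbF]
      linear_combination -hbω)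
  exact ⟨a, b, by rw [ha, sub_add_cancel]⟩

omit hω

theorem algebraMap_poly_eq_sum (p : F[X]) {d : ℕ} (hd : p.natDegree ≤ d) :
    algebraMap F[X] (CInfty F) p =
      ∑ i ∈ Finset.range (d + 1), algebraMap F (CInfty F) (p.coeff i) * theta F ^ i := by
  conv_lhs => rw [p.as_sum_range_C_mul_X_pow' (Nat.lt_succ_of_le hd), map_sum]
  refine Finset.sum_congr rfl fun i _ => ?_
  rw [map_mul, map_pow]
  rfl

theorem norm_sum_mul_theta_pow {c : ℕ → CInfty F} {d : ℕ} (hc : ∀ i, ‖c i‖ ≤ 1)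
    (hd : ‖c d‖ = 1) :
    ‖∑ i ∈ Finset.range (d + 1), c i * theta F ^ i‖ = (Nat.card F : ℝ) ^ d := by
  have hq1 := one_lt_card_real F
  have hq0 := card_pos_real F
  have hnorm : ∀ i, ‖c i * theta F ^ i‖ = ‖c i‖ * (Nat.card F : ℝ) ^ i := fun i => by
    rw [norm_mul, norm_pow, norm_theta]
  have htop : ‖c d * theta F ^ d‖ = (Nat.card F : ℝ) ^ d := by rw [hnorm, hd, one_mul]
  have hlow : ‖∑ i ∈ Finset.range d, c i * theta F ^ i‖ < (Nat.card F : ℝ) ^ d := by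
    rcases Nat.eq_zero_or_pos d with rfl | hpos
    · simp
    refine lt_of_le_of_lt (IsUltrametricDist.norm_sum_le_of_forall_le_of_nonneg
      (pow_nonneg hq0.le (d - 1)) fun i hi => ?_) (pow_lt_pow_right₀ hq1 (by omega))
    rw [hnorm]
    exact (mul_le_of_le_one_left (by positivity) (hc i)).trans
      (pow_le_pow_right₀ hq1.le (Nat.le_sub_one_of_lt (Finset.mem_range.mp hi)))
  rw [Finset.sum_range_succ, IsUltrametricDist.norm_add_eq_max_of_norm_ne_norm
    (htop ▸ hlow.ne), htop, max_eq_right hlow.le]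

include hω

theorem IsQuadraticGenerator.norm_poly_add_mul {a b : F[X]} (h : ¬(a = 0 ∧ b = 0)) :
    ‖algebraMap F[X] (CInfty F) a + algebraMap F[X] (CInfty F) b * ω‖ =
      (Nat.card F : ℝ) ^ max a.natDegree b.natDegree := by
  rw [algebraMap_poly_eq_sum a (le_max_left _ b.natDegree),
    algebraMap_poly_eq_sum b (le_max_right a.natDegree _), Finset.sum_mul,
    ← Finset.sum_add_distrib,
    ← norm_sum_mul_theta_pow (fun i => hω.norm_add_mul_le_one (a.coeff i) (b.coeff i))
      (hω.norm_add_mul fun h0 => h (eq_zero_of_coeff_max_natDegree_eq_zero h0.1 h0.2))]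
  exact congrArg norm (Finset.sum_congr rfl fun i _ => by ring)

theorem IsQuadraticGenerator.norm_poly_le (a b : F[X]) :
    ‖algebraMap F[X] (CInfty F) b‖ ≤
      ‖algebraMap F[X] (CInfty F) a + algebraMap F[X] (CInfty F) b * ω‖ := by
  rcases eq_or_ne b 0 with rfl | hb
  · simp
  have hbnorm := hω.norm_poly_add_mul (a := b) (b := 0) (fun h => hb h.1)
  rw [map_zero, zero_mul, add_zero, Polynomial.natDegree_zero, max_eq_left (Nat.zero_le _)]
    at hbnorm
  rw [hω.norm_poly_add_mul (fun h => hb h.2), hbnorm]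
  exact pow_le_pow_right₀ (one_lt_card_real F).le (le_max_right _ _)

theorem IsQuadraticGenerator.one_le_norm_ratFunc_add (r : RatFunc F) :
    1 ≤ ‖algebraMap (RInfty F) (CInfty F) (algebraMap (RatFunc F) (RInfty F) r) + ω‖ := by
  have hden : algebraMap F[X] (CInfty F) r.denom ≠ 0 :=
    (map_ne_zero_iff _ (polyHom_injective F)).mpr r.denom_ne_zero
  have hr : algebraMap (RInfty F) (CInfty F) (algebraMap (RatFunc F) (RInfty F) r) *
      algebraMap F[X] (CInfty F) r.denom = algebraMap F[X] (CInfty F) r.num := by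
    change algebraMap (RInfty F) (CInfty F) _ * algebraMap (RInfty F) (CInfty F)
      (algebraMap (RatFunc F) (RInfty F) (algebraMap F[X] (RatFunc F) r.denom)) =
      algebraMap (RInfty F) (CInfty F)
        (algebraMap (RatFunc F) (RInfty F) (algebraMap F[X] (RatFunc F) r.num))
    rw [← map_mul, ← map_mul,
      (eq_div_iff (RatFunc.algebraMap_ne_zero r.denom_ne_zero)).mp r.num_div_denom.symm]
  have hle := hω.norm_poly_le r.num r.denom
  rw [← hr, mul_comm (algebraMap F[X] (CInfty F) r.denom) ω, ← add_mul, norm_mul] at hle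
  exact (le_mul_iff_one_le_left (norm_pos_iff.mpr hden)).mp hle

theorem IsQuadraticGenerator.one_le_norm_add (a : RInfty F) :
    1 ≤ ‖algebraMap (RInfty F) (CInfty F) a + ω‖ := by
  obtain ⟨r, hr⟩ := Metric.denseRange_iff.mp (denseRange_ratFunc F) a 1 one_pos
  have hlt : ‖algebraMap (RInfty F) (CInfty F) (a - algebraMap (RatFunc F) (RInfty F) r)‖ < 1 := by
    rwa [norm_algebraMap', ← dist_eq_norm]
  have hr1 := hω.one_le_norm_ratFunc_add r
  rw [← sub_add_cancel a (algebraMap (RatFunc F) (RInfty F) r), map_add, add_assoc,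
    IsUltrametricDist.norm_add_eq_max_of_norm_ne_norm (hlt.trans_le hr1).ne]
  exact hr1.trans (le_max_right _ _)

theorem IsQuadraticGenerator.max_norm_le (a b : RInfty F) :
    max ‖a‖ ‖b‖ ≤
      ‖algebraMap (RInfty F) (CInfty F) a + algebraMap (RInfty F) (CInfty F) b * ω‖ := by
  have hb : ‖b‖ ≤
      ‖algebraMap (RInfty F) (CInfty F) a + algebraMap (RInfty F) (CInfty F) b * ω‖ := by
    rcases eq_or_ne b 0 with rfl | hb
    · simp
    have hfactor : algebraMap (RInfty F) (CInfty F) a + algebraMap (RInfty F) (CInfty F) b * ω =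
        algebraMap (RInfty F) (CInfty F) b * (algebraMap (RInfty F) (CInfty F) (a / b) + ω) := by
      rw [mul_add, ← map_mul, mul_div_cancel₀ _ hb]
    rw [hfactor, norm_mul, norm_algebraMap']
    exact le_mul_of_one_le_right (norm_nonneg b) (hω.one_le_norm_add _)
  refine max_le ?_ hb
  rw [← norm_algebraMap' (CInfty F) a]
  conv_lhs => rw [← add_sub_cancel_right (algebraMap (RInfty F) (CInfty F) a)
    (algebraMap (RInfty F) (CInfty F) b * ω)]
  refine (norm_sub_le_max _ _).trans (max_le le_rfl ?_)
  rwa [norm_mul, hω.norm_eq_one, norm_algebraMap', mul_one]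

end QuadraticGenerator

section BaseVec

variable {F : Type*} [Field F] [Finite F] {n : ℕ} {ω y : CInfty F}
  {l : Fin n ⊕ Fin n → Fin n → CInfty F}

theorem sum_smul_baseVec (ω y : CInfty F) (c : Fin n ⊕ Fin n → CInfty F) (i : Fin n) :
    (∑ j, c j • baseVec n ω y j) i = (c (Sum.inl i) + c (Sum.inr i) * ω) * y := by
  simp [baseVec, Fintype.sum_sum_type, Finset.sum_apply, Pi.single_apply, add_mul, mul_assoc]

theorem smul_baseVec (ω y t : CInfty F) (j : Fin n ⊕ Fin n) :
    t • baseVec n ω y j = baseVec n ω (t * y) j := by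
  rcases j with i | i
  · simp only [baseVec, Sum.elim_inl, ← Pi.single_smul, smul_eq_mul]
  · simp only [baseVec, Sum.elim_inr, ← Pi.single_smul, smul_eq_mul, mul_left_comm]

theorem baseVec_zero (ω : CInfty F) (j : Fin n ⊕ Fin n) : baseVec n ω 0 j = 0 := by
  rw [← zero_mul (0 : CInfty F), ← smul_baseVec, zero_smul]

theorem norm_baseVec (hω : ‖ω‖ = 1) (y : CInfty F) (j : Fin n ⊕ Fin n) :
    ‖baseVec n ω y j‖ = ‖y‖ := by
  rcases j with i | i
  · simp only [baseVec, Sum.elim_inl, Pi.norm_single]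
  · simp only [baseVec, Sum.elim_inr, Pi.norm_single, norm_mul, hω, one_mul]

theorem mExp_zero_baseVec (hω : ω ^ (Nat.card F ^ 2) = ω) (y : CInfty F)
    (j : Fin n ⊕ Fin n) : mExp 0 (baseVec n ω y j) = baseVec n ω (exp₀ y) j := by
  rcases j with i | i
  · simp only [baseVec, Sum.elim_inl, mExp_zero_single]
  · simp only [baseVec, Sum.elim_inr, mExp_zero_single, exp₀_mul hω]

theorem linearIndependent_of_close (hω : IsQuadraticGenerator ω)
    (hl : ∀ j, ‖l j - baseVec n ω y j‖ < ‖y‖) : LinearIndependent (RInfty F) l := by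
  refine linearIndependent_of_norm_sub_lt (fun c j => ?_) hl
  have hmax : ∀ i, max ‖c (Sum.inl i)‖ ‖c (Sum.inr i)‖ * ‖y‖ ≤
      ‖∑ j, c j • baseVec n ω y j‖ := fun i => by
    refine le_trans ?_ (norm_le_pi_norm _ i)
    simp only [← algebraMap_smul (CInfty F) (c _)]
    rw [sum_smul_baseVec, norm_mul]
    exact mul_le_mul_of_nonneg_right (hω.max_norm_le _ _) (norm_nonneg y)
  rcases j with i | i
  · exact (mul_le_mul_of_nonneg_right (le_max_left _ _) (norm_nonneg y)).trans (hmax i)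
  · exact (mul_le_mul_of_nonneg_right (le_max_right _ _) (norm_nonneg y)).trans (hmax i)

theorem linearIndependent_inl_of_close (hl : ∀ j, ‖l j - baseVec n ω y j‖ < ‖y‖) :
    LinearIndependent (CInfty F) fun i => l (Sum.inl i) := by
  refine linearIndependent_of_norm_sub_lt (b := fun i => Pi.single i y) (fun c i => ?_)
    fun i => hl (Sum.inl i)
  refine le_trans (le_of_eq ?_) (norm_le_pi_norm _ i)
  simp [Finset.sum_apply, Pi.single_apply]

end BaseVec

/-! ### The lattice of `M(A)` for small `A` -/

section Lattice

variable {F : Type*} [Field F] [Finite F] {n : ℕ} {ω y : CInfty F}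
  {A : Matrix (Fin n) (Fin n) (CInfty F)}

theorem norm_le_one_of_lt_inv_card (hA : ‖A‖ < (Nat.card F : ℝ)⁻¹) : ‖A‖ ≤ 1 :=
  hA.le.trans (inv_le_one_of_one_le₀ (one_lt_card_real F).le)

theorem norm_mExp_sub_mExp_zero_lt (hA : ‖A‖ < (Nat.card F : ℝ)⁻¹) {z : Fin n → CInfty F}
    (hz : ‖z‖ ≤ Nat.card F * torsionRadius F) : ‖mExp A z - mExp 0 z‖ < torsionRadius F :=
  calc ‖mExp A z - mExp 0 z‖ ≤ ‖A‖ * (Nat.card F * torsionRadius F) :=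
        norm_mExp_sub_mExp_zero_le (norm_le_one_of_lt_inv_card hA) hz
    _ < (Nat.card F : ℝ)⁻¹ * (Nat.card F * torsionRadius F) :=
        mul_lt_mul_of_pos_right hA (mul_pos (card_pos_real F) (torsionRadius_pos F))
    _ = torsionRadius F := inv_mul_cancel_left₀ (card_pos_real F).ne' _

theorem exists_isCloseVec (hω : IsQuadraticGenerator ω) (hy : IsNearestRoot y)
    (hA : ‖A‖ < (Nat.card F : ℝ)⁻¹) (j : Fin n ⊕ Fin n) : ∃ x, IsCloseVec ω y A j x := by
  have hA1 := norm_le_one_of_lt_inv_card hA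
  have hb : ‖baseVec n ω y j‖ ≤ Nat.card F * torsionRadius F := by
    rw [norm_baseVec hω.norm_eq_one, hy.norm_eq]
  have hsmall : ‖mExp A (baseVec n ω y j)‖ < Nat.card F * torsionRadius F := by
    have h := norm_mExp_sub_mExp_zero_lt hA hb
    rw [mExp_zero_baseVec hω.pow_card_sq, hy.exp₀_eq_zero, baseVec_zero, sub_zero] at h
    exact h.trans torsionRadius_lt_card_mul
  obtain ⟨z, hz, hzE⟩ := exists_mExp_eq hA1 hsmall
  refine ⟨baseVec n ω y j - z, (mem_motiveLattice hA1).mpr ?_, ?_⟩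
  · rw [mExp_sub hA1, hzE, sub_self]
  · rwa [sub_sub_cancel_left, norm_neg, hz, hy.norm_eq]

theorem IsCloseVec.eq (hy : IsNearestRoot y) (hA : ‖A‖ ≤ 1) {j : Fin n ⊕ Fin n}
    {x x' : Fin n → CInfty F} (hx : IsCloseVec ω y A j x) (hx' : IsCloseVec ω y A j x') :
    x = x' := by
  refine sub_eq_zero.mp (eq_zero_of_mExp_eq_zero hA ?_
    ((mem_motiveLattice hA).mp (sub_mem hx.1 hx'.1)))
  rw [← sub_sub_sub_cancel_right x x' (baseVec n ω y j), ← hy.norm_eq]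
  exact (norm_sub_le_max _ _).trans_lt (max_lt hx.2 hx'.2)

theorem IsCloseVec.norm_le (hω : ‖ω‖ = 1) {j : Fin n ⊕ Fin n} {x : Fin n → CInfty F}
    (hx : IsCloseVec ω y A j x) : ‖x‖ ≤ ‖y‖ := by
  rw [← sub_add_cancel x (baseVec n ω y j)]
  exact (IsUltrametricDist.norm_add_le_max _ _).trans
    (max_le hx.2.le (norm_baseVec hω y j).le)

theorem exp₀_theta_inv_mul_pow (hy : exp₀ y = 0) :
    exp₀ ((theta F)⁻¹ * y) ^ (Nat.card F ^ 2) = -(theta F * exp₀ ((theta F)⁻¹ * y)) := by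
  have h := exp₀_theta_mul ((theta F)⁻¹ * y)
  rw [mul_inv_cancel_left₀ (theta_ne_zero F), hy] at h
  exact (neg_eq_of_add_eq_zero_right h.symm).symm

theorem IsNearestRoot.exp₀_theta_inv_mul_ne_zero (hy : IsNearestRoot y) :
    exp₀ ((theta F)⁻¹ * y) ≠ 0 := by
  have h : ‖(theta F)⁻¹ * y‖ = torsionRadius F := by
    rw [norm_mul, norm_inv, norm_theta, hy.norm_eq, inv_mul_cancel_left₀ (card_pos_real F).ne']
  rw [← norm_pos_iff, norm_exp₀ (h ▸ torsionRadius_lt_card_mul), h]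
  exact torsionRadius_pos F

theorem norm_mExp_theta_inv_smul_sub_lt (hω : IsQuadraticGenerator ω) (hy : IsNearestRoot y)
    (hA : ‖A‖ < (Nat.card F : ℝ)⁻¹) {j : Fin n ⊕ Fin n} {x : Fin n → CInfty F}
    (hx : ‖x - baseVec n ω y j‖ < ‖y‖) :
    ‖mExp A ((theta F)⁻¹ • x) - baseVec n ω (exp₀ ((theta F)⁻¹ * y)) j‖ < torsionRadius F := by
  have hq0 := card_pos_real F
  have hA1 := norm_le_one_of_lt_inv_card hA
  set b := baseVec n ω y j
  have hb : ‖(theta F)⁻¹ • b‖ = torsionRadius F := by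
    rw [norm_theta_inv_smul, norm_baseVec hω.norm_eq_one, hy.norm_eq,
      mul_div_cancel_left₀ _ hq0.ne']
  have hxb : ‖(theta F)⁻¹ • (x - b)‖ < torsionRadius F := by
    rwa [norm_theta_inv_smul, div_lt_iff₀' hq0, ← hy.norm_eq]
  have hdecomp : mExp A ((theta F)⁻¹ • x) - baseVec n ω (exp₀ ((theta F)⁻¹ * y)) j =
      mExp A ((theta F)⁻¹ • (x - b)) +
        (mExp A ((theta F)⁻¹ • b) - mExp 0 ((theta F)⁻¹ • b)) := by
    rw [smul_sub, mExp_sub hA1, smul_baseVec, mExp_zero_baseVec hω.pow_card_sq]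
    abel
  rw [hdecomp]
  refine (IsUltrametricDist.norm_add_le_max _ _).trans_lt (max_lt ?_ ?_)
  · rwa [norm_mExp hA1 (hxb.trans torsionRadius_lt_card_mul)]
  · exact norm_mExp_sub_mExp_zero_lt hA (hb.le.trans torsionRadius_lt_card_mul.le)

theorem tAct_const_smul (A : Matrix (Fin n) (Fin n) (CInfty F)) (a : F)
    (x : Fin n → CInfty F) :
    tAct A (algebraMap F (CInfty F) a • x) = algebraMap F (CInfty F) a • tAct A x := by
  simp only [tAct_apply, vecFrob_smul, frob_apply, algebraMap_pow_card_pow, Matrix.mulVec_smul,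
    smul_add, smul_comm (theta F)]

theorem torsionRadius_pow_card_lt :
    torsionRadius F ^ Nat.card F < Nat.card F * torsionRadius F := by
  rw [← torsionRadius_pow]
  exact pow_lt_pow_right₀ (one_lt_torsionRadius F)
    (lt_self_pow₀ Finite.one_lt_card one_lt_two)

theorem exists_tAct_zero_sub_eq_zero (hA : ‖A‖ ≤ 1) {x : Fin n → CInfty F}
    (hx : tAct A x = 0) : ∃ η, ‖η‖ < torsionRadius F ∧ tAct 0 (x - η) = 0 := by
  have h0x : tAct 0 x = -A.mulVec (vecFrob 1 x) := by
    rw [tAct_apply] at hx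
    rw [tAct_apply, Matrix.zero_mulVec, add_zero, eq_neg_iff_add_eq_zero, ← hx]
    abel
  have hsmall : ‖tAct 0 x‖ < Nat.card F * torsionRadius F :=
    calc ‖tAct 0 x‖ ≤ ‖x‖ ^ Nat.card F := by
          rw [h0x, norm_neg, ← pow_one (Nat.card F), ← norm_vecFrob]
          exact (norm_mulVec_le _ _).trans (mul_le_of_le_one_left (norm_nonneg _) hA)
      _ ≤ torsionRadius F ^ Nat.card F :=
          pow_le_pow_left₀ (norm_nonneg x) (norm_le_of_tAct_eq_zero hA hx) _
      _ < Nat.card F * torsionRadius F := torsionRadius_pow_card_lt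
  obtain ⟨η, hη, hηx⟩ := exists_tAct_eq norm_zero_matrix_le hsmall
  exact ⟨η, hη, by rw [map_sub, hηx, sub_self]⟩

theorem exists_eq_sum_baseVec (hω : IsQuadraticGenerator ω) {μ : CInfty F} (hμ0 : μ ≠ 0)
    (hμ : μ ^ (Nat.card F ^ 2) = -(theta F * μ)) {x : Fin n → CInfty F} (hx : tAct 0 x = 0) :
    ∃ c : Fin n ⊕ Fin n → F, x = ∑ j, algebraMap F (CInfty F) (c j) • baseVec n ω μ j := by
  have hcoord (i : Fin n) : ∃ a b : F,
      x i = (algebraMap F (CInfty F) a + algebraMap F (CInfty F) b * ω) * μ := by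
    have hxi : theta F * x i + x i ^ (Nat.card F ^ 2) = 0 := by
      rw [tAct_apply, Matrix.zero_mulVec, add_zero] at hx
      exact congrFun hx i
    have hfix : (x i / μ) ^ (Nat.card F ^ 2) = x i / μ := by
      rw [div_pow, (neg_eq_of_add_eq_zero_right hxi).symm, hμ, neg_div_neg_eq,
        mul_div_mul_left _ _ (theta_ne_zero F)]
    obtain ⟨a, b, hab⟩ := hω.exists_add_mul_eq hfix
    exact ⟨a, b, (div_eq_iff hμ0).mp hab⟩
  choose a b hab using hcoord
  refine ⟨Sum.elim a b, funext fun i => ?_⟩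
  rw [sum_smul_baseVec, hab]
  rfl

theorem exists_eq_sum_torsion (hω : IsQuadraticGenerator ω) (hA : ‖A‖ ≤ 1) {μ : CInfty F}
    (hμ0 : μ ≠ 0) (hμ : μ ^ (Nat.card F ^ 2) = -(theta F * μ))
    {t : Fin n ⊕ Fin n → Fin n → CInfty F} (ht : ∀ j, tAct A (t j) = 0)
    (htb : ∀ j, ‖t j - baseVec n ω μ j‖ < torsionRadius F) {x : Fin n → CInfty F}
    (hx : tAct A x = 0) :
    ∃ c : Fin n ⊕ Fin n → F, x = ∑ j, algebraMap F (CInfty F) (c j) • t j := by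
  obtain ⟨η, hη, hker⟩ := exists_tAct_zero_sub_eq_zero hA hx
  obtain ⟨c, hc⟩ := exists_eq_sum_baseVec hω hμ0 hμ hker
  refine ⟨c, sub_eq_zero.mp (eq_zero_of_tAct_eq_zero hA ?_ ?_)⟩
  · have hdecomp : x - ∑ j, algebraMap F (CInfty F) (c j) • t j =
        η - ∑ j, algebraMap F (CInfty F) (c j) • (t j - baseVec n ω μ j) := by
      simp only [smul_sub, Finset.sum_sub_distrib, ← hc]
      abel
    have hsum := norm_sum_smul_lt one_pos (torsionRadius_pos F)
      (fun j => norm_algebraMap_le_one (c j)) htb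
    rw [one_mul] at hsum
    rw [hdecomp]
    exact (norm_sub_le_max _ _).trans_lt (max_lt hη hsum)
  · rw [map_sub, hx, map_sum, zero_sub, neg_eq_zero]
    exact Finset.sum_eq_zero fun j _ => by rw [tAct_const_smul, ht, smul_zero]

theorem C_smul_eq_algebraMap_smul (a : F) (v : Fin n → CInfty F) :
    Polynomial.C a • v = algebraMap F (CInfty F) a • v :=
  (algebraMap_smul (CInfty F) (Polynomial.C a) v).symm

theorem X_smul_eq_theta_smul (v : Fin n → CInfty F) :
    (Polynomial.X : F[X]) • v = theta F • v :=
  (algebraMap_smul (CInfty F) (Polynomial.X : F[X]) v).symm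

theorem exists_eq_sum_add_X_smul (hω : IsQuadraticGenerator ω) (hy : IsNearestRoot y)
    (hA : ‖A‖ < (Nat.card F : ℝ)⁻¹) {l : Fin n ⊕ Fin n → Fin n → CInfty F}
    (hl : ∀ j, IsCloseVec ω y A j (l j)) {z : Fin n → CInfty F} (hz : z ∈ motiveLattice A) :
    ∃ c : Fin n ⊕ Fin n → F, ∃ z' ∈ motiveLattice A,
      z = ∑ j, Polynomial.C (c j) • l j + (Polynomial.X : F[X]) • z' := by
  have hA1 := norm_le_one_of_lt_inv_card hA
  have htor {x} (hx : x ∈ motiveLattice A) : tAct A (mExp A ((theta F)⁻¹ • x)) = 0 := by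
    rw [tAct_mExp_theta_inv_smul hA1, (mem_motiveLattice hA1).mp hx]
  obtain ⟨c, hc⟩ := exists_eq_sum_torsion hω hA1 hy.exp₀_theta_inv_mul_ne_zero
    (exp₀_theta_inv_mul_pow hy.exp₀_eq_zero) (fun j => htor (hl j).1)
    (fun j => norm_mExp_theta_inv_smul_sub_lt hω hy hA (hl j).2) (htor hz)
  refine ⟨c, (theta F)⁻¹ • (z - ∑ j, Polynomial.C (c j) • l j),
    (mem_motiveLattice hA1).mpr ?_, ?_⟩
  · simp only [smul_sub, Finset.smul_sum, mExp_sub hA1, mExp_sum hA1, hc,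
      C_smul_eq_algebraMap_smul, smul_comm (theta F)⁻¹, mExp_const_smul hA1, sub_self]
  · rw [X_smul_eq_theta_smul, smul_inv_smul₀ (theta_ne_zero F), add_sub_cancel]

theorem norm_theta_smul (z : Fin n → CInfty F) : ‖theta F • z‖ = Nat.card F * ‖z‖ := by
  rw [norm_smul, norm_theta]

theorem mem_span_of_norm_lt (hω : IsQuadraticGenerator ω) (hy : IsNearestRoot y)
    (hA : ‖A‖ < (Nat.card F : ℝ)⁻¹) {l : Fin n ⊕ Fin n → Fin n → CInfty F}
    (hl : ∀ j, IsCloseVec ω y A j (l j)) (m : ℕ) : ∀ z ∈ motiveLattice A,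
      ‖z‖ < ‖y‖ * (Nat.card F : ℝ) ^ m → z ∈ Submodule.span F[X] (Set.range l) := by
  have hA1 := norm_le_one_of_lt_inv_card hA
  have hy0 : 0 < ‖y‖ := norm_pos_iff.mpr hy.1
  induction m with
  | zero =>
    intro z hz hzn
    rw [pow_zero, mul_one, hy.norm_eq] at hzn
    rw [eq_zero_of_mExp_eq_zero hA1 hzn ((mem_motiveLattice hA1).mp hz)]
    exact Submodule.zero_mem _
  | succ m ih =>
    intro z hz hzn
    obtain ⟨c, z', hz', rfl⟩ := exists_eq_sum_add_X_smul hω hy hA hl hz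
    have hsum : ‖∑ j, Polynomial.C (c j) • l j‖ < ‖y‖ * (Nat.card F : ℝ) ^ (m + 1) := by
      refine lt_of_le_of_lt ?_ (lt_mul_of_one_lt_right hy0
        (one_lt_pow₀ (one_lt_card_real F) m.succ_ne_zero))
      refine IsUltrametricDist.norm_sum_le_of_forall_le_of_nonneg hy0.le fun j _ => ?_
      rw [C_smul_eq_algebraMap_smul, norm_smul]
      exact (mul_le_of_le_one_left (norm_nonneg _) (norm_algebraMap_le_one _)).trans
        ((hl j).norm_le hω.norm_eq_one)
    have hz'n : ‖z'‖ < ‖y‖ * (Nat.card F : ℝ) ^ m := by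
      have h := (norm_sub_le_max _ _).trans_lt (max_lt hzn hsum)
      rw [add_sub_cancel_left, X_smul_eq_theta_smul, norm_theta_smul, pow_succ',
        mul_left_comm] at h
      exact lt_of_mul_lt_mul_left h (card_pos_real F).le
    exact Submodule.add_mem _
      (Submodule.sum_mem _ fun j _ => Submodule.smul_mem _ _ (Submodule.subset_span ⟨j, rfl⟩))
      (Submodule.smul_mem _ _ (ih z' hz' hz'n))

theorem span_eq_motiveLattice_of_isCloseVec (hω : IsQuadraticGenerator ω)
    (hy : IsNearestRoot y) (hA : ‖A‖ < (Nat.card F : ℝ)⁻¹)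
    {l : Fin n ⊕ Fin n → Fin n → CInfty F} (hl : ∀ j, IsCloseVec ω y A j (l j)) :
    Submodule.span F[X] (Set.range l) = motiveLattice A := by
  apply le_antisymm
  · rw [Submodule.span_le]
    rintro _ ⟨j, rfl⟩
    exact (hl j).1
  · intro z hz
    obtain ⟨m, hm⟩ := pow_unbounded_of_one_lt (‖z‖ / ‖y‖) (one_lt_card_real F)
    exact mem_span_of_norm_lt hω hy hA hl m z hz ((div_lt_iff₀' (norm_pos_iff.mpr hy.1)).mp hm)

end Lattice

section Domain

variable {F : Type*} [Field F] [Finite F] {n : ℕ} {ω y : CInfty F}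
  {A : Matrix (Fin n) (Fin n) (CInfty F)}

theorem exists_norm_theta_smul_add_vecFrob_two_sub_lt (w : Fin n → CInfty F) {ε : ℝ}
    (hε : 0 < ε) : ∃ x, ‖theta F • x + vecFrob 2 x - w‖ < ε := by
  choose x hx using fun i => exists_norm_pow_add_theta_mul_sub_lt
    (Nat.one_lt_pow two_ne_zero (Finite.one_lt_card (α := F))) (w i) hε
  refine ⟨x, (pi_norm_lt_iff hε).mpr fun i => ?_⟩
  have h := hx i
  rwa [add_comm (x i ^ _)] at h

theorem norm_pow_card_le_max {x : Fin n → CInfty F} {r : ℝ} (hr : 0 ≤ r)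
    (h : ‖theta F • x + vecFrob 2 x‖ ≤ r ^ Nat.card F) :
    ‖x‖ ^ Nat.card F ≤ max (torsionRadius F ^ Nat.card F) r := by
  rcases le_or_gt ‖x‖ (torsionRadius F) with hx | hx
  · exact le_max_of_le_left (pow_le_pow_left₀ (norm_nonneg x) hx _)
  have hlt : ‖theta F • x‖ < ‖vecFrob 2 x‖ := by
    rw [norm_theta_smul, norm_vecFrob]
    exact card_mul_lt_pow_of_torsionRadius_lt hx
  rw [IsUltrametricDist.norm_add_eq_max_of_norm_ne_norm hlt.ne, max_eq_right hlt.le,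
    norm_vecFrob, sq, pow_mul] at h
  exact le_max_of_le_right (le_of_pow_le_pow_left₀ Nat.card_pos.ne' hr h)

theorem mem_range_mExp_of_norm_le_pow (hA : ‖A‖ ≤ 1) {r : ℝ} (hr : torsionRadius F ≤ r)
    (h : ∀ w, ‖w‖ ≤ r → w ∈ (mExpHom hA).range) {w : Fin n → CInfty F}
    (hw : ‖w‖ ≤ r ^ Nat.card F) : w ∈ (mExpHom hA).range := by
  have hr1 : 1 ≤ r := (one_lt_torsionRadius F).le.trans hr
  have hball {v} (hv : ‖v‖ < Nat.card F * torsionRadius F) : v ∈ (mExpHom hA).range :=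
    (exists_mExp_eq hA hv).imp fun z hz => hz.2
  obtain ⟨x, hx⟩ := exists_norm_theta_smul_add_vecFrob_two_sub_lt w one_pos
  have hxq : ‖x‖ ^ Nat.card F ≤ max (torsionRadius F ^ Nat.card F) r := by
    refine norm_pow_card_le_max (zero_le_one.trans hr1) ?_
    rw [← sub_add_cancel (theta F • x + vecFrob 2 x) w]
    exact (IsUltrametricDist.norm_add_le_max _ _).trans
      (max_le (hx.le.trans (one_le_pow₀ hr1)) hw)
  have hTx : tAct A x ∈ (mExpHom hA).range := by
    have hxr : ‖x‖ ≤ r := le_of_pow_le_pow_left₀ Nat.card_pos.ne' (zero_le_one.trans hr1)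
      (hxq.trans (max_le (pow_le_pow_left₀ (torsionRadius_pos F).le hr _)
        (le_self_pow₀ hr1 Nat.card_pos.ne')))
    obtain ⟨z, hz⟩ := h x hxr
    exact ⟨theta F • z, (mExp_theta_smul hA z).trans (congrArg (tAct A) hz)⟩
  have hAx : A.mulVec (vecFrob 1 x) ∈ (mExpHom hA).range := by
    have hle : ‖A.mulVec (vecFrob 1 x)‖ ≤ ‖x‖ ^ Nat.card F := by
      rw [← pow_one (Nat.card F), ← norm_vecFrob]
      exact (norm_mulVec_le _ _).trans (mul_le_of_le_one_left (norm_nonneg _) hA)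
    rcases le_max_iff.mp (hle.trans hxq) with h' | h'
    · exact hball (h'.trans_lt torsionRadius_pow_card_lt)
    · exact h _ h'
  have hrest : theta F • x + vecFrob 2 x - w ∈ (mExpHom hA).range :=
    hball (hx.trans ((one_lt_torsionRadius F).trans torsionRadius_lt_card_mul))
  have hdecomp : w = tAct A x - A.mulVec (vecFrob 1 x) - (theta F • x + vecFrob 2 x - w) := by
    rw [tAct_apply]
    abel
  rw [hdecomp]
  exact sub_mem (sub_mem hTx hAx) hrest

theorem uniformizable_of_norm_le_one (hA : ‖A‖ ≤ 1) : Uniformizable A := by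
  have h1 := one_lt_torsionRadius F
  have hmem (m : ℕ) :
      ∀ w, ‖w‖ ≤ torsionRadius F ^ (Nat.card F ^ m) → w ∈ (mExpHom hA).range := by
    induction m with
    | zero =>
      intro w hw
      rw [pow_zero, pow_one] at hw
      exact (exists_mExp_eq hA (hw.trans_lt torsionRadius_lt_card_mul)).imp fun z hz => hz.2
    | succ m ih =>
      intro w hw
      rw [pow_succ, pow_mul] at hw
      exact mem_range_mExp_of_norm_le_pow hA
        (le_self_pow₀ h1.le (pow_pos Nat.card_pos m).ne') ih hw
  intro w
  obtain ⟨m, hm⟩ := pow_unbounded_of_one_lt ‖w‖ h1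
  obtain ⟨z, hz⟩ := hmem m w
    (hm.le.trans (pow_le_pow_right₀ h1.le (Nat.lt_pow_self Finite.one_lt_card).le))
  exact ⟨z, (expEq_iff hA).mpr hz⟩

theorem poly_smul_eq (p : F[X]) (v : Fin n → CInfty F) :
    p • v = algebraMap (RatFunc F) (RInfty F) (algebraMap F[X] (RatFunc F) p) • v :=
  (algebraMap_smul (CInfty F) p v).symm.trans (algebraMap_smul (CInfty F)
    (algebraMap (RatFunc F) (RInfty F) (algebraMap F[X] (RatFunc F) p)) v)

theorem linearIndependent_poly_of_rInfty {ι : Type*} {l : ι → Fin n → CInfty F}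
    (hl : LinearIndependent (RInfty F) l) : LinearIndependent F[X] l := by
  rw [linearIndependent_iff'] at hl ⊢
  intro s c hc i hi
  simp only [poly_smul_eq] at hc
  exact (map_eq_zero_iff _ (RatFunc.algebraMap_injective F)).mp
    ((map_eq_zero (algebraMap (RatFunc F) (RInfty F))).mp (hl s _ hc i hi))

theorem span_rInfty_span_poly (s : Set (Fin n → CInfty F)) :
    Submodule.span (RInfty F) (Submodule.span F[X] s : Set (Fin n → CInfty F)) =
      Submodule.span (RInfty F) s := by
  refine le_antisymm (Submodule.span_le.mpr fun x hx => ?_)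
    (Submodule.span_mono Submodule.subset_span)
  induction hx using Submodule.span_induction with
  | mem x hx => exact Submodule.subset_span hx
  | zero => exact Submodule.zero_mem _
  | add x x' _ _ hx hx' => exact Submodule.add_mem _ hx hx'
  | smul p x _ hx =>
    rw [poly_smul_eq]
    exact Submodule.smul_mem _ _ hx

theorem isSiegelBasis_of_isCloseVec (hω : IsQuadraticGenerator ω) (hy : IsNearestRoot y)
    (hA : ‖A‖ < (Nat.card F : ℝ)⁻¹) {l : Fin n ⊕ Fin n → Fin n → CInfty F}
    (hl : ∀ j, IsCloseVec ω y A j (l j)) : IsSiegelBasis (motiveLattice A) l where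
  linearIndependent := linearIndependent_poly_of_rInfty
    (linearIndependent_of_close hω fun j => (hl j).2)
  span_eq := span_eq_motiveLattice_of_isCloseVec hω hy hA hl
  linearIndependent_inl := linearIndependent_inl_of_close fun j => (hl j).2

theorem isLattice_of_isCloseVec (hω : IsQuadraticGenerator ω) (hy : IsNearestRoot y)
    (hA : ‖A‖ < (Nat.card F : ℝ)⁻¹) {l : Fin n ⊕ Fin n → Fin n → CInfty F}
    (hl : ∀ j, IsCloseVec ω y A j (l j)) : IsLattice (2 * n) (motiveLattice A) := by
  have hS := isSiegelBasis_of_isCloseVec hω hy hA hl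
  refine ⟨?_, ?_, ?_⟩
  · rw [← hS.span_eq]
    exact ⟨(Module.Basis.span hS.linearIndependent).reindex
      (finSumFinEquiv.trans (finCongr (two_mul n).symm))⟩
  · have htop := hS.linearIndependent_inl.span_eq_top_of_card_eq_finrank' (by simp)
    refine top_le_iff.mp (htop.ge.trans (Submodule.span_mono ?_))
    rintro _ ⟨i, rfl⟩
    exact (hl (Sum.inl i)).1
  · rw [← hS.span_eq, span_rInfty_span_poly,
      finrank_span_eq_card (linearIndependent_of_close hω fun j => (hl j).2),
      Fintype.card_sum, Fintype.card_fin, two_mul]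

theorem isCloseVec_closeVec (hω : IsQuadraticGenerator ω) (hy : IsNearestRoot y)
    (hA : ‖A‖ < (Nat.card F : ℝ)⁻¹) (j : Fin n ⊕ Fin n) :
    IsCloseVec ω y A j (closeVec ω y A j) :=
  Classical.epsilon_spec (exists_isCloseVec hω hy hA j)

theorem mem_domain13 (hω : IsQuadraticGenerator ω) (hy : IsNearestRoot y)
    (hA : ‖A‖ < (Nat.card F : ℝ)⁻¹) : A ∈ domain13 n ω y := by
  have hA1 := norm_le_one_of_lt_inv_card hA
  have hclose := isCloseVec_closeVec hω hy hA
  exact ⟨uniformizable_of_norm_le_one hA1, isLattice_of_isCloseVec hω hy hA hclose,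
    fun j => ⟨_, hclose j, fun _ hx => hx.eq hy hA1 (hclose j)⟩,
    isSiegelBasis_of_isCloseVec hω hy hA hclose⟩

end Domain
/-! ### The power series intertwining the actions of `T` -/

section Intertwiner

variable {F : Type*} [Field F] [Finite F] {n : ℕ} {A B Φ : Matrix (Fin n) (Fin n) (CInfty F)}

/-- The coefficients of the additive power series `f = ∑ f_i z^{(i)}` with `f_0 = Φ` that
intertwines the actions of `T` on the t-modules of `M(A)` and `M(B)`. -/
def twistCoeff (A B Φ : Matrix (Fin n) (Fin n) (CInfty F)) : ℕ → Matrix (Fin n) (Fin n) (CInfty F)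
  | 0 => Φ
  | 1 => (frob F 1 (theta F) - theta F)⁻¹ • (B * Φ.map (frob F 1) - Φ * A)
  | i + 2 => (frob F (i + 2) (theta F) - theta F)⁻¹ •
      (B * (twistCoeff A B Φ (i + 1)).map (frob F 1) -
        twistCoeff A B Φ (i + 1) * A.map (frob F (i + 1)) +
        (twistCoeff A B Φ i).map (frob F 2) - twistCoeff A B Φ i)

/-- The coefficient of `z^{(i+1)}` contributed by `f_i` to `f ∘ T_A - T_B ∘ f`. -/
def defectOne (A B Φ : Matrix (Fin n) (Fin n) (CInfty F)) (i : ℕ) :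
    Matrix (Fin n) (Fin n) (CInfty F) :=
  twistCoeff A B Φ i * A.map (frob F i) - B * (twistCoeff A B Φ i).map (frob F 1)

/-- The coefficient of `z^{(i+2)}` contributed by `f_i` to `f ∘ T_A - T_B ∘ f`. -/
def defectTwo (A B Φ : Matrix (Fin n) (Fin n) (CInfty F)) (i : ℕ) :
    Matrix (Fin n) (Fin n) (CInfty F) :=
  twistCoeff A B Φ i - (twistCoeff A B Φ i).map (frob F 2)

theorem map_frob_zero (X : Matrix (Fin n) (Fin n) (CInfty F)) : X.map (frob F 0) = X :=
  Matrix.ext fun i j => frob_zero_apply F (X i j)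

theorem smul_twistCoeff_one (A B Φ : Matrix (Fin n) (Fin n) (CInfty F)) :
    (frob F 1 (theta F) - theta F) • twistCoeff A B Φ 1 = -defectOne A B Φ 0 := by
  rw [twistCoeff, smul_inv_smul₀ (frob_theta_ne F one_ne_zero), defectOne, map_frob_zero, neg_sub]
  rfl

theorem smul_twistCoeff_add_two (A B Φ : Matrix (Fin n) (Fin n) (CInfty F)) (i : ℕ) :
    (frob F (i + 2) (theta F) - theta F) • twistCoeff A B Φ (i + 2) =
      -(defectOne A B Φ (i + 1) + defectTwo A B Φ i) := by
  rw [twistCoeff, smul_inv_smul₀ (frob_theta_ne F (Nat.succ_ne_zero _)), defectOne, defectTwo]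
  abel

theorem addTerm_tAct_sub (A B Φ : Matrix (Fin n) (Fin n) (CInfty F)) (x : Fin n → CInfty F)
    (i : ℕ) : addTerm (twistCoeff A B Φ) (tAct A x) i - tAct B (addTerm (twistCoeff A B Φ) x i) =
      ((frob F i (theta F) - theta F) • twistCoeff A B Φ i).mulVec (vecFrob i x) +
        (defectOne A B Φ i).mulVec (vecFrob (i + 1) x) +
        (defectTwo A B Φ i).mulVec (vecFrob (i + 2) x) := by
  have e1 : vecFrob i (tAct A x) = frob F i (theta F) • vecFrob i x +
      (A.map (frob F i)).mulVec (vecFrob (i + 1) x) + vecFrob (i + 2) x := by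
    rw [tAct_apply, vecFrob_add, vecFrob_add, vecFrob_smul, vecFrob_mulVec, vecFrob_vecFrob]
  have e2 : ∀ k, k + i = i + k := fun k => add_comm k i
  rw [addTerm, e1, tAct_apply, addTerm, vecFrob_mulVec, vecFrob_mulVec, e2, e2, defectOne,
    defectTwo, Matrix.mulVec_mulVec, Matrix.mulVec_add, Matrix.mulVec_add, Matrix.mulVec_mulVec,
    Matrix.mulVec_smul, Matrix.smul_mulVec, Matrix.sub_mulVec, Matrix.sub_mulVec, sub_smul]
  abel

theorem sum_addTerm_tAct_sub (A B Φ : Matrix (Fin n) (Fin n) (CInfty F)) (x : Fin n → CInfty F)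
    (N : ℕ) : ∑ i ∈ Finset.range (N + 2), addTerm (twistCoeff A B Φ) (tAct A x) i -
      tAct B (∑ i ∈ Finset.range (N + 2), addTerm (twistCoeff A B Φ) x i) =
      (defectOne A B Φ (N + 1) + defectTwo A B Φ N).mulVec (vecFrob (N + 2) x) +
        (defectTwo A B Φ (N + 1)).mulVec (vecFrob (N + 3) x) := by
  rw [map_sum, ← Finset.sum_sub_distrib]
  simp_rw [addTerm_tAct_sub]
  induction N with
  | zero =>
    rw [zero_add, Finset.sum_range_succ, Finset.sum_range_one, smul_twistCoeff_one,
      frob_zero_apply, sub_self, zero_smul, Matrix.zero_mulVec, Matrix.neg_mulVec,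
      Matrix.add_mulVec]
    simp only [zero_add]
    abel
  | succ N ih =>
    rw [show N + 1 + 2 = (N + 2) + 1 by ring, Finset.sum_range_succ, ih, smul_twistCoeff_add_two,
      Matrix.neg_mulVec, Matrix.add_mulVec, Matrix.add_mulVec]
    simp only [show N + 1 + 1 = N + 2 by ring, show N + 2 + 1 = N + 3 by ring,
      show N + 2 + 2 = N + 4 by ring]
    abel

theorem norm_mul_map_frob_le_of_norm_le_one {M N : Matrix (Fin n) (Fin n) (CInfty F)}
    (hN : ‖N‖ ≤ 1) (i : ℕ) : ‖M * N.map (frob F i)‖ ≤ ‖M‖ :=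
  (norm_matrix_mul_le _ _).trans (mul_le_of_le_one_right (norm_nonneg _)
    ((norm_map_frob_le i N).trans (pow_le_one₀ (norm_nonneg _) hN)))

theorem norm_twistCoeff_add_two_le (hA : ‖A‖ ≤ 1) (hB : ‖B‖ ≤ 1) {m : ℝ} (hm : 1 ≤ m) {i : ℕ}
    (h0 : ‖twistCoeff A B Φ i‖ ≤ m ^ (Nat.card F ^ i))
    (h1 : ‖twistCoeff A B Φ (i + 1)‖ ≤ m ^ (Nat.card F ^ (i + 1))) :
    ‖twistCoeff A B Φ (i + 2)‖ ≤ ((Nat.card F : ℝ)⁻¹ * m) ^ (Nat.card F ^ (i + 2)) := by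
  have hmono : ∀ k ≤ 2, m ^ (Nat.card F ^ (i + k)) ≤ m ^ (Nat.card F ^ (i + 2)) := fun k hk =>
    pow_le_pow_right₀ hm (Nat.pow_le_pow_right Nat.card_pos (by lia))
  have hmap : ∀ j k, ‖twistCoeff A B Φ j‖ ≤ m ^ (Nat.card F ^ j) →
      ‖(twistCoeff A B Φ j).map (frob F k)‖ ≤ m ^ (Nat.card F ^ (j + k)) := fun j k h => by
    rw [pow_add, pow_mul]
    exact (norm_map_frob_le _ _).trans (pow_le_pow_left₀ (norm_nonneg _) h _)
  rw [twistCoeff, norm_inv_frob_theta_sub_smul (Nat.succ_ne_zero _), mul_pow]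
  gcongr
  refine (norm_sub_le_max _ _).trans (max_le ((IsUltrametricDist.norm_add_le_max _ _).trans
    (max_le ((norm_sub_le_max _ _).trans (max_le ?_ ?_)) (hmap i 2 h0))) ?_)
  · exact (norm_matrix_mul_le _ _).trans
      ((mul_le_of_le_one_left (norm_nonneg _) hB).trans (hmap (i + 1) 1 h1))
  · exact (norm_mul_map_frob_le_of_norm_le_one hA _).trans (h1.trans (hmono 1 one_le_two))
  · exact h0.trans (hmono 0 zero_le_two)

theorem exists_norm_twistCoeff_le_pow (hA : ‖A‖ ≤ 1) (hB : ‖B‖ ≤ 1) :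
    ∃ M, 1 ≤ M ∧ ∀ i, ‖twistCoeff A B Φ i‖ ≤ M ^ (Nat.card F ^ i) := by
  refine ⟨max 1 (max ‖twistCoeff A B Φ 0‖ ‖twistCoeff A B Φ 1‖), le_max_left _ _, fun i => ?_⟩
  induction i using Nat.twoStepInduction with
  | zero => simp
  | one =>
    exact ((le_max_right _ _).trans (le_max_right _ _)).trans
      (le_self_pow₀ (le_max_left _ _) (pow_pos Nat.card_pos 1).ne')
  | more i h0 h1 =>
    refine (norm_twistCoeff_add_two_le hA hB (le_max_left _ _) h0 h1).trans ?_
    gcongr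
    exact mul_le_of_le_one_left (by positivity)
      (inv_le_one_of_one_le₀ (one_lt_card_real F).le)

theorem exists_norm_twistCoeff_le (hA : ‖A‖ ≤ 1) (hB : ‖B‖ ≤ 1) :
    ∃ N, ∀ i ≥ N, ‖twistCoeff A B Φ i‖ ≤ (Nat.card F : ℝ)⁻¹ ^ (Nat.card F ^ i) := by
  obtain ⟨M, hM1, hM⟩ := exists_norm_twistCoeff_le_pow (Φ := Φ) hA hB
  have step : ∀ m : ℝ, 1 ≤ m → ∀ N, (∀ i ≥ N, ‖twistCoeff A B Φ i‖ ≤ m ^ (Nat.card F ^ i)) →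
      ∀ i ≥ N + 2, ‖twistCoeff A B Φ i‖ ≤ ((Nat.card F : ℝ)⁻¹ * m) ^ (Nat.card F ^ i) := by
    intro m hm N h i hi
    obtain ⟨k, rfl⟩ := Nat.exists_eq_add_of_le' (le_of_add_le_right hi)
    exact norm_twistCoeff_add_two_le hA hB hm (h k (by lia)) (h (k + 1) (by lia))
  have iter : ∀ k, ∀ i ≥ 2 * k,
      ‖twistCoeff A B Φ i‖ ≤ (max 1 (M / (Nat.card F : ℝ) ^ k)) ^ (Nat.card F ^ i) := by
    intro k
    induction k with
    | zero => exact fun i _ => by simpa [max_eq_right hM1] using hM i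
    | succ k ih =>
      refine fun i hi => (step _ (le_max_left _ _) _ ih i hi).trans ?_
      rw [mul_max_of_nonneg _ _ (by positivity), mul_one, inv_mul_eq_div, inv_eq_one_div,
        div_div, ← pow_succ]
      gcongr
      exact (div_le_one (card_pos_real F)).mpr (one_lt_card_real F).le
  obtain ⟨k, hk⟩ := pow_unbounded_of_one_lt M (one_lt_card_real F)
  have hN := iter k
  rw [max_eq_left (div_le_one_of_le₀ hk.le (by positivity))] at hN
  exact ⟨2 * k + 2, fun i hi => by simpa using step 1 le_rfl _ hN i hi⟩

theorem exists_norm_twistCoeff_le_const (hA : ‖A‖ ≤ 1) (hB : ‖B‖ ≤ 1) :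
    ∃ K, ∀ i, ‖twistCoeff A B Φ i‖ ≤ K := by
  obtain ⟨N, hN⟩ := exists_norm_twistCoeff_le (Φ := Φ) hA hB
  refine ⟨max 1 (∑ i ∈ Finset.range N, ‖twistCoeff A B Φ i‖), fun i => ?_⟩
  rcases lt_or_ge i N with hi | hi
  · exact le_max_of_le_right (Finset.single_le_sum (f := fun i => ‖twistCoeff A B Φ i‖)
      (fun _ _ => norm_nonneg _) (Finset.mem_range.mpr hi))
  · exact le_max_of_le_left ((hN i hi).trans
      (pow_le_one₀ (by positivity) (inv_le_one_of_one_le₀ (one_lt_card_real F).le)))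

theorem summable_addTerm_twistCoeff (hA : ‖A‖ ≤ 1) (hB : ‖B‖ ≤ 1) {z : Fin n → CInfty F}
    (hz : ‖z‖ < Nat.card F) : Summable (addTerm (twistCoeff A B Φ) z) := by
  obtain ⟨N, hN⟩ := exists_norm_twistCoeff_le (Φ := Φ) hA hB
  exact summable_addTerm (by positivity) hN (by rwa [inv_mul_lt_iff₀ (card_pos_real F), mul_one])

theorem norm_tAct_le (hB : ‖B‖ ≤ 1) {w : Fin n → CInfty F} (hw : ‖w‖ ≤ 1) :
    ‖tAct B w‖ ≤ Nat.card F * ‖w‖ := by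
  have hpow : ∀ k, ‖w‖ ^ (Nat.card F ^ k) ≤ Nat.card F * ‖w‖ := fun k =>
    (pow_le_of_le_one (norm_nonneg w) hw (pow_pos Nat.card_pos k).ne').trans
      (le_mul_of_one_le_left (norm_nonneg w) (one_lt_card_real F).le)
  rw [tAct_apply]
  refine (IsUltrametricDist.norm_add_le_max _ _).trans (max_le
    ((IsUltrametricDist.norm_add_le_max _ _).trans (max_le ?_ ?_)) ?_)
  · rw [norm_smul, norm_theta]
  · refine (norm_mulVec_le _ _).trans ((mul_le_of_le_one_left (norm_nonneg _) hB).trans ?_)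
    exact (norm_vecFrob 1 w).trans_le (hpow 1)
  · exact (norm_vecFrob 2 w).trans_le (hpow 2)

theorem norm_iterate_tAct_le (hB : ‖B‖ ≤ 1) {k : ℕ} {w : Fin n → CInfty F}
    (hw : (Nat.card F : ℝ) ^ k * ‖w‖ ≤ 1) :
    ‖(tAct B)^[k] w‖ ≤ (Nat.card F : ℝ) ^ k * ‖w‖ := by
  induction k with
  | zero => simp
  | succ k ih =>
    have hk : (Nat.card F : ℝ) ^ k * ‖w‖ ≤ 1 := by
      refine le_trans ?_ hw
      gcongr
      · exact (one_lt_card_real F).le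
      · exact k.le_succ
    rw [Function.iterate_succ_apply', pow_succ', mul_assoc]
    exact (norm_tAct_le hB ((ih hk).trans hk)).trans (by gcongr; exact ih hk)

theorem norm_defectOne_le (hA : ‖A‖ ≤ 1) (hB : ‖B‖ ≤ 1) {i : ℕ} (h : ‖twistCoeff A B Φ i‖ ≤ 1) :
    ‖defectOne A B Φ i‖ ≤ ‖twistCoeff A B Φ i‖ := by
  refine (norm_sub_le_max _ _).trans (max_le (norm_mul_map_frob_le_of_norm_le_one hA i) ?_)
  refine (norm_matrix_mul_le _ _).trans ((mul_le_of_le_one_left (norm_nonneg _) hB).trans ?_)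
  exact (norm_map_frob_le _ _).trans
    (pow_le_of_le_one (norm_nonneg _) h (pow_pos Nat.card_pos _).ne')

theorem norm_defectTwo_le {i : ℕ} (h : ‖twistCoeff A B Φ i‖ ≤ 1) :
    ‖defectTwo A B Φ i‖ ≤ ‖twistCoeff A B Φ i‖ := by
  refine (norm_sub_le_max _ _).trans (max_le le_rfl ?_)
  exact (norm_map_frob_le _ _).trans
    (pow_le_of_le_one (norm_nonneg _) h (pow_pos Nat.card_pos _).ne')

theorem norm_defect_remainder_le (hA : ‖A‖ ≤ 1) (hB : ‖B‖ ≤ 1) {x : Fin n → CInfty F}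
    (hx : ‖x‖ ≤ 1) {N : ℕ} {b : ℝ} (hb : b ≤ 1) (h : ∀ i ≥ N, ‖twistCoeff A B Φ i‖ ≤ b) :
    ‖(defectOne A B Φ (N + 1) + defectTwo A B Φ N).mulVec (vecFrob (N + 2) x) +
      (defectTwo A B Φ (N + 1)).mulVec (vecFrob (N + 3) x)‖ ≤ b := by
  have h0 := h N le_rfl
  have h1 := h (N + 1) N.le_succ
  have hv : ∀ (M : Matrix (Fin n) (Fin n) (CInfty F)) (k : ℕ),
      ‖M.mulVec (vecFrob k x)‖ ≤ ‖M‖ := fun M k => by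
    refine (norm_mulVec_le _ _).trans (mul_le_of_le_one_right (norm_nonneg _) ?_)
    exact (norm_vecFrob k x).trans_le (pow_le_one₀ (norm_nonneg _) hx)
  refine (IsUltrametricDist.norm_add_le_max _ _).trans (max_le ((hv _ _).trans
    ((IsUltrametricDist.norm_add_le_max _ _).trans (max_le ?_ ?_))) ((hv _ _).trans ?_))
  · exact (norm_defectOne_le hA hB (h1.trans hb)).trans h1
  · exact (norm_defectTwo_le (h0.trans hb)).trans h0
  · exact (norm_defectTwo_le (h1.trans hb)).trans h1

theorem tendsto_defect_remainder (hA : ‖A‖ ≤ 1) (hB : ‖B‖ ≤ 1) {x : Fin n → CInfty F}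
    (hx : ‖x‖ ≤ 1) :
    Filter.Tendsto (fun N =>
      (defectOne A B Φ (N + 1) + defectTwo A B Φ N).mulVec (vecFrob (N + 2) x) +
        (defectTwo A B Φ (N + 1)).mulVec (vecFrob (N + 3) x)) Filter.atTop (𝓝 0) := by
  have hq : (Nat.card F : ℝ)⁻¹ < 1 := inv_lt_one_of_one_lt₀ (one_lt_card_real F)
  obtain ⟨N₀, hN₀⟩ := exists_norm_twistCoeff_le (Φ := Φ) hA hB
  refine squeeze_zero_norm' (a := fun N => (Nat.card F : ℝ)⁻¹ ^ (Nat.card F ^ N)) ?_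
    ((tendsto_pow_atTop_nhds_zero_of_lt_one (by positivity) hq).comp
      (tendsto_pow_atTop_atTop_of_one_lt Finite.one_lt_card))
  filter_upwards [Filter.eventually_ge_atTop N₀] with N hN
  refine norm_defect_remainder_le hA hB hx (pow_le_one₀ (by positivity) hq.le) fun i hi => ?_
  exact (hN₀ i (hN.trans hi)).trans (pow_le_pow_of_le_one (by positivity) hq.le
    (Nat.pow_le_pow_right Nat.card_pos hi))

theorem addSum_twistCoeff_tAct (hA : ‖A‖ ≤ 1) (hB : ‖B‖ ≤ 1) {x : Fin n → CInfty F}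
    (hx : ‖x‖ ≤ 1) (hTx : ‖tAct A x‖ < Nat.card F) :
    addSum (twistCoeff A B Φ) (tAct A x) = tAct B (addSum (twistCoeff A B Φ) x) := by
  have htAct := ((summable_addTerm_twistCoeff (Φ := Φ) hA hB hTx).hasSum.tendsto_sum_nat).comp
    (Filter.tendsto_add_atTop_nat 2)
  have hsum := (((continuous_tAct B).tendsto _).comp
    ((summable_addTerm_twistCoeff (Φ := Φ) hA hB
      (hx.trans_lt (one_lt_card_real F))).hasSum.tendsto_sum_nat)).comp
    (Filter.tendsto_add_atTop_nat 2)
  refine sub_eq_zero.mp (tendsto_nhds_unique (htAct.sub hsum)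
    ((tendsto_defect_remainder (Φ := Φ) hA hB hx).congr fun N => ?_))
  exact (sum_addTerm_tAct_sub A B Φ x N).symm

theorem norm_addSum_sub_le {f : ℕ → Matrix (Fin n) (Fin n) (CInfty F)} {x : Fin n → CInfty F}
    (hs : Summable (addTerm f x)) {K : ℝ} (hK : ∀ i, ‖f i‖ ≤ K) (hx : ‖x‖ ≤ 1) :
    ‖addSum f x - (f 0).mulVec x‖ ≤ K * ‖x‖ ^ Nat.card F := by
  have hK0 : 0 ≤ K := (norm_nonneg _).trans (hK 0)
  have h0 : addTerm f x 0 = (f 0).mulVec x := by rw [addTerm, vecFrob_zero_left]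
  rw [addSum, hs.tsum_eq_zero_add, h0, add_sub_cancel_left]
  refine IsUltrametricDist.norm_tsum_le_of_forall_le_of_nonneg (by positivity) fun i => ?_
  refine (norm_addTerm_le _ _ _).trans (mul_le_mul (hK _) ?_ (by positivity) hK0)
  exact pow_le_pow_of_le_one (norm_nonneg x) hx (Nat.le_self_pow (Nat.succ_ne_zero i) _)

theorem exists_norm_addSum_twistCoeff_mExp_sub_le (hA : ‖A‖ ≤ 1) (hB : ‖B‖ ≤ 1) :
    ∃ r K : ℝ, 0 < r ∧ ∀ z, ‖z‖ ≤ r →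
      ‖addSum (twistCoeff A B Φ) (mExp A z) - mExp B (Φ.mulVec z)‖ ≤ K * ‖z‖ ^ Nat.card F := by
  obtain ⟨K, hK⟩ := exists_norm_twistCoeff_le_const (Φ := Φ) hA hB
  have hΦ : twistCoeff A B Φ 0 = Φ := by rw [twistCoeff]
  have hΦK : ‖Φ‖ ≤ K := hΦ ▸ hK 0
  refine ⟨(max 1 ‖Φ‖)⁻¹, max K (‖Φ‖ ^ Nat.card F), by positivity, fun z hz => ?_⟩
  have hz1 : ‖z‖ ≤ 1 := hz.trans (inv_le_one_of_one_le₀ (le_max_left _ _))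
  have hΦz : ‖Φ.mulVec z‖ ≤ ‖Φ‖ * ‖z‖ := norm_mulVec_le _ _
  have hΦz1 : ‖Φ.mulVec z‖ ≤ 1 := hΦz.trans <|
    (mul_le_mul (le_max_right _ _) hz (norm_nonneg _) (by positivity)).trans
      (mul_inv_cancel₀ (by positivity)).le
  have hx : ‖mExp A z‖ = ‖z‖ := norm_mExp hA
    (hz1.trans_lt ((one_lt_torsionRadius F).trans torsionRadius_lt_card_mul))
  have e : addSum (twistCoeff A B Φ) (mExp A z) - mExp B (Φ.mulVec z) =
      (addSum (twistCoeff A B Φ) (mExp A z) - Φ.mulVec (mExp A z)) + Φ.mulVec (mExp A z - z) -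
        (mExp B (Φ.mulVec z) - Φ.mulVec z) := by
    rw [Matrix.mulVec_sub]
    abel
  rw [e]
  refine (norm_sub_le_max _ _).trans (max_le
    ((IsUltrametricDist.norm_add_le_max _ _).trans (max_le ?_ ?_)) ?_)
  · have h := norm_addSum_sub_le (summable_addTerm_twistCoeff hA hB
      (by rw [hx]; exact hz1.trans_lt (one_lt_card_real F))) hK (hx.trans_le hz1)
    rw [hΦ, hx] at h
    exact h.trans (mul_le_mul_of_nonneg_right (le_max_left _ _) (by positivity))
  · exact (norm_mulVec_le _ _).trans (mul_le_mul (hΦK.trans (le_max_left _ _))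
      (norm_mExp_sub_le_pow hA hz1) (norm_nonneg _) (le_max_of_le_right (by positivity)))
  · refine (norm_mExp_sub_le_pow hB hΦz1).trans
      ((pow_le_pow_left₀ (norm_nonneg _) hΦz _).trans ?_)
    rw [mul_pow]
    exact mul_le_mul_of_nonneg_right (le_max_right _ _) (by positivity)

theorem addSum_twistCoeff_mExp_sub_eq_tAct (hA : ‖A‖ ≤ 1) (hB : ‖B‖ ≤ 1)
    {z : Fin n → CInfty F} (hz : ‖z‖ ≤ torsionRadius F) :
    addSum (twistCoeff A B Φ) (mExp A z) - mExp B (Φ.mulVec z) =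
      tAct B (addSum (twistCoeff A B Φ) (mExp A ((theta F)⁻¹ • z)) -
        mExp B (Φ.mulVec ((theta F)⁻¹ • z))) := by
  have hz1 : ‖(theta F)⁻¹ • z‖ ≤ 1 := by
    rw [norm_theta_inv_smul, div_le_one (card_pos_real F)]
    exact hz.trans (torsionRadius_lt_card F).le
  have hx : ‖mExp A ((theta F)⁻¹ • z)‖ ≤ 1 := by
    rwa [norm_mExp hA
      (hz1.trans_lt ((one_lt_torsionRadius F).trans torsionRadius_lt_card_mul))]
  have hTx : ‖tAct A (mExp A ((theta F)⁻¹ • z))‖ < Nat.card F := by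
    rw [tAct_mExp_theta_inv_smul hA, norm_mExp hA (hz.trans_lt torsionRadius_lt_card_mul)]
    exact hz.trans_lt (torsionRadius_lt_card F)
  rw [map_sub, ← addSum_twistCoeff_tAct hA hB hx hTx, tAct_mExp_theta_inv_smul hA,
    Matrix.mulVec_smul, tAct_mExp_theta_inv_smul hB]

theorem norm_theta_inv_pow_smul (k : ℕ) (z : Fin n → CInfty F) :
    ‖(theta F)⁻¹ ^ k • z‖ = (Nat.card F : ℝ)⁻¹ ^ k * ‖z‖ := by
  rw [norm_smul, norm_pow, norm_inv, norm_theta]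

theorem eq_iterate_tAct_theta_inv_pow_smul {h : (Fin n → CInfty F) → Fin n → CInfty F} {ρ : ℝ}
    (hT : ∀ z, ‖z‖ ≤ ρ → h z = tAct B (h ((theta F)⁻¹ • z)))
    {z : Fin n → CInfty F} (hz : ‖z‖ ≤ ρ) (k : ℕ) :
    h z = (tAct B)^[k] (h ((theta F)⁻¹ ^ k • z)) := by
  induction k with
  | zero => rw [pow_zero, one_smul, Function.iterate_zero_apply]
  | succ k ih =>
    rw [ih, Function.iterate_succ_apply, pow_succ', mul_smul, ← hT]
    rw [norm_theta_inv_pow_smul]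
    exact (mul_le_of_le_one_left (norm_nonneg z) (pow_le_one₀ (by positivity)
      (inv_le_one_of_one_le₀ (one_lt_card_real F).le))).trans hz

theorem eq_zero_of_forall_eq_tAct_theta_inv_smul (hB : ‖B‖ ≤ 1)
    {h : (Fin n → CInfty F) → Fin n → CInfty F} {r K ρ : ℝ} (hr : 0 < r)
    (hK : ∀ z, ‖z‖ ≤ r → ‖h z‖ ≤ K * ‖z‖ ^ Nat.card F)
    (hT : ∀ z, ‖z‖ ≤ ρ → h z = tAct B (h ((theta F)⁻¹ • z)))
    {z : Fin n → CInfty F} (hz : ‖z‖ ≤ ρ) : h z = 0 := by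
  have hq1 := one_lt_card_real F
  have hlim := tendsto_pow_atTop_nhds_zero_of_lt_one (r := (Nat.card F : ℝ)⁻¹) (by positivity)
    (inv_lt_one_of_one_lt₀ hq1)
  have hlimK : Filter.Tendsto (fun k : ℕ => (Nat.card F : ℝ)⁻¹ ^ k * (|K| * ‖z‖ ^ Nat.card F))
      Filter.atTop (𝓝 0) := by simpa using hlim.mul_const (|K| * ‖z‖ ^ Nat.card F)
  have hlimz : Filter.Tendsto (fun k : ℕ => (Nat.card F : ℝ)⁻¹ ^ k * ‖z‖)
      Filter.atTop (𝓝 0) := by simpa using hlim.mul_const ‖z‖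
  rw [← norm_le_zero_iff]
  refine ge_of_tendsto hlimK ?_
  filter_upwards [hlimK.eventually_le_const one_pos, hlimz.eventually_le_const hr] with k hk1 hkr
  have hb : (Nat.card F : ℝ) ^ k * ‖h ((theta F)⁻¹ ^ k • z)‖ ≤
      (Nat.card F : ℝ)⁻¹ ^ k * (|K| * ‖z‖ ^ Nat.card F) := by
    have h2 : ((Nat.card F : ℝ)⁻¹ ^ k) ^ Nat.card F ≤ ((Nat.card F : ℝ)⁻¹ ^ k) ^ 2 :=
      pow_le_pow_of_le_one (by positivity)
        (pow_le_one₀ (by positivity) (inv_le_one_of_one_le₀ hq1.le)) Finite.one_lt_card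
    calc (Nat.card F : ℝ) ^ k * ‖h ((theta F)⁻¹ ^ k • z)‖
        ≤ (Nat.card F : ℝ) ^ k * (|K| * (((Nat.card F : ℝ)⁻¹ ^ k) ^ 2 * ‖z‖ ^ Nat.card F)) := by
          gcongr
          refine (hK _ ((norm_theta_inv_pow_smul k z).trans_le hkr)).trans ?_
          rw [norm_theta_inv_pow_smul, mul_pow]
          gcongr
          exact le_abs_self K
      _ = (Nat.card F : ℝ)⁻¹ ^ k * (|K| * ‖z‖ ^ Nat.card F) := by
          have := card_pos_real F
          rw [inv_pow]
          field_simp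
  rw [eq_iterate_tAct_theta_inv_pow_smul hT hz k]
  exact (norm_iterate_tAct_le hB (hb.trans hk1)).trans hb

theorem addSum_twistCoeff_mExp (hA : ‖A‖ ≤ 1) (hB : ‖B‖ ≤ 1) {z : Fin n → CInfty F}
    (hz : ‖z‖ ≤ torsionRadius F) :
    addSum (twistCoeff A B Φ) (mExp A z) = mExp B (Φ.mulVec z) := by
  obtain ⟨r, K, hr, hK⟩ := exists_norm_addSum_twistCoeff_mExp_sub_le (Φ := Φ) hA hB
  exact sub_eq_zero.mp (eq_zero_of_forall_eq_tAct_theta_inv_smul hB hr hK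
    (fun _ => addSum_twistCoeff_mExp_sub_eq_tAct hA hB) hz)

end Intertwiner

section Vanishing

variable {F : Type*} [Field F] [Finite F] {n : ℕ} {ω : CInfty F}

theorem norm_matrix_lt_of_smul_col_lt {P : Matrix (Fin n) (Fin n) (CInfty F)} {c : CInfty F}
    {W : ℝ} (hW : 0 < W) (h : ∀ i, ‖c • P.mulVec (Pi.single i 1)‖ < W) : ‖P‖ * ‖c‖ < W := by
  rw [mul_comm, ← norm_smul]
  refine (Matrix.norm_lt_iff hW).mpr fun a i => lt_of_le_of_lt ?_ (h i)
  have := norm_le_pi_norm (c • P.mulVec (Pi.single i 1)) a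
  rwa [Matrix.mulVec_single_one] at this ⊢

theorem vecFrob_single (k : ℕ) (i : Fin n) (c : CInfty F) :
    vecFrob k (Pi.single i c : Fin n → CInfty F) = frob F k c • Pi.single i 1 := by
  funext j
  by_cases h : j = i
  · subst h
    simp [vecFrob]
  · simp [vecFrob, h]

theorem norm_lt_of_norm_sub_lt_of_norm_smul_sub_lt {𝕜 E : Type*} [NormedField 𝕜]
    [SeminormedAddCommGroup E] [NormedSpace 𝕜 E] [IsUltrametricDist E] {a b : 𝕜} (hb : ‖b‖ ≤ 1)
    (hab : ‖a - b‖ = 1) {p r : E} {W : ℝ} (h : ‖p - r‖ < W) (h' : ‖a • p - b • r‖ < W) :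
    ‖p‖ < W ∧ ‖r‖ < W := by
  have hp : ‖p‖ < W := by
    rw [← one_mul ‖p‖, ← hab, ← norm_smul,
      show (a - b) • p = (a • p - b • r) - b • (p - r) by rw [sub_smul, smul_sub]; abel]
    refine (norm_sub_le_max _ _).trans_lt (max_lt h' ?_)
    rw [norm_smul]
    exact (mul_le_of_le_one_left (norm_nonneg _) hb).trans_lt h
  refine ⟨hp, ?_⟩
  rw [← sub_sub_cancel p r]
  exact (norm_sub_le_max _ _).trans_lt (max_lt hp h)

theorem norm_mul_pow_lt_of_baseVec (hω : IsQuadraticGenerator ω) {μ : CInfty F}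
    {P Q : Matrix (Fin n) (Fin n) (CInfty F)} {k : ℕ} {W : ℝ} (hW : 0 < W)
    (h : ∀ j, ‖P.mulVec (vecFrob (k + 1) (baseVec n ω μ j)) -
      Q.mulVec (vecFrob k (baseVec n ω μ j))‖ < W) :
    ‖P‖ * ‖μ‖ ^ (Nat.card F ^ (k + 1)) < W ∧ ‖Q‖ * ‖μ‖ ^ (Nat.card F ^ k) < W := by
  have hωk : ‖frob F k ω‖ ≤ 1 := by rw [norm_frob, hω.norm_eq_one, one_pow]
  have hωd : ‖frob F (k + 1) ω - frob F k ω‖ = 1 := by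
    rw [frob_add_apply, ← map_sub, norm_frob, hω.norm_frob_sub, one_pow]
  have hcol : ∀ i, ‖frob F (k + 1) μ • P.mulVec (Pi.single i 1)‖ < W ∧
      ‖frob F k μ • Q.mulVec (Pi.single i 1)‖ < W := fun i => by
    have hl := h (Sum.inl i)
    have hr := h (Sum.inr i)
    simp only [baseVec, Sum.elim_inl, Sum.elim_inr, vecFrob_single, Matrix.mulVec_smul, map_mul,
      mul_smul] at hl hr
    exact norm_lt_of_norm_sub_lt_of_norm_smul_sub_lt hωk hωd hl hr
  rw [← norm_frob, ← norm_frob]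
  exact ⟨norm_matrix_lt_of_smul_col_lt hW fun i => (hcol i).1,
    norm_matrix_lt_of_smul_col_lt hW fun i => (hcol i).2⟩

theorem norm_mulVec_vecFrob_lt {M : Matrix (Fin n) (Fin n) (CInfty F)} {m : ℕ}
    {d : Fin n → CInfty F} {ρ W : ℝ} (hW : 0 < W) (hM : ‖M‖ * ρ ^ (Nat.card F ^ m) ≤ W)
    (hd : ‖d‖ < ρ) : ‖M.mulVec (vecFrob m d)‖ < W := by
  rcases eq_or_ne M 0 with rfl | hM0
  · rwa [Matrix.zero_mulVec, norm_zero]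
  · refine (norm_mulVec_le _ _).trans_lt (lt_of_lt_of_le ?_ hM)
    rw [norm_vecFrob]
    refine mul_lt_mul_of_pos_left ?_ (norm_pos_iff.mpr hM0)
    exact pow_lt_pow_left₀ hd (norm_nonneg _) (pow_pos Nat.card_pos m).ne'

theorem norm_mul_pow_le_of_close (hω : IsQuadraticGenerator ω) {μ : CInfty F}
    {t : Fin n ⊕ Fin n → Fin n → CInfty F} (ht : ∀ j, ‖t j - baseVec n ω μ j‖ < ‖μ‖)
    {P Q : Matrix (Fin n) (Fin n) (CInfty F)} {k : ℕ} {ε : ℝ} (hε : 0 ≤ ε)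
    (h : ∀ j, ‖P.mulVec (vecFrob (k + 1) (t j)) - Q.mulVec (vecFrob k (t j))‖ ≤ ε) :
    ‖P‖ * ‖μ‖ ^ (Nat.card F ^ (k + 1)) ≤ ε := by
  by_contra! hlt
  obtain ⟨W, hW⟩ : ∃ W, W = max (‖P‖ * ‖μ‖ ^ (Nat.card F ^ (k + 1)))
    (‖Q‖ * ‖μ‖ ^ (Nat.card F ^ k)) := ⟨_, rfl⟩
  have hPW : ‖P‖ * ‖μ‖ ^ (Nat.card F ^ (k + 1)) ≤ W := hW ▸ le_max_left _ _
  have hQW : ‖Q‖ * ‖μ‖ ^ (Nat.card F ^ k) ≤ W := hW ▸ le_max_right _ _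
  have hεW : ε < W := hlt.trans_le hPW
  have hW0 : 0 < W := hε.trans_lt hεW
  have hbase : ∀ j, ‖P.mulVec (vecFrob (k + 1) (baseVec n ω μ j)) -
      Q.mulVec (vecFrob k (baseVec n ω μ j))‖ < W := by
    intro j
    have e : P.mulVec (vecFrob (k + 1) (baseVec n ω μ j)) -
        Q.mulVec (vecFrob k (baseVec n ω μ j)) =
        (P.mulVec (vecFrob (k + 1) (t j)) - Q.mulVec (vecFrob k (t j))) -
          P.mulVec (vecFrob (k + 1) (t j - baseVec n ω μ j)) +
        Q.mulVec (vecFrob k (t j - baseVec n ω μ j)) := by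
      rw [vecFrob_sub, vecFrob_sub, Matrix.mulVec_sub, Matrix.mulVec_sub]
      abel
    rw [e]
    exact (IsUltrametricDist.norm_add_le_max _ _).trans_lt (max_lt
      ((norm_sub_le_max _ _).trans_lt (max_lt ((h j).trans_lt hεW)
        (norm_mulVec_vecFrob_lt hW0 hPW (ht j)))) (norm_mulVec_vecFrob_lt hW0 hQW (ht j)))
  have hlt := norm_mul_pow_lt_of_baseVec hω hW0 hbase
  exact (max_lt hlt.1 hlt.2).ne hW.symm

variable {A B Φ : Matrix (Fin n) (Fin n) (CInfty F)} {κ : ℝ} {N : ℕ} {x : Fin n → CInfty F}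

theorem norm_tAct_sum_range_addTerm_le (hB : ‖B‖ ≤ 1)
    {f : ℕ → Matrix (Fin n) (Fin n) (CInfty F)} (hκ : 0 ≤ κ)
    (hf : ∀ i ≥ N, ‖f i‖ ≤ κ ^ (Nat.card F ^ i)) (hx : κ * ‖x‖ < 1)
    (h : tAct B (addSum f x) = 0) :
    ‖tAct B (∑ i ∈ Finset.range N, addTerm f x i)‖ ≤
      Nat.card F * (κ * ‖x‖) ^ (Nat.card F ^ N) := by
  have htail : ‖∑' i, addTerm f x (i + N)‖ ≤ (κ * ‖x‖) ^ (Nat.card F ^ N) :=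
    IsUltrametricDist.norm_tsum_le_of_forall_le_of_nonneg (by positivity) fun i =>
      (norm_addTerm_le_pow (hf (i + N) (N.le_add_left i))).trans
        (pow_le_pow_of_le_one (by positivity) hx.le
          (Nat.pow_le_pow_right Nat.card_pos (N.le_add_left i)))
  rw [addSum, ← (summable_addTerm hκ hf hx).sum_add_tsum_nat_add N, map_add] at h
  rw [eq_neg_of_add_eq_zero_left h, norm_neg]
  exact (norm_tAct_le hB (htail.trans (pow_le_one₀ (by positivity) hx.le))).trans (by gcongr)

theorem twistCoeff_mulVec_sub_of_tAct_eq_zero (hx : tAct A x = 0) (N : ℕ) :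
    (twistCoeff A B Φ N).mulVec (vecFrob (N + 2) x) -
        (frob F (N + 1) (theta F) • twistCoeff A B Φ (N + 1)).mulVec (vecFrob (N + 1) x) =
      B.mulVec (((twistCoeff A B Φ (N + 1)).map (frob F 1)).mulVec (vecFrob (N + 2) x)) +
        ((twistCoeff A B Φ N).map (frob F 2)).mulVec (vecFrob (N + 2) x) +
        ((twistCoeff A B Φ (N + 1)).map (frob F 2)).mulVec (vecFrob (N + 3) x) -
        tAct B (∑ i ∈ Finset.range (N + 2), addTerm (twistCoeff A B Φ) x i) := by
  have hsum := sum_addTerm_tAct_sub A B Φ x N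
  simp_rw [hx, addTerm, vecFrob_zero_right, Matrix.mulVec_zero] at hsum
  rw [Finset.sum_const_zero, zero_sub] at hsum
  have hfrob : vecFrob (N + 3) x = -(frob F (N + 1) (theta F) • vecFrob (N + 1) x +
      (A.map (frob F (N + 1))).mulVec (vecFrob (N + 2) x)) := by
    have := congrArg (vecFrob (N + 1)) hx
    rw [tAct_apply, vecFrob_add, vecFrob_add, vecFrob_smul, vecFrob_mulVec, vecFrob_vecFrob,
      vecFrob_zero_right] at this
    exact (neg_eq_of_add_eq_zero_right this).symm
  have hlast : (twistCoeff A B Φ (N + 1)).mulVec (vecFrob (N + 3) x) =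
      -((frob F (N + 1) (theta F) • twistCoeff A B Φ (N + 1)).mulVec (vecFrob (N + 1) x) +
        (twistCoeff A B Φ (N + 1) * A.map (frob F (N + 1))).mulVec (vecFrob (N + 2) x)) := by
    rw [hfrob, Matrix.mulVec_neg, Matrix.mulVec_add, Matrix.mulVec_mulVec, Matrix.mulVec_smul,
      Matrix.smul_mulVec]
  simp only [addTerm]
  rw [sub_eq_add_neg _ (tAct B _), hsum, defectOne, defectTwo, defectTwo, Matrix.add_mulVec,
    Matrix.sub_mulVec, Matrix.sub_mulVec, Matrix.sub_mulVec, hlast, Matrix.mulVec_mulVec]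
  abel

theorem norm_map_frob_mulVec_vecFrob_le {M : Matrix (Fin n) (Fin n) (CInfty F)} {i : ℕ}
    (hM : ‖M‖ ≤ κ ^ (Nat.card F ^ i)) (k : ℕ) :
    ‖(M.map (frob F k)).mulVec (vecFrob (i + k) x)‖ ≤ (κ * ‖x‖) ^ (Nat.card F ^ (i + k)) := by
  rw [mul_pow, ← norm_vecFrob]
  refine (norm_mulVec_le _ _).trans (mul_le_mul_of_nonneg_right ?_ (norm_nonneg _))
  rw [pow_add, pow_mul]
  exact (norm_map_frob_le _ _).trans (pow_le_pow_left₀ (norm_nonneg _) hM _)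

theorem norm_twistCoeff_mulVec_sub_le (hB : ‖B‖ ≤ 1) (hκ : 0 ≤ κ)
    (hf : ∀ i ≥ N, ‖twistCoeff A B Φ i‖ ≤ κ ^ (Nat.card F ^ i)) (hx : κ * ‖x‖ < 1)
    (hxA : tAct A x = 0) (hxB : tAct B (addSum (twistCoeff A B Φ) x) = 0) :
    ‖(twistCoeff A B Φ N).mulVec (vecFrob (N + 2) x) -
        (frob F (N + 1) (theta F) • twistCoeff A B Φ (N + 1)).mulVec (vecFrob (N + 1) x)‖ ≤
      Nat.card F * (κ * ‖x‖) ^ (Nat.card F ^ (N + 2)) := by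
  have hle : ∀ m ≥ N + 2,
      (κ * ‖x‖) ^ (Nat.card F ^ m) ≤ Nat.card F * (κ * ‖x‖) ^ (Nat.card F ^ (N + 2)) :=
    fun m hm => (pow_le_pow_of_le_one (by positivity) hx.le
      (Nat.pow_le_pow_right Nat.card_pos hm)).trans
        (le_mul_of_one_le_left (by positivity) (one_lt_card_real F).le)
  have hN := hf N le_rfl
  have hN1 := hf (N + 1) N.le_succ
  rw [twistCoeff_mulVec_sub_of_tAct_eq_zero hxA]
  refine (norm_sub_le_max _ _).trans (max_le ((IsUltrametricDist.norm_add_le_max _ _).trans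
    (max_le ((IsUltrametricDist.norm_add_le_max _ _).trans (max_le ?_ ?_)) ?_)) ?_)
  · exact (norm_mulVec_le _ _).trans ((mul_le_of_le_one_left (norm_nonneg _) hB).trans
      ((norm_map_frob_mulVec_vecFrob_le hN1 1).trans (hle _ le_rfl)))
  · exact (norm_map_frob_mulVec_vecFrob_le hN 2).trans (hle _ le_rfl)
  · exact (norm_map_frob_mulVec_vecFrob_le hN1 2).trans (hle _ (N + 2).le_succ)
  · exact norm_tAct_sum_range_addTerm_le hB hκ (fun i hi => hf i (le_of_add_le_left hi)) hx hxB

theorem card_mul_pow_le_sq_pow (hκ0 : 0 ≤ κ) (hκ : κ ≤ (Nat.card F : ℝ)⁻¹) (N : ℕ) :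
    Nat.card F * κ ^ (Nat.card F ^ (N + 2)) ≤ (κ ^ 2) ^ (Nat.card F ^ N) := by
  have hκ1 : κ ≤ 1 := hκ.trans (inv_le_one_of_one_le₀ (one_lt_card_real F).le)
  have hexp : 2 * Nat.card F ^ N + 1 ≤ Nat.card F ^ (N + 2) := by
    have h2 : 2 ^ 2 ≤ Nat.card F ^ 2 := Nat.pow_le_pow_left Finite.one_lt_card 2
    have h3 : 0 < Nat.card F ^ N := pow_pos Nat.card_pos N
    rw [pow_add]
    nlinarith
  calc Nat.card F * κ ^ (Nat.card F ^ (N + 2))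
      ≤ Nat.card F * κ ^ (2 * Nat.card F ^ N + 1) := by
        gcongr Nat.card F * ?_
        exact pow_le_pow_of_le_one hκ0 hκ1 hexp
    _ = (Nat.card F * κ) * (κ ^ 2) ^ (Nat.card F ^ N) := by
        rw [pow_succ, pow_mul]
        ring
    _ ≤ (κ ^ 2) ^ (Nat.card F ^ N) := mul_le_of_le_one_left (by positivity)
        ((le_inv_mul_iff₀ (card_pos_real F)).mp (by rwa [mul_one]))

theorem norm_twistCoeff_le_sq (hω : IsQuadraticGenerator ω) {μ : CInfty F}
    (hμ : ‖μ‖ = torsionRadius F) (hB : ‖B‖ ≤ 1) {t : Fin n ⊕ Fin n → Fin n → CInfty F}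
    (ht : ∀ j, ‖t j - baseVec n ω μ j‖ < ‖μ‖) (htA : ∀ j, tAct A (t j) = 0)
    (htB : ∀ j, tAct B (addSum (twistCoeff A B Φ) (t j)) = 0) (hκ0 : 0 ≤ κ)
    (hκ : κ ≤ (Nat.card F : ℝ)⁻¹) (hf : ∀ i ≥ N, ‖twistCoeff A B Φ i‖ ≤ κ ^ (Nat.card F ^ i)) :
    ∀ i ≥ N, ‖twistCoeff A B Φ i‖ ≤ (κ ^ 2) ^ (Nat.card F ^ i) := by
  intro i hi
  have hμ0 : 0 < ‖μ‖ := hμ ▸ torsionRadius_pos F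
  have hκμ : κ * ‖μ‖ < 1 := by
    refine (mul_le_mul_of_nonneg_right hκ hμ0.le).trans_lt ?_
    rw [inv_mul_lt_iff₀ (card_pos_real F), mul_one, hμ]
    exact torsionRadius_lt_card F
  have htn : ∀ j, κ * ‖t j‖ ≤ κ * ‖μ‖ := fun j => by
    gcongr
    rw [← sub_add_cancel (t j) (baseVec n ω μ j)]
    exact (IsUltrametricDist.norm_add_le_max _ _).trans
      (max_le (ht j).le (norm_baseVec hω.norm_eq_one μ j).le)
  have hle : ‖twistCoeff A B Φ i‖ * ‖μ‖ ^ (Nat.card F ^ (i + 2)) ≤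
      Nat.card F * (κ * ‖μ‖) ^ (Nat.card F ^ (i + 2)) := by
    refine norm_mul_pow_le_of_close hω ht (by positivity) fun j =>
      (norm_twistCoeff_mulVec_sub_le hB hκ0 (fun k hk => hf k (hi.trans hk))
        ((htn j).trans_lt hκμ) (htA j) (htB j)).trans ?_
    gcongr Nat.card F * ?_ ^ _
    exact htn j
  rw [mul_pow, ← mul_assoc] at hle
  exact (le_of_mul_le_mul_right hle (by positivity)).trans (card_mul_pow_le_sq_pow hκ0 hκ i)

theorem tAct_addSum_twistCoeff_eq_zero (hA : ‖A‖ ≤ 1) (hB : ‖B‖ ≤ 1) {z : Fin n → CInfty F}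
    (hz : ‖z‖ ≤ Nat.card F * torsionRadius F) (hzB : mExp B (Φ.mulVec z) = 0) :
    tAct B (addSum (twistCoeff A B Φ) (mExp A ((theta F)⁻¹ • z))) = 0 := by
  rw [addSum_twistCoeff_mExp hA hB, Matrix.mulVec_smul, tAct_mExp_theta_inv_smul hB, hzB]
  rwa [norm_theta_inv_smul, div_le_iff₀' (card_pos_real F)]

theorem eq_zero_of_forall_norm_le_pow_two_pow {E : Type*} [NormedAddCommGroup E] {x : E} {r : ℝ}
    {d : ℕ} (hr0 : 0 ≤ r) (hr1 : r < 1) (hd : d ≠ 0) (h : ∀ m : ℕ, ‖x‖ ≤ (r ^ 2 ^ m) ^ d) :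
    x = 0 := by
  have hlim := (tendsto_pow_atTop_nhds_zero_of_lt_one hr0 hr1).comp
    (tendsto_pow_atTop_atTop_of_one_lt one_lt_two)
  refine norm_le_zero_iff.mp (ge_of_tendsto' hlim fun m => (h m).trans ?_)
  exact pow_le_of_le_one (by positivity) (pow_le_one₀ hr0 hr1.le) hd

theorem exists_twistCoeff_eq_zero (hω : IsQuadraticGenerator ω) {y : CInfty F}
    (hy : IsNearestRoot y) (hA : ‖A‖ < (Nat.card F : ℝ)⁻¹) (hB : ‖B‖ ≤ 1)
    {l : Fin n ⊕ Fin n → Fin n → CInfty F} (hl : ∀ j, IsCloseVec ω y A j (l j))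
    (hlB : ∀ j, mExp B (Φ.mulVec (l j)) = 0) :
    ∃ N, ∀ i ≥ N, twistCoeff A B Φ i = 0 := by
  have hA1 := norm_le_one_of_lt_inv_card hA
  have hq : (Nat.card F : ℝ)⁻¹ < 1 := inv_lt_one_of_one_lt₀ (one_lt_card_real F)
  have hμ : ‖exp₀ ((theta F)⁻¹ * y)‖ = torsionRadius F :=
    norm_eq_torsionRadius hy.exp₀_theta_inv_mul_ne_zero
      (exp₀_theta_inv_mul_pow hy.exp₀_eq_zero)
  obtain ⟨N, hN⟩ := exists_norm_twistCoeff_le (Φ := Φ) hA1 hB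
  have key : ∀ m : ℕ, ∀ i ≥ N,
      ‖twistCoeff A B Φ i‖ ≤ ((Nat.card F : ℝ)⁻¹ ^ 2 ^ m) ^ (Nat.card F ^ i) := by
    intro m
    induction m with
    | zero => simpa using hN
    | succ m ih =>
      rw [pow_succ, pow_mul]
      refine norm_twistCoeff_le_sq hω hμ hB (t := fun j => mExp A ((theta F)⁻¹ • l j))
        (fun j => ?_) (fun j => ?_) (fun j => ?_) (by positivity)
        (pow_le_of_le_one (by positivity) hq.le (pow_pos two_pos m).ne') ih
      · rw [hμ]
        exact norm_mExp_theta_inv_smul_sub_lt hω hy hA (hl j).2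
      · rw [tAct_mExp_theta_inv_smul hA1, (mem_motiveLattice hA1).mp (hl j).1]
      · exact tAct_addSum_twistCoeff_eq_zero hA1 hB
          (hy.norm_eq ▸ (hl j).norm_le hω.norm_eq_one) (hlB j)
  exact ⟨N, fun i hi => eq_zero_of_forall_norm_le_pow_two_pow (by positivity) hq
    (pow_pos Nat.card_pos i).ne' fun m => key m i hi⟩

end Vanishing

/-! ### Skew polynomial matrices and T-motives -/

section Skew

variable {F : Type*} [Field F] [Finite F] {n : ℕ}

/-- The matrix `X τ^i` over the skew polynomial ring `C_∞[τ]`. -/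
def monMatrix (i : ℕ) : Matrix (Fin n) (Fin n) (CInfty F) →+
    Matrix (Fin n) (Fin n) (SkewPolynomial (CInfty F)) :=
  ((SkewPolynomial.monomial i : CInfty F →ₗ[CInfty F] _).toAddMonoidHom).mapMatrix

/-- The coefficient of `τ^i` of a matrix over `C_∞[τ]`. -/
def coeffMatrix (i : ℕ) : Matrix (Fin n) (Fin n) (SkewPolynomial (CInfty F)) →+
    Matrix (Fin n) (Fin n) (CInfty F) :=
  AddMonoidHom.mapMatrix
    { toFun := fun p => p.coeff i
      map_zero' := rfl
      map_add' := fun p p' => SkewPolynomial.coeff_add p p' i }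

/-- The matrix `θ + A τ + τ^2` by which `T` acts on the basis `e_*` of `M(A)`. -/
def opMatrix (A : Matrix (Fin n) (Fin n) (CInfty F)) :
    Matrix (Fin n) (Fin n) (SkewPolynomial (CInfty F)) :=
  monMatrix 0 (theta F • 1) + monMatrix 1 A + monMatrix 2 1

theorem monMatrix_mul (i k : ℕ) (X Y : Matrix (Fin n) (Fin n) (CInfty F)) :
    monMatrix i X * monMatrix k Y = monMatrix (i + k) (X * Y.map (frob F i)) := by
  ext1 a b
  simp only [monMatrix, AddMonoidHom.mapMatrix_apply, Matrix.map_apply, Matrix.mul_apply, map_sum]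
  refine Finset.sum_congr rfl fun j _ => ?_
  exact (SkewPolynomial.monomial_mul_monomial _ _ _ _).trans
    (by rw [SkewPolynomial.φ_iterate_apply]; rfl)

theorem monMatrix_zero_one :
    monMatrix 0 (1 : Matrix (Fin n) (Fin n) (CInfty F)) = 1 :=
  Matrix.map_one _ (map_zero _) rfl

theorem coeffMatrix_monMatrix (m i : ℕ) (X : Matrix (Fin n) (Fin n) (CInfty F)) :
    coeffMatrix m (monMatrix i X) = if i = m then X else 0 := by
  ext a b
  refine (SkewPolynomial.coeff_monomial ..).trans ?_
  split_ifs <;> rfl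

theorem exists_eq_sum_monMatrix (V : Matrix (Fin n) (Fin n) (SkewPolynomial (CInfty F))) :
    ∃ d, ∀ m ≥ d, V = ∑ i ∈ Finset.range m, monMatrix i (coeffMatrix i V) := by
  obtain ⟨d, hd⟩ := (Finset.univ.biUnion fun a =>
    Finset.univ.biUnion fun b => (V a b).support).exists_nat_subset_range
  refine ⟨d, fun m hm => Matrix.ext fun a b => ?_⟩
  have hs : (V a b).support ⊆ Finset.range m := fun i hi => Finset.range_subset_range.mpr hm <|
    hd (Finset.mem_biUnion.mpr ⟨a, Finset.mem_univ a,
      Finset.mem_biUnion.mpr ⟨b, Finset.mem_univ b, hi⟩⟩)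
  rw [Matrix.sum_apply]
  conv_lhs => rw [← SkewPolynomial.sum_monomial (V a b), SkewPolynomial.sum_def]
  exact Finset.sum_subset hs fun i _ hi => by
    rw [SkewPolynomial.notMem_support_iff.mp hi, map_zero]

theorem monMatrix_mul_opMatrix_sub (A B X : Matrix (Fin n) (Fin n) (CInfty F)) (i : ℕ) :
    monMatrix i X * opMatrix A - opMatrix B * monMatrix i X =
      monMatrix i ((frob F i (theta F) - theta F) • X) +
        monMatrix (i + 1) (X * A.map (frob F i) - B * X.map (frob F 1)) +
        monMatrix (i + 2) (X - X.map (frob F 2)) := by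
  have h1 : (1 : Matrix (Fin n) (Fin n) (CInfty F)).map (frob F i) = 1 :=
    Matrix.map_one _ (map_zero _) (map_one _)
  have hθ : (theta F • (1 : Matrix (Fin n) (Fin n) (CInfty F))).map (frob F i) =
      frob F i (theta F) • 1 := by
    rw [Matrix.map_smul' _ _ _ (map_mul _), h1]
  simp only [opMatrix, mul_add, add_mul, monMatrix_mul, map_frob_zero, h1, hθ, mul_one, one_mul,
    Matrix.mul_smul, Matrix.smul_mul, zero_add, add_zero, add_comm 1 i, add_comm 2 i, sub_smul,
    map_sub]
  abel

theorem sum_monMatrix_mul_opMatrix (A B Φ : Matrix (Fin n) (Fin n) (CInfty F)) (N : ℕ) :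
    (∑ i ∈ Finset.range (N + 2), monMatrix i (twistCoeff A B Φ i)) * opMatrix A -
      opMatrix B * (∑ i ∈ Finset.range (N + 2), monMatrix i (twistCoeff A B Φ i)) =
      monMatrix (N + 2) (defectOne A B Φ (N + 1) + defectTwo A B Φ N) +
        monMatrix (N + 3) (defectTwo A B Φ (N + 1)) := by
  rw [Finset.sum_mul, Finset.mul_sum, ← Finset.sum_sub_distrib]
  have hterm (i : ℕ) : monMatrix i (twistCoeff A B Φ i) * opMatrix A -
      opMatrix B * monMatrix i (twistCoeff A B Φ i) =
      monMatrix i ((frob F i (theta F) - theta F) • twistCoeff A B Φ i) +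
        monMatrix (i + 1) (defectOne A B Φ i) + monMatrix (i + 2) (defectTwo A B Φ i) :=
    monMatrix_mul_opMatrix_sub A B (twistCoeff A B Φ i) i
  simp_rw [hterm]
  induction N with
  | zero =>
    rw [zero_add, Finset.sum_range_succ, Finset.sum_range_one, smul_twistCoeff_one,
      frob_zero_apply, sub_self, zero_smul, map_zero, map_neg, map_add]
    simp only [zero_add]
    abel
  | succ N ih =>
    rw [show N + 1 + 2 = (N + 2) + 1 by ring, Finset.sum_range_succ, ih, smul_twistCoeff_add_two,
      map_neg, map_add, map_add]
    simp only [show N + 1 + 1 = N + 2 by ring, show N + 2 + 1 = N + 3 by ring,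
      show N + 2 + 2 = N + 4 by ring]
    abel

theorem exists_mul_opMatrix_eq {A B Φ : Matrix (Fin n) (Fin n) (CInfty F)} {N : ℕ}
    (h : ∀ i ≥ N, twistCoeff A B Φ i = 0) :
    ∃ f : Matrix (Fin n) (Fin n) (SkewPolynomial (CInfty F)),
      f * opMatrix A = opMatrix B * f ∧ coeffMatrix 0 f = Φ := by
  refine ⟨∑ i ∈ Finset.range (N + 2), monMatrix i (twistCoeff A B Φ i), ?_, ?_⟩
  · have hmap : ∀ k, (0 : Matrix (Fin n) (Fin n) (CInfty F)).map (frob F k) = 0 := fun k =>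
      Matrix.map_zero _ (map_zero _)
    rw [← sub_eq_zero, sum_monMatrix_mul_opMatrix, defectOne, defectTwo, defectTwo, h N le_rfl,
      h (N + 1) N.le_succ, hmap, hmap, zero_mul, mul_zero, sub_zero, add_zero, map_zero, map_zero,
      add_zero]
  · simp only [map_sum, coeffMatrix_monMatrix, Finset.sum_ite_eq', Finset.mem_range]
    rw [if_pos (by lia), twistCoeff]

theorem coeffMatrix_zero_mul (V W : Matrix (Fin n) (Fin n) (SkewPolynomial (CInfty F))) :
    coeffMatrix 0 (V * W) = coeffMatrix 0 V * coeffMatrix 0 W := by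
  obtain ⟨d, hd⟩ := exists_eq_sum_monMatrix V
  obtain ⟨d', hd'⟩ := exists_eq_sum_monMatrix W
  conv_lhs => rw [hd (d + 1) d.le_succ, hd' (d' + 1) d'.le_succ, Finset.sum_mul_sum]
  simp only [Finset.sum_range_succ', monMatrix_mul, map_add, map_sum, coeffMatrix_monMatrix]
  simp [map_frob_zero]

theorem coeffMatrix_mul_opMatrix_sub {A B : Matrix (Fin n) (Fin n) (CInfty F)}
    {V : Matrix (Fin n) (Fin n) (SkewPolynomial (CInfty F))} {m : ℕ}
    (hV : ∀ i < m, coeffMatrix i V = 0) :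
    coeffMatrix m (V * opMatrix A - opMatrix B * V) =
      (frob F m (theta F) - theta F) • coeffMatrix m V := by
  obtain ⟨d, hd⟩ := exists_eq_sum_monMatrix V
  conv_lhs => rw [hd (max d (m + 1)) (le_max_left _ _), Finset.sum_mul, Finset.mul_sum,
    ← Finset.sum_sub_distrib, map_sum]
  refine (Finset.sum_eq_single_of_mem m (Finset.mem_range.mpr (by lia)) fun i _ hi => ?_).trans ?_
  · rcases hi.lt_or_gt with him | him
    · rw [hV i him, map_zero, zero_mul, mul_zero, sub_zero, map_zero]
    · rw [monMatrix_mul_opMatrix_sub, map_add, map_add, coeffMatrix_monMatrix,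
        coeffMatrix_monMatrix, coeffMatrix_monMatrix, if_neg hi, if_neg (by lia), if_neg (by lia),
        add_zero, add_zero]
  · rw [monMatrix_mul_opMatrix_sub, map_add, map_add, coeffMatrix_monMatrix,
      coeffMatrix_monMatrix, coeffMatrix_monMatrix, if_pos rfl, if_neg (by lia), if_neg (by lia),
      add_zero, add_zero]

theorem eq_zero_of_mul_opMatrix_eq {A B : Matrix (Fin n) (Fin n) (CInfty F)}
    {V : Matrix (Fin n) (Fin n) (SkewPolynomial (CInfty F))}
    (hV : V * opMatrix A = opMatrix B * V) (h0 : coeffMatrix 0 V = 0) : V = 0 := by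
  have hcoeff : ∀ m, coeffMatrix m V = 0 := by
    intro m
    induction m using Nat.strong_induction_on with
    | _ m ih =>
      rcases eq_or_ne m 0 with rfl | hm
      · exact h0
      · refine (smul_eq_zero_iff_right (frob_theta_ne F hm)).mp ?_
        rw [← coeffMatrix_mul_opMatrix_sub (A := A) (B := B) ih, hV, sub_self, map_zero]
  exact Matrix.ext fun a b => SkewPolynomial.ext fun m => congrFun (congrFun (hcoeff m) a) b

theorem mul_eq_one_of_mul_opMatrix_eq {A B : Matrix (Fin n) (Fin n) (CInfty F)}
    {f g : Matrix (Fin n) (Fin n) (SkewPolynomial (CInfty F))}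
    (hf : f * opMatrix A = opMatrix B * f) (hg : g * opMatrix B = opMatrix A * g)
    (h0 : coeffMatrix 0 f * coeffMatrix 0 g = 1) : f * g = 1 := by
  refine sub_eq_zero.mp (eq_zero_of_mul_opMatrix_eq (A := B) (B := B) ?_ ?_)
  · rw [sub_mul, mul_sub, one_mul, mul_one, mul_assoc, hg, ← mul_assoc, hf, mul_assoc]
  · rw [map_sub, coeffMatrix_zero_mul, h0, ← monMatrix_zero_one, coeffMatrix_monMatrix, if_pos rfl,
      sub_self]

end Skew

section Motive

variable {F : Type*} [Field F] [Finite F] {n : ℕ}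

/-- The inclusion of the matrices over `C_∞[τ]` into the matrices over `C_∞[T, τ]`. -/
def andMatrix : Matrix (Fin n) (Fin n) (SkewPolynomial (CInfty F)) →+*
    Matrix (Fin n) (Fin n) (AndersonRing F) :=
  Polynomial.C.mapMatrix

theorem andMatrix_opMatrix (A : Matrix (Fin n) (Fin n) (CInfty F)) (i k : Fin n) :
    andMatrix (opMatrix A) i k = andConst F (theta F) * (1 : Matrix _ _ (AndersonRing F)) i k +
      andConst F (A i k) * andTau F + andTau F ^ 2 * (1 : Matrix _ _ (AndersonRing F)) i k := by
  have h1 (c : CInfty F) :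
      andConst F c * andTau F = Polynomial.C (SkewPolynomial.monomial 1 c) := by
    rw [← SkewPolynomial.monomial_mul_X, Polynomial.C_mul]; rfl
  have h2 : andTau F ^ 2 = Polynomial.C (SkewPolynomial.monomial 2 1) := by
    rw [andTau, ← Polynomial.C_pow, SkewPolynomial.monomial_one_right_eq_X_pow]
  have hop : andMatrix (opMatrix A) i k = Polynomial.C
      (SkewPolynomial.monomial 0 ((theta F • (1 : Matrix (Fin n) (Fin n) (CInfty F))) i k) +
        SkewPolynomial.monomial 1 (A i k) +
        SkewPolynomial.monomial 2 ((1 : Matrix (Fin n) (Fin n) (CInfty F)) i k)) := rfl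
  have h0 (c : CInfty F) : Polynomial.C (SkewPolynomial.monomial 0 c) = andConst F c := rfl
  rw [hop, map_add, map_add, h0, h1, h2]
  rcases eq_or_ne i k with rfl | h <;> simp [*]

theorem motiveRel_eq (A : Matrix (Fin n) (Fin n) (CInfty F)) (i : Fin n) :
    motiveRel A i = (Matrix.scalar (Fin n) (andT F) - andMatrix (opMatrix A)) i := by
  funext k
  have hs : (∑ j, (andConst F (A i j) * andTau F) • (Pi.single j 1 : Fin n → AndersonRing F)) k =
      andConst F (A i k) * andTau F := by
    rw [Finset.sum_apply, Finset.sum_eq_single k (fun j _ hj => by simp [hj.symm]) (by simp)]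
    simp
  rw [motiveRel, Pi.sub_apply, Pi.add_apply, Pi.add_apply, hs, Matrix.sub_apply,
    andMatrix_opMatrix]
  simp [Pi.single_apply, Matrix.one_apply, Matrix.diagonal_apply, eq_comm]

theorem vecMul_motiveRel {A B : Matrix (Fin n) (Fin n) (CInfty F)}
    {f : Matrix (Fin n) (Fin n) (SkewPolynomial (CInfty F))}
    (hf : f * opMatrix A = opMatrix B * f) (i : Fin n) :
    Matrix.vecMul (motiveRel B i) (andMatrix f) = ∑ j, andMatrix f i j • motiveRel A j := by
  have hT : Commute (Matrix.scalar (Fin n) (andT F)) (andMatrix f) :=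
    Matrix.scalar_commute _ (fun p => Polynomial.commute_X p) _
  calc Matrix.vecMul (motiveRel B i) (andMatrix f)
      = ((Matrix.scalar (Fin n) (andT F) - andMatrix (opMatrix B)) * andMatrix f) i := by
        rw [motiveRel_eq]; rfl
    _ = (andMatrix f * (Matrix.scalar (Fin n) (andT F) - andMatrix (opMatrix A))) i := by
        rw [sub_mul, mul_sub, hT.eq, ← map_mul, ← map_mul, hf]
    _ = ∑ j, andMatrix f i j • motiveRel A j := by
        simp_rw [motiveRel_eq]
        funext k
        rw [Matrix.mul_apply, Finset.sum_apply]
        rfl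

theorem span_motiveRel_le_comap {A B : Matrix (Fin n) (Fin n) (CInfty F)}
    {f : Matrix (Fin n) (Fin n) (SkewPolynomial (CInfty F))}
    (hf : f * opMatrix A = opMatrix B * f) :
    Submodule.span (AndersonRing F) (Set.range (motiveRel B)) ≤
      (Submodule.span (AndersonRing F) (Set.range (motiveRel A))).comap
        (Matrix.vecMulLinear (andMatrix f)) := by
  rw [Submodule.span_le]
  rintro _ ⟨i, rfl⟩
  rw [SetLike.mem_coe, Submodule.mem_comap, Matrix.vecMulLinear_apply, vecMul_motiveRel hf]
  exact Submodule.sum_mem _ fun j _ => Submodule.smul_mem _ _ (Submodule.subset_span ⟨j, rfl⟩)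

theorem nonempty_motive_equiv {A B : Matrix (Fin n) (Fin n) (CInfty F)}
    {f g : Matrix (Fin n) (Fin n) (SkewPolynomial (CInfty F))}
    (hf : f * opMatrix A = opMatrix B * f) (hg : g * opMatrix B = opMatrix A * g)
    (hfg : f * g = 1) (hgf : g * f = 1) :
    Nonempty (Motive A ≃ₗ[AndersonRing F] Motive B) := by
  have hid {M N : Matrix (Fin n) (Fin n) (SkewPolynomial (CInfty F))} (h : M * N = 1)
      (v : Fin n → AndersonRing F) :
      Matrix.vecMul (Matrix.vecMul v (andMatrix M)) (andMatrix N) = v := by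
    rw [Matrix.vecMul_vecMul, ← map_mul, h, map_one, Matrix.vecMul_one]
  refine ⟨LinearEquiv.ofLinearMap (Submodule.mapQ _ _ _ (span_motiveRel_le_comap hg))
    (Submodule.mapQ _ _ _ (span_motiveRel_le_comap hf)) ?_ ?_⟩
  · exact Submodule.linearMap_qext _ (LinearMap.ext fun v =>
      congrArg Submodule.Quotient.mk (hid hfg v))
  · exact Submodule.linearMap_qext _ (LinearMap.ext fun v =>
      congrArg Submodule.Quotient.mk (hid hgf v))

theorem nonempty_motive_equiv_of_twistCoeff {A B Φ Φ' : Matrix (Fin n) (Fin n) (CInfty F)}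
    {N N' : ℕ} (hΦ : Φ * Φ' = 1) (hf : ∀ i ≥ N, twistCoeff A B Φ i = 0)
    (hg : ∀ i ≥ N', twistCoeff B A Φ' i = 0) :
    Nonempty (Motive A ≃ₗ[AndersonRing F] Motive B) := by
  obtain ⟨f, hfT, rfl⟩ := exists_mul_opMatrix_eq hf
  obtain ⟨g, hgT, rfl⟩ := exists_mul_opMatrix_eq hg
  exact nonempty_motive_equiv hfT hgT (mul_eq_one_of_mul_opMatrix_eq hfT hgT hΦ)
    (mul_eq_one_of_mul_opMatrix_eq hgT hfT (mul_eq_one_comm.mp hΦ))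

end Motive

/-! ### Siegel matrices and the isomorphism -/

section Siegel

variable {F : Type*} [Field F] [Finite F] {n : ℕ} {l l' : Fin n ⊕ Fin n → Fin n → CInfty F}
  {L L' : Submodule F[X] (Fin n → CInfty F)} {Z : Matrix (Fin n) (Fin n) (CInfty F)}
  {γ : Matrix.GeneralLinearGroup (Fin n ⊕ Fin n) F[X]}

/-- The denominator `c Z + d` of `γ(Z)`. -/
def siegelDenom (γ : Matrix.GeneralLinearGroup (Fin n ⊕ Fin n) F[X])
    (Z : Matrix (Fin n) (Fin n) (CInfty F)) : Matrix (Fin n) (Fin n) (CInfty F) :=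
  ((algebraMap F[X] (CInfty F)).mapMatrix γ.val).toBlocks₂₁ * Z +
    ((algebraMap F[X] (CInfty F)).mapMatrix γ.val).toBlocks₂₂

/-- The homogeneous coordinates `(Z, E_n)^t` of `Z`, on which `γ` acts linearly. -/
def homogCoord (Z : Matrix (Fin n) (Fin n) (CInfty F)) :
    Matrix (Fin n ⊕ Fin n) (Fin n) (CInfty F) :=
  Matrix.fromRows Z 1

/-- The `2n × n` matrix with rows `l_{n+1}, ..., l_{2n}, l_1, ..., l_n`, swapped to match the
blocks of `homogCoord`. -/
def siegelFrame (l : Fin n ⊕ Fin n → Fin n → CInfty F) :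
    Matrix (Fin n ⊕ Fin n) (Fin n) (CInfty F) :=
  Matrix.of fun j => l j.swap

theorem isUnit_det_of_linearIndependent_inl
    (hl : LinearIndependent (CInfty F) fun i => l (Sum.inl i)) :
    IsUnit (Matrix.of fun i => l (Sum.inl i)).det :=
  (Matrix.isUnit_iff_isUnit_det _).mp (Matrix.linearIndependent_rows_iff_isUnit.mp hl)

theorem siegelMatrix_mul (hl : LinearIndependent (CInfty F) fun i => l (Sum.inl i)) :
    siegelMatrix l * Matrix.of (fun i => l (Sum.inl i)) = Matrix.of fun i => l (Sum.inr i) :=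
  Matrix.nonsing_inv_mul_cancel_right _ _ (isUnit_det_of_linearIndependent_inl hl)

theorem siegelFrame_eq (hl : LinearIndependent (CInfty F) fun i => l (Sum.inl i)) :
    siegelFrame l = homogCoord (siegelMatrix l) * Matrix.of fun i => l (Sum.inl i) := by
  rw [homogCoord, Matrix.fromRows_mul, siegelMatrix_mul hl, one_mul]
  ext (i | i) k <;> rfl

theorem IsSiegelBasis.mem (hl : IsSiegelBasis L l) (j : Fin n ⊕ Fin n) : l j ∈ L :=
  hl.span_eq ▸ Submodule.subset_span ⟨j, rfl⟩

theorem siegelMatrix_row_ne_zero (hl : IsSiegelBasis L l) (i : Fin n) : siegelMatrix l i ≠ 0 := by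
  intro h
  refine hl.linearIndependent.ne_zero (Sum.inr i) ?_
  calc l (Sum.inr i) = (siegelMatrix l * Matrix.of fun i => l (Sum.inl i)) i := by
        rw [siegelMatrix_mul hl.linearIndependent_inl]; rfl
    _ = 0 := by rw [Matrix.mul_apply_eq_vecMul, h, Matrix.zero_vecMul]

-- Otherwise the junk value `(c Z + d)⁻¹ = 0` would make `γ(Z)` vanish.
theorem isUnit_det_siegelDenom (h : ∀ i, siegelAct γ Z i ≠ 0) :
    IsUnit (siegelDenom γ Z).det := by
  by_contra hD
  have h0 : siegelAct γ Z = 0 :=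
    (congrArg (_ * ·) (Matrix.nonsing_inv_apply_not_isUnit _ hD)).trans (mul_zero _)
  rcases isEmpty_or_nonempty (Fin n) with _ | ⟨⟨i⟩⟩
  · exact hD (by rw [Matrix.det_isEmpty]; exact isUnit_one)
  · exact h i (congrFun h0 i)

theorem homogCoord_siegelAct_mul_siegelDenom (hD : IsUnit (siegelDenom γ Z).det) :
    homogCoord (siegelAct γ Z) * siegelDenom γ Z =
      (algebraMap F[X] (CInfty F)).mapMatrix γ.val * homogCoord Z := by
  conv_rhs => rw [← Matrix.fromBlocks_toBlocks ((algebraMap F[X] (CInfty F)).mapMatrix γ.val)]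
  rw [homogCoord, homogCoord, Matrix.fromBlocks_mul_fromRows, Matrix.fromRows_mul, mul_one, mul_one,
    one_mul]
  exact congrArg (Matrix.fromRows · _) (Matrix.nonsing_inv_mul_cancel_right _ _ hD)

theorem map_algebraMap_mul_siegelFrame_mem (hl : ∀ j, l j ∈ L)
    (g : Matrix (Fin n ⊕ Fin n) (Fin n ⊕ Fin n) F[X]) (j : Fin n ⊕ Fin n) :
    ((algebraMap F[X] (CInfty F)).mapMatrix g * siegelFrame l) j ∈ L := by
  have hsum : ((algebraMap F[X] (CInfty F)).mapMatrix g * siegelFrame l) j =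
      ∑ k, g j k • siegelFrame l k := by
    funext i
    rw [Matrix.mul_apply, Finset.sum_apply]
    exact Finset.sum_congr rfl fun k _ => (Algebra.smul_def (g j k) _).symm
  rw [hsum]
  exact Submodule.sum_mem _ fun k _ => Submodule.smul_mem _ _ (hl k.swap)

theorem mulVec_transpose_mem_of_siegelFrame_mul_eq {Ψ : Matrix (Fin n) (Fin n) (CInfty F)}
    {g : Matrix (Fin n ⊕ Fin n) (Fin n ⊕ Fin n) F[X]} (hl' : ∀ j, l' j ∈ L')
    (h : siegelFrame l * Ψ = (algebraMap F[X] (CInfty F)).mapMatrix g * siegelFrame l')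
    (j : Fin n ⊕ Fin n) : Ψ.transpose.mulVec (l j) ∈ L' := by
  have hmem := map_algebraMap_mul_siegelFrame_mem hl' g j.swap
  rw [← h, Matrix.mul_apply_eq_vecMul] at hmem
  rwa [Matrix.mulVec_transpose, ← Sum.swap_swap j]

theorem exists_siegelFrame_mul_eq (hl : IsSiegelBasis L l) (hl' : IsSiegelBasis L' l')
    (h : siegelMatrix l = siegelAct γ (siegelMatrix l')) :
    ∃ Ψ : Matrix (Fin n) (Fin n) (CInfty F), IsUnit Ψ.det ∧
      siegelFrame l * Ψ = (algebraMap F[X] (CInfty F)).mapMatrix γ.val * siegelFrame l' := by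
  have hP := isUnit_det_of_linearIndependent_inl hl.linearIndependent_inl
  have hP' := isUnit_det_of_linearIndependent_inl hl'.linearIndependent_inl
  have hD := isUnit_det_siegelDenom fun i => h ▸ siegelMatrix_row_ne_zero hl i
  refine ⟨(Matrix.of fun i => l (Sum.inl i))⁻¹ * siegelDenom γ (siegelMatrix l') *
    Matrix.of fun i => l' (Sum.inl i), ?_, ?_⟩
  · rw [Matrix.det_mul, Matrix.det_mul]
    exact ((Matrix.isUnit_nonsing_inv_det _ hP).mul hD).mul hP'
  · rw [siegelFrame_eq hl.linearIndependent_inl, siegelFrame_eq hl'.linearIndependent_inl,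
      ← Matrix.mul_assoc, ← Matrix.mul_assoc, ← Matrix.mul_assoc,
      Matrix.mul_nonsing_inv_cancel_right _ _ hP, h, homogCoord_siegelAct_mul_siegelDenom hD]

theorem exists_mulVec_mem_of_siegelMatrix_eq (hl : IsSiegelBasis L l) (hl' : IsSiegelBasis L' l')
    (h : siegelMatrix l = siegelAct γ (siegelMatrix l')) :
    ∃ Φ Φ' : Matrix (Fin n) (Fin n) (CInfty F), Φ * Φ' = 1 ∧
      (∀ j, Φ.mulVec (l j) ∈ L') ∧ ∀ j, Φ'.mulVec (l' j) ∈ L := by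
  obtain ⟨Ψ, hΨ, hframe⟩ := exists_siegelFrame_mul_eq hl hl' h
  have hframe' : siegelFrame l' * Ψ⁻¹ =
      (algebraMap F[X] (CInfty F)).mapMatrix γ⁻¹.val * siegelFrame l := by
    have hγ : (algebraMap F[X] (CInfty F)).mapMatrix γ⁻¹.val *
        (algebraMap F[X] (CInfty F)).mapMatrix γ.val = 1 := by
      rw [← map_mul, ← Units.val_mul, inv_mul_cancel, Units.val_one, map_one]
    rw [← Matrix.mul_nonsing_inv_cancel_right Ψ (siegelFrame l) hΨ, hframe, ← Matrix.mul_assoc,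
      ← Matrix.mul_assoc, hγ, Matrix.one_mul]
  refine ⟨Ψ.transpose, Ψ⁻¹.transpose, ?_,
    mulVec_transpose_mem_of_siegelFrame_mul_eq hl'.mem hframe,
    mulVec_transpose_mem_of_siegelFrame_mul_eq hl.mem hframe'⟩
  rw [← Matrix.transpose_mul, Matrix.nonsing_inv_mul _ hΨ, Matrix.transpose_one]

theorem nonempty_motive_equiv_of_mu13_eq {ω y : CInfty F} (hω : IsQuadraticGenerator ω)
    (hy : IsNearestRoot y) {A B : Matrix (Fin n) (Fin n) (CInfty F)}
    (hA : ‖A‖ < (Nat.card F : ℝ)⁻¹) (hB : ‖B‖ < (Nat.card F : ℝ)⁻¹)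
    (h : mu13 ω y A = siegelAct γ (mu13 ω y B)) :
    Nonempty (Motive A ≃ₗ[AndersonRing F] Motive B) := by
  have hlA := isCloseVec_closeVec hω hy hA
  have hlB := isCloseVec_closeVec hω hy hB
  have hA1 := norm_le_one_of_lt_inv_card hA
  have hB1 := norm_le_one_of_lt_inv_card hB
  obtain ⟨Φ, Φ', hΦ, hAB, hBA⟩ := exists_mulVec_mem_of_siegelMatrix_eq
    (isSiegelBasis_of_isCloseVec hω hy hA hlA) (isSiegelBasis_of_isCloseVec hω hy hB hlB) h
  obtain ⟨N, hN⟩ := exists_twistCoeff_eq_zero hω hy hA hB1 hlA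
    fun j => (mem_motiveLattice hB1).mp (hAB j)
  obtain ⟨N', hN'⟩ := exists_twistCoeff_eq_zero hω hy hB hA1 hlB
    fun j => (mem_motiveLattice hA1).mp (hBA j)
  exact nonempty_motive_equiv_of_twistCoeff hΦ hN hN'

theorem isOpen_setOf_forall_norm_apply_lt (r : ℝ) :
    IsOpen {A : Matrix (Fin n) (Fin n) (CInfty F) | ∀ i j, ‖A i j‖ < r} := by
  simp only [Set.ofPred_forall]
  exact isOpen_iInter_of_finite fun i => isOpen_iInter_of_finite fun j =>
    isOpen_lt (continuous_id.matrix_elem i j).norm continuous_const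

end Siegel

end TMotive

end

theorem theorem3_general {F : Type*} [Field F] [Finite F] (n : ℕ) (ω y₀ : TMotive.CInfty F)
    (hω : ω ^ (Nat.card F ^ 2) = ω) (hω' : ω ^ Nat.card F ≠ ω)
    (hy₀ : TMotive.IsNearestRoot y₀) :
    ∃ U : Set (Matrix (Fin n) (Fin n) (TMotive.CInfty F)),
      IsOpen U ∧ 0 ∈ U ∧ U ⊆ TMotive.domain13 n ω y₀ ∧
      ∀ A ∈ U, ∀ B ∈ U, ∀ γ : Matrix.GeneralLinearGroup (Fin n ⊕ Fin n) F[X],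
        TMotive.mu13 ω y₀ A = TMotive.siegelAct γ (TMotive.mu13 ω y₀ B) →
        Nonempty (TMotive.Motive A ≃ₗ[TMotive.AndersonRing F] TMotive.Motive B) := by
  have hq : 0 < (Nat.card F : ℝ)⁻¹ := inv_pos.mpr (TMotive.card_pos_real F)
  have hgen : TMotive.IsQuadraticGenerator ω := ⟨hω, hω'⟩
  refine ⟨{A | ∀ i j, ‖A i j‖ < (Nat.card F : ℝ)⁻¹},
    TMotive.isOpen_setOf_forall_norm_apply_lt _, fun i j => ?_, fun A hA => ?_,
    fun A hA B hB γ h => ?_⟩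
  · rwa [Matrix.zero_apply, norm_zero]
  · exact TMotive.mem_domain13 hgen hy₀ ((Matrix.norm_lt_iff hq).mpr hA)
  · exact TMotive.nonempty_motive_equiv_of_mu13_eq hgen hy₀ ((Matrix.norm_lt_iff hq).mpr hA)
      ((Matrix.norm_lt_iff hq).mpr hB) h

theorem theorem3 {F : Type*} [Field F] [Finite F] (n : ℕ) (ω y₀ : TMotive.CInfty F)
    (hω : ω ^ (Nat.card F ^ 2) = ω) (hω' : ω ^ Nat.card F ≠ ω)
    (hy₀ : TMotive.IsNearestRoot y₀) (k : ℕ) :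
    ∃ U : Set (Matrix (Fin n) (Fin n) (TMotive.CInfty F)),
      IsOpen U ∧ 0 ∈ U ∧ U ⊆ TMotive.domain13 n ω y₀ ∧
      ∀ A ∈ U, ∀ B ∈ U, ∀ γ ∈ TMotive.stabilizer0 n ω, TMotive.glDegree γ ≤ k →
        TMotive.mu13 ω y₀ A = TMotive.siegelAct γ (TMotive.mu13 ω y₀ B) →
        Nonempty (TMotive.Motive A ≃ₗ[TMotive.AndersonRing F] TMotive.Motive B) := by
  obtain ⟨U, hU, h0, hdom, hiso⟩ := theorem3_general n ω y₀ hω hω' hy₀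
  exact ⟨U, hU, h0, hdom, fun A hA B hB γ _ _ => hiso A hA B hB γ⟩
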